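/- Let $k$ be an algebraically closed field of characteristic zero, $R=k[[t]]$, $R_n=R/(t^{n+1})$ and $K=k((t))$. Fix an algebraic closure $K^{alg}$ of $K$ and, for every $d>0$, a $d$-th root $\sqrt[d]{t}\in K^{alg}$ of $t$, such that $(\sqrt[de]{t})^e=\sqrt[d]{t}$ for all $d,e>0$. Put $K(d)=K(\sqrt[d]{t})$ and let $R(d)$ be the integral closure of $R$ in $K(d)$. For a separated $k$-scheme $X$ of finite type, let $\mathcal L(X)$ be its arc scheme, whose points with values in a $k$-algebra $A$ are $\mathcal L(X)(A)=\varprojlim_n X(A\otimes_k R_n)$, let $\pi_0:\mathcal L(X)\to X$ be the projection that sends an arc to its origin, and, for $\xi\in k^\times$, write $\psi(\xi t)$ for the arc obtained from an arc $\psi$ by the substitution $t\mapsto \xi t$. For a separated $R$-scheme $Y$ of finite type, let $\widehat Y$ be its $t$-adic completion (the formal $R$-scheme given by the schemes $Y\times_R R_n$, $n\ge 0$) and $\widehat Y_\eta$ the generic fiber of $\widehat Y$, a rigid analytic $K$-variety. For a finite extension $L$ of $K$, with integral closure $R_L$ of $R$ in $L$, write $\widehat Y_\eta(L)$ for the set of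 morphisms $\mathrm{Sp}\,L\to\widehat Y_\eta$ of rigid $K$-varieties. The specialization map $sp:\widehat Y_\eta(L)\to Y_0(k)$, where $Y_0=Y\times_R k$, sends a point to the reduction, modulo the maximal ideal of $R_L$, of the section of $\widehat Y$ over $\mathrm{Spf}\,R_L$ whose generic fiber it is. **Relative case.** Let $X$ be a smooth, irreducible, separated $k$-scheme of finite type and $f:X\to\mathbb A^1_k=\mathrm{Spec}\,k[t]$ a dominant morphism over $k$. Let $\widehat X$ be the $t$-adic completion of $X_R=X\times_{k[t]}k[[t]]$; its special fiber $X_0$ is the fiber of $f$ over the origin. For $d>0$ let $\mathcal X(d)\subset\mathcal L(X)$ be the closed subscheme of arcs $\psi$ with $f(\psi)=t^d$. Then for every $d>0$: 1. There is a ring isomorphism $\varphi_d:R(d)\to k[[t]]$ with $\varphi_d(\sqrt[d]{t})=t$ and $\varphi_d(b(t))=b(t^d)$ for all $b\in R$, and there is an isomorphism of groups $\mu_d(k)\cong \mathrm{Gal}(K(d)/K)$ under which $\xi\in\mu_d(k)$ acts by $\sqrt[d]{t}\mapsto\xi\sqrt[d]{t}$. 2. There is a bijection $$\varphi:\widehat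 X_\eta(K(d))\longrightarrow\mathcal X(d)(k),$$ characterized as follows: for a morphism of $k$-schemes $\psi:\mathrm{Spec}\,k[[t]]\to X$ with $f(\psi)=t^d$, and $P\in\widehat X_\eta(K(d))$, one has $\varphi(P)=\psi$ if and only if $P$ is the generic fiber of the $t$-adic completion of a morphism of $R$-schemes $\mathrm{Spec}\,R(d)\to X_R$ whose composition with $X_R\to X$ is $\psi\circ\mathrm{Spec}(\varphi_d^{-1})$. 3. Every $P\in\widehat X_\eta(K(d))$ specializes to exactly one point $sp(P)\in X_0(k)$, and $sp(P)=\pi_0(\varphi(P))$. 4. For all $P\in\widehat X_\eta(K(d))$ and $\xi\in\mu_d(k)=\mathrm{Gal}(K(d)/K)$, if $\psi=\varphi(P)$ then $\varphi(\xi\cdot P)=\psi(\xi t)$. **Absolute case.** Let $X$ be any separated $k$-scheme of finite type, $X_R=X\times_kR$, and $\widehat X$ the $t$-adic completion of $X_R$. Then truncation $X(k[[t]])\to\mathcal L(X)(k)$, from the set of $k$-morphisms $\mathrm{Spec}\,k[[t]]\to X$, is bijective (so $\mathcal L(X)(k)=X_R(R)$), and there is a bijection $$\varphi:\mathcal L(X)(k)\longrightarrow\widehat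 X_\eta(K),$$ characterized as follows: for a $k$-morphism $\psi:\mathrm{Spec}\,k[[t]]\to X$ and $P\in\widehat X_\eta(K)$, one has $\varphi(\psi)=P$ if and only if $P$ is the generic fiber of the $t$-adic completion of the section $\mathrm{Spec}\,R\to X_R$ induced by $\psi$. For every $\gamma\in\mathcal L(X)(k)$ the point $\varphi(\gamma)$ specializes to exactly one point of $X_0(k)=X(k)$, and $sp(\varphi(\gamma))=\pi_0(\gamma)$. -/

import Mathlib

open CategoryTheory AlgebraicGeometry TensorProduct Opposite
open scoped PowerSeries LaurentSeries

universe u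

noncomputable section

namespace RigidArc

/-! ### Affinoid algebras and affinoid spaces -/

section Affinoid

variable (R : Type u) [CommRing R] (π : R) (K : Type u) [Field K] [Algebra R K]

/-- The algebra `R{x₁, …, xₘ}` of converging power series: the `π`-adic completion
`lim R[x]/(π^n)` of the polynomial ring. -/
abbrev ConvergingPowerSeries (m : ℕ) : Type u :=
  AdicCompletion (Ideal.span {algebraMap R (MvPolynomial (Fin m) R) π}) (MvPolynomial (Fin m) R)

/-- The Tate algebra `T_m = K{x₁, …, xₘ} = R{x₁, …, xₘ} ⊗_R K`. -/
abbrev TateAlgebra (m : ℕ) : Type u := K ⊗[R] ConvergingPowerSeries R π m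

/-- A `K`-affinoid algebra is a `K`-algebra isomorphic to a quotient of a Tate algebra. -/
def IsAffinoid (B : Type u) [CommRing B] [Algebra K B] : Prop :=
  ∃ (m : ℕ) (q : TateAlgebra R π K m →ₐ[K] B), Function.Surjective q

/-- The objects of the category of `K`-affinoid spaces. -/
structure AffinoidSpace where
  /-- The algebra of analytic functions. -/
  functions : Type u
  [commRing : CommRing functions]
  [algebra : Algebra K functions]
  isAffinoid : IsAffinoid R π K functions

attribute [instance] AffinoidSpace.commRing AffinoidSpace.algebra

variable {R π K}

namespace AffinoidSpace

/-- A morphism `Y ⟶ X` of affinoid spaces is a morphism of `K`-algebras `A(X) → A(Y)`. -/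
structure Hom (Y X : AffinoidSpace R π K) where
  /-- The map on analytic functions. -/
  pullback : X.functions →ₐ[K] Y.functions

instance : Category (AffinoidSpace R π K) where
  Hom := Hom
  id X := ⟨AlgHom.id K X.functions⟩
  comp h g := ⟨h.pullback.comp g.pullback⟩

/-- The set `h^♭(Y^♭)`, realised as a set of ideals of `A(X)`, where `Y^♭` is the set of maximal
ideals of `A(Y)`. -/
def imagePoints {Y X : AffinoidSpace R π K} (h : Y ⟶ X) : Set (Ideal X.functions) :=
  {x | ∃ y : Ideal Y.functions, y.IsMaximal ∧ y.comap h.pullback = x}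

/-- Open immersions of affinoid spaces. -/
def IsOpenImmersion {Y X : AffinoidSpace R π K} (h : Y ⟶ X) : Prop :=
  ∀ (Z : AffinoidSpace R π K) (g : Z ⟶ X), imagePoints g ⊆ imagePoints h →
    ∃! g' : Z ⟶ Y, g' ≫ h = g

/-- The affinoid covers: finite sets of open immersions whose images cover the set of maximal
ideals of `A(X)`. -/
def affinoidCovers : Precoverage (AffinoidSpace R π K) where
  coverings X := {S | ∃ (n : ℕ) (U : Fin n → AffinoidSpace R π K) (j : ∀ i, U i ⟶ X),
    (∀ i, IsOpenImmersion (j i)) ∧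
    (∀ x : Ideal X.functions, x.IsMaximal → ∃ i, x ∈ imagePoints (j i)) ∧
    S = Presieve.ofArrows U j}

/-- The Grothendieck topology on the category of affinoid spaces generated by affinoid covers. -/
def topology : GrothendieckTopology (AffinoidSpace R π K) :=
  affinoidCovers.toGrothendieck

end AffinoidSpace

/-- If `R` is Noetherian and `π`-adically complete, finite `R`-algebras are `π`-adically
complete. -/
theorem isAdicComplete_of_finite [IsNoetherianRing R] [IsAdicComplete (Ideal.span {π}) R]
    (S : Type u) [CommRing S] [Algebra R S] [Module.Finite R S] :
    IsAdicComplete (Ideal.span {algebraMap R S π}) S := by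
  have hmap : Ideal.span {algebraMap R S π} = (Ideal.span {π}).map (algebraMap R S) := by
    rw [Ideal.map_span, Set.image_singleton]
  rw [hmap]
  have hH : IsHausdorff (Ideal.span {π}) S :=
    .of_le_jacobson _ _ (IsAdicComplete.le_jacobson_bot _)
  have hP : IsAdicComplete (Ideal.span {π}) S := by
    rw [← AdicCompletion.of_bijective_iff]
    refine ⟨AdicCompletion.of_injective _ _, fun x => ?_⟩
    obtain ⟨y, rfl⟩ := AdicCompletion.ofTensorProduct_surjective_of_finite (Ideal.span {π}) S x
    induction y with
    | zero => exact ⟨0, by simp⟩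
    | add a b ha hb =>
      obtain ⟨a', ha⟩ := ha
      obtain ⟨b', hb⟩ := hb
      exact ⟨a' + b', by rw [map_add, ha, hb, map_add]⟩
    | tmul a s =>
      obtain ⟨r, rfl⟩ := (AdicCompletion.of_bijective (Ideal.span {π}) R).2 a
      refine ⟨r • s, ?_⟩
      rw [AdicCompletion.ofTensorProduct_tmul, map_smul]
      ext n
      rfl
  exact { toIsHausdorff := IsHausdorff.map_algebraMap_iff.2 hP.toIsHausdorff
          toIsPrecomplete := IsPrecomplete.map_algebraMap_iff.2 hP.toIsPrecomplete }

/-- An algebra map to a complete algebra extends to the adic completion. -/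
theorem exists_lift_adicCompletion {P S : Type u} [CommRing P] [CommRing S] [Algebra R P]
    [Algebra R S] (I : Ideal P) (J : Ideal S) [IsAdicComplete J S] (ev : P →ₐ[R] S)
    (h : I ≤ J.comap ev) :
    ∃ g : AdicCompletion I P →ₐ[R] S, ∀ p, g (AdicCompletion.of I P p) = ev p := by
  have hn : ∀ n, I ^ n ≤ (J ^ n).comap ev := fun n =>
    (Ideal.pow_right_mono h n).trans (Ideal.le_comap_pow _ _)
  let fn : ∀ n, AdicCompletion I P →ₐ[R] S ⧸ J ^ n := fun n =>
    (Ideal.quotientMapₐ (J ^ n) ev (hn n)).comp ((AdicCompletion.evalₐ I n).restrictScalars R)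
  have hfn : ∀ n (a : AdicCompletion.AdicCauchySequence I P),
      fn n (AdicCompletion.mk I P a) = Ideal.Quotient.mk (J ^ n) (ev (a.val n)) := fun n a => by
    simp only [fn, AlgHom.comp_apply, AlgHom.restrictScalars_apply, AdicCompletion.evalₐ_mk]
    rfl
  have hcompat : ∀ {m n : ℕ} (hle : m ≤ n),
      (Ideal.Quotient.factorₐ R (Ideal.pow_le_pow_right hle)).comp (fn n) = fn m := by
    intro m n hle
    ext y
    induction y using AdicCompletion.induction_on with
    | h a =>
      rw [AlgHom.comp_apply, hfn, hfn]
      refine Ideal.Quotient.eq.2 ?_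
      rw [← map_sub]
      refine hn m ?_
      have := (a.property hle).symm
      rw [smul_eq_mul, Ideal.mul_top] at this
      exact SModEq.sub_mem.1 this
  refine ⟨IsAdicComplete.liftAlgHom J fn hcompat, fun p => ?_⟩
  refine (IsHausdorff.eq_iff_smodEq (I := J)).2 fun n => ?_
  rw [smul_eq_mul, Ideal.mul_top]
  refine SModEq.def.2 ?_
  refine (IsAdicComplete.mk_liftAlgHom J fn hcompat n _).trans ?_
  simp only [fn, AlgHom.comp_apply, AlgHom.restrictScalars_apply, AdicCompletion.evalₐ_of]
  rfl

/-- A finite field extension of `K` is a `K`-affinoid algebra. -/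
theorem isAffinoid_of_finiteDimensional [IsDomain R] [IsNoetherianRing R]
    [IsAdicComplete (Ideal.span {π}) R] [IsFractionRing R K] (L : Type u) [Field L] [Algebra K L]
    [FiniteDimensional K L] : IsAffinoid R π K L := by
  let _ : Algebra R L := ((algebraMap K L).comp (algebraMap R K)).toAlgebra
  have : IsScalarTower R K L := .of_algebraMap_eq fun _ => rfl
  let b := Module.finBasis K L
  have : Algebra.IsAlgebraic R L := (IsFractionRing.comap_isAlgebraic_iff (K := K)).2 inferInstance
  classical
  obtain ⟨r, hr, hint⟩ := Algebra.IsAlgebraic.exists_integral_multiples R (Finset.univ.image b)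
  let x : Fin (Module.finrank K L) → L := fun i => r • b i
  have hx : ∀ i, IsIntegral R (x i) := fun i => hint _ (by simp)
  let S := Algebra.adjoin R (Set.range x)
  have : Module.Finite R S := by
    refine (Module.Finite.iff_fg (N := Subalgebra.toSubmodule S)).2 ?_
    exact fg_adjoin_of_finite (Set.finite_range x) (by rintro _ ⟨i, rfl⟩; exact hx i)
  have := isAdicComplete_of_finite (R := R) (π := π) S
  let P := MvPolynomial (Fin (Module.finrank K L)) R
  let ev : P →ₐ[R] S := MvPolynomial.aeval fun i => ⟨x i, Algebra.subset_adjoin ⟨i, rfl⟩⟩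
  let I : Ideal P := Ideal.span {algebraMap R P π}
  let J : Ideal S := Ideal.span {algebraMap R S π}
  have hIJ : I ≤ J.comap ev := by
    simp only [I, Ideal.span_singleton_le_iff_mem, Ideal.mem_comap, AlgHom.commutes]
    exact Ideal.mem_span_singleton_self _
  obtain ⟨g, hg'⟩ := exists_lift_adicCompletion I J ev hIJ
  have hg : ∀ i, g (AdicCompletion.of I P (MvPolynomial.X i)) =
      ⟨x i, Algebra.subset_adjoin ⟨i, rfl⟩⟩ := fun i => by
    rw [hg', MvPolynomial.aeval_X]
  let q : TateAlgebra R π K (Module.finrank K L) →ₐ[K] L :=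
    Algebra.TensorProduct.lift (Algebra.ofId K L) (S.val.comp g) fun _ _ => .all _ _
  refine ⟨_, q, fun y => ?_⟩
  have hr' : algebraMap R K r ≠ 0 := by simpa using hr
  refine ⟨∑ i, (b.repr y i * (algebraMap R K r)⁻¹) ⊗ₜ AdicCompletion.of I P (MvPolynomial.X i), ?_⟩
  rw [map_sum]
  conv_rhs => rw [← b.sum_repr y]
  refine Finset.sum_congr rfl fun i _ => ?_
  refine (Algebra.TensorProduct.lift_tmul _ _ _ _ _).trans ?_
  rw [AlgHom.comp_apply, hg, Algebra.ofId_apply, Subalgebra.val_apply]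
  simp only [x]
  rw [← algebraMap_smul K r (b i), Algebra.smul_def (algebraMap R K r), ← mul_assoc, ← map_mul,
    mul_assoc, inv_mul_cancel₀ hr', mul_one, Algebra.smul_def]

/-- The affinoid space `Sp L` of a finite extension `L` of `K`. -/
def AffinoidSpace.Sp (R : Type u) [CommRing R] (π : R) (K : Type u) [Field K] [Algebra R K]
    [IsDomain R] [IsNoetherianRing R] [IsAdicComplete (Ideal.span {π}) R] [IsFractionRing R K]
    (L : Type u) [Field L] [Algebra K L] [FiniteDimensional K L] : AffinoidSpace R π K where
  functions := L
  isAffinoid := isAffinoid_of_finiteDimensional L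

end Affinoid

/-! ### Formal schemes -/

section Formal

/-- The quotient `A/(a^(n+1))`; for `A = R` and `a = π` this is `R_n`. -/
abbrev Trunc {A : Type u} [CommRing A] (a : A) (n : ℕ) : Type u := A ⧸ Ideal.span {a ^ (n + 1)}

/-- The truncation map `A/(a^(n+2)) → A/(a^(n+1))`. -/
def Trunc.factor {A : Type u} [CommRing A] (a : A) (n : ℕ) : Trunc a (n + 1) →+* Trunc a n :=
  Ideal.Quotient.factor ((Ideal.span_singleton_le_span_singleton).2 ⟨a, pow_succ a (n + 1)⟩)

/-- The map `A/(a^(n+1)) → B/(b^(n+1))` induced by a ring map sending `a` to `b`. -/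
def Trunc.map {A B : Type u} [CommRing A] [CommRing B] (g : A →+* B) {a : A} {b : B}
    (h : g a = b) (n : ℕ) : Trunc a n →+* Trunc b n :=
  Ideal.quotientMap _ g ((Ideal.span_singleton_le_iff_mem _).2 (by
    rw [Ideal.mem_comap, map_pow, h]; exact Ideal.mem_span_singleton_self _))

variable (R : Type u) [CommRing R] (π : R)

/-- A separated formal scheme topologically of finite type over `R`, given as the direct system of
its infinitesimal thickenings `X_n`: separated schemes of finite type over `R_n = R/(π^(n+1))`
with `X_n ≅ X_{n+1} ×_{R_{n+1}} R_n`. -/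
structure FormalScheme where
  /-- The thickening `X_n`; in particular `X_0` is the special fiber. -/
  thickening : ℕ → Scheme.{u}
  /-- The structure morphism `X_n ⟶ Spec R_n`. -/
  str (n : ℕ) : thickening n ⟶ Spec (.of (Trunc π n))
  /-- The transition morphism `X_n ⟶ X_{n+1}`. -/
  trans (n : ℕ) : thickening n ⟶ thickening (n + 1)
  isPullback (n : ℕ) : IsPullback (trans n) (str n) (str (n + 1))
    (Spec.map (CommRingCat.ofHom (Trunc.factor π n)))
  locallyOfFiniteType (n : ℕ) : LocallyOfFiniteType (str n)
  quasiCompact (n : ℕ) : QuasiCompact (str n)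
  isSeparated (n : ℕ) : IsSeparated (str n)

variable {R π}

/-- The `π`-adic completion of a separated `R`-scheme of finite type: the direct system
`Y ×_R R_n`. -/
def completion {Y : Scheme.{u}} (y : Y ⟶ Spec (.of R)) [LocallyOfFiniteType y] [QuasiCompact y]
    [IsSeparated y] (π : R) : FormalScheme R π where
  thickening n := Limits.pullback y (Spec.map (CommRingCat.ofHom (Ideal.Quotient.mk _)) :
    Spec (.of (Trunc π n)) ⟶ Spec (.of R))
  str n := Limits.pullback.snd _ _
  trans n := Limits.pullback.lift (Limits.pullback.fst _ _)
    (Limits.pullback.snd _ _ ≫ Spec.map (CommRingCat.ofHom (Trunc.factor π n))) (by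
      rw [Limits.pullback.condition, Category.assoc, ← Spec.map_comp]; rfl)
  isPullback n := by
    refine IsPullback.of_right (h₁₂ := Limits.pullback.fst _ _) (h₂₂ := Spec.map
      (CommRingCat.ofHom (Ideal.Quotient.mk _))) (v₁₃ := y) ?_ ?_ ?_
    · rw [Limits.pullback.lift_fst, ← Spec.map_comp]
      exact IsPullback.of_hasPullback _ _
    · exact Limits.pullback.lift_snd _ _ _
    · exact IsPullback.of_hasPullback _ _
  locallyOfFiniteType n := inferInstance
  quasiCompact n := inferInstance
  isSeparated n := inferInstance

namespace FormalScheme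

variable (𝔛 : FormalScheme R π)

/-- An affine open formal subscheme `U = Spf A` of `𝔛`: an open subset of the underlying space,
regarded as an open subset `U_n` of each thickening, such that all `U_n` are affine. -/
structure AffineOpen where
  /-- The open subset `U_n` of `X_n`. -/
  opens (n : ℕ) : (𝔛.thickening n).Opens
  preimage_opens (n : ℕ) : 𝔛.trans n ⁻¹ᵁ opens (n + 1) = opens n
  isAffineOpen (n : ℕ) : IsAffineOpen (opens n)

namespace AffineOpen

variable {𝔛}

instance : LE 𝔛.AffineOpen := ⟨fun V U => ∀ n, V.opens n ≤ U.opens n⟩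

variable (U : 𝔛.AffineOpen)

/-- The restriction map `𝒪(U_{n+1}) → 𝒪(U_n)`. -/
def transition (n : ℕ) :
    Γ(𝔛.thickening (n + 1), U.opens (n + 1)) ⟶ Γ(𝔛.thickening n, U.opens n) :=
  (𝔛.trans n).appLE (U.opens (n + 1)) (U.opens n) (U.preimage_opens n).ge

/-- The ring `lim 𝒪(U_n)` inside the product. -/
def sectionsSubring : Subring (∀ n, Γ(𝔛.thickening n, U.opens n)) where
  carrier := {a | ∀ n, (U.transition n).hom (a (n + 1)) = a n}
  mul_mem' ha hb n := by rw [Pi.mul_apply, map_mul, ha, hb, Pi.mul_apply]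
  one_mem' n := map_one _
  add_mem' ha hb n := by rw [Pi.add_apply, map_add, ha, hb, Pi.add_apply]
  zero_mem' n := map_zero _
  neg_mem' ha n := by rw [Pi.neg_apply, map_neg, ha, Pi.neg_apply]

/-- The ring `A = 𝒪_𝔛(U) = lim 𝒪(U_n)` of sections, so that `U = Spf A`. -/
def Sections : Type u := U.sectionsSubring

instance : CommRing U.Sections := inferInstanceAs (CommRing U.sectionsSubring)

/-- The reduction of a section modulo `π^(n+1)`. -/
def Sections.reduction {U : 𝔛.AffineOpen} (n : ℕ) :
    U.Sections →+* Γ(𝔛.thickening n, U.opens n) :=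
  (Pi.evalRingHom (fun n => Γ(𝔛.thickening n, U.opens n)) n).comp U.sectionsSubring.subtype

theorem le_preimage_top (n : ℕ) : U.opens n ≤ 𝔛.str n ⁻¹ᵁ ⊤ := by
  rw [Scheme.Hom.preimage_top]; exact le_top

/-- The structure map `R → R_n → 𝒪(U_n)`. -/
def structureMap (n : ℕ) : R →+* Γ(𝔛.thickening n, U.opens n) :=
  (((𝔛.str n).appLE ⊤ (U.opens n) (U.le_preimage_top n)).hom.comp
    (Scheme.ΓSpecIso (.of (Trunc π n))).inv.hom).comp (Ideal.Quotient.mk _)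

theorem transition_structureMap (n : ℕ) (r : R) :
    (U.transition n).hom (U.structureMap (n + 1) r) = U.structureMap n r := by
  have h : (Scheme.ΓSpecIso (.of (Trunc π (n + 1)))).inv ≫
      (𝔛.str (n + 1)).appLE ⊤ (U.opens (n + 1)) (U.le_preimage_top _) ≫ U.transition n =
      CommRingCat.ofHom (Trunc.factor π n) ≫ (Scheme.ΓSpecIso (.of (Trunc π n))).inv ≫
        (𝔛.str n).appLE ⊤ (U.opens n) (U.le_preimage_top _) := by
    rw [transition, Scheme.Hom.appLE_comp_appLE, Scheme.ΓSpecIso_inv_naturality_assoc]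
    refine congrArg _ (Eq.trans ?_ (Scheme.Hom.comp_appLE (𝔛.str n) (Spec.map _) ⊤ (U.opens n)
      le_top))
    simp only [(𝔛.isPullback n).w]
  exact congrArg (fun φ => φ.hom (Ideal.Quotient.mk _ r)) h

instance : Algebra R U.Sections :=
  RingHom.toAlgebra ((RingHom.pi U.structureMap).codRestrict U.sectionsSubring
    fun r n => U.transition_structureMap n r)

/-- The restriction map `𝒪_𝔛(U) → 𝒪_𝔛(V)` for `V ⊆ U`. -/
def restrict {V U : 𝔛.AffineOpen} (h : V ≤ U) : U.Sections →ₐ[R] V.Sections where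
  toFun a := ⟨fun n => ((𝔛.thickening n).presheaf.map (homOfLE (h n)).op).hom (a.1 n), fun n => by
    have h' : (𝔛.thickening (n + 1)).presheaf.map (homOfLE (h (n + 1))).op ≫ V.transition n =
        U.transition n ≫ (𝔛.thickening n).presheaf.map (homOfLE (h n)).op := by
      rw [transition, transition, Scheme.Hom.map_appLE, Scheme.Hom.appLE_map]
    exact (congrArg (fun φ => φ.hom (a.1 (n + 1))) h').trans
      (congrArg ((𝔛.thickening n).presheaf.map (homOfLE (h n)).op).hom (a.2 n))⟩
  map_one' := Subtype.ext (funext fun n => map_one _)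
  map_mul' a b := Subtype.ext (funext fun n => map_mul _ _ _)
  map_zero' := Subtype.ext (funext fun n => map_zero _)
  map_add' a b := Subtype.ext (funext fun n => map_add _ _ _)
  commutes' r := Subtype.ext (funext fun n => by
    have h' : (𝔛.str n).appLE ⊤ (U.opens n) (U.le_preimage_top n) ≫
        (𝔛.thickening n).presheaf.map (homOfLE (h n)).op =
        (𝔛.str n).appLE ⊤ (V.opens n) (V.le_preimage_top n) := by
      rw [Scheme.Hom.appLE_map]
    exact congrArg (fun φ => φ.hom ((Scheme.ΓSpecIso (.of (Trunc π n))).inv.hom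
      (Ideal.Quotient.mk _ r))) h')

end AffineOpen

/-! ### The generic fiber -/

variable (K : Type u) [Field K] [Algebra R K]

/-- `Y`-valued points of the charts: an affine open `U = Spf A` of `𝔛` and a morphism from the
affinoid space `Y` to `U_η = Sp (A ⊗_R K)`. -/
structure ChartPoint (Y : AffinoidSpace R π K) where
  /-- The chart. -/
  chart : 𝔛.AffineOpen
  /-- The morphism `Y ⟶ U_η`. -/
  hom : K ⊗[R] chart.Sections →ₐ[K] Y.functions

variable {𝔛 K}

/-- For `V ⊆ U`, a point of `V_η` is identified with its image in `U_η`. -/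
def ChartPoint.Rel {Y : AffinoidSpace R π K} (P Q : 𝔛.ChartPoint K Y) : Prop :=
  ∃ h : P.chart ≤ Q.chart,
    Q.hom = P.hom.comp (Algebra.TensorProduct.map (AlgHom.id K K) (AffineOpen.restrict h))

/-- Composition of a point with a morphism of affinoid spaces. -/
def ChartPoint.comp {Y Z : AffinoidSpace R π K} (g : Z ⟶ Y) (P : 𝔛.ChartPoint K Y) :
    𝔛.ChartPoint K Z :=
  ⟨P.chart, (AffinoidSpace.Hom.pullback g).comp P.hom⟩

variable (𝔛 K)

/-- The presheaf on affinoid spaces obtained by gluing the charts `U_η = Sp (𝒪_𝔛(U) ⊗_R K)`,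
for `U` an affine open of `𝔛`, along the maps `V_η ⟶ U_η` for `V ⊆ U`; that is, the colimit of the
presheaves represented by the charts. -/
def chartPresheaf : (AffinoidSpace R π K)ᵒᵖ ⥤ Type (u + 1) where
  obj Y := ULift.{u + 1} (Quot (ChartPoint.Rel (𝔛 := 𝔛) (Y := Y.unop)))
  map g := TypeCat.ofHom fun P => ULift.up (Quot.map (ChartPoint.comp g.unop)
    (fun _ _ h => h.imp fun _ e =>
      (congrArg (AlgHom.comp (AffinoidSpace.Hom.pullback g.unop)) e).trans
        (AlgHom.comp_assoc _ _ _).symm) P.down)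
  map_id Y := by
    ext P
    rcases P with ⟨⟨P⟩⟩
    rfl
  map_comp f g := by
    ext P
    rcases P with ⟨⟨P⟩⟩
    rfl

/-- The generic fiber `𝔛_η`: the rigid space glued from the affinoid spaces
`U_η = Sp (𝒪_𝔛(U) ⊗_R K)`, where `U` runs through the affine opens of `𝔛`. A rigid space is viewed
here as a sheaf on the site of affinoid spaces, via `Y ↦ Hom(Y, 𝔛_η)`. -/
def genericFiber : Sheaf (AffinoidSpace.topology (R := R) (π := π) (K := K)) (Type (u + 1)) :=
  (presheafToSheaf _ _).obj (𝔛.chartPresheaf K)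

variable [IsDomain R] [IsNoetherianRing R] [IsAdicComplete (Ideal.span {π}) R] [IsFractionRing R K]
  (L : Type u) [Field L] [Algebra K L] [FiniteDimensional K L]

/-- The set `𝔛_η(L)` of `L`-points of the generic fiber, i.e. of morphisms `Sp L ⟶ 𝔛_η`. -/
def Points : Type (u + 1) := (𝔛.genericFiber K).obj.obj (op (AffinoidSpace.Sp R π K L))

variable {𝔛 K L}

/-- The point of `𝔛_η` given by a morphism `Sp L ⟶ U_η = Sp (𝒪_𝔛(U) ⊗_R K)`. -/
def Points.ofChart (U : 𝔛.AffineOpen) (α : K ⊗[R] U.Sections →ₐ[K] L) : 𝔛.Points K L :=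
  (toSheafify AffinoidSpace.topology (𝔛.chartPresheaf K)).app (op (AffinoidSpace.Sp R π K L))
    (ULift.up (Quot.mk _ ⟨U, α⟩))

/-- The action of `Gal(L/K)` on `𝔛_η(L)`. -/
def Points.gal (σ : L ≃ₐ[K] L) (P : 𝔛.Points K L) : 𝔛.Points K L :=
  (𝔛.genericFiber K).obj.map (Quiver.Hom.op (X := AffinoidSpace.Sp R π K L)
    (Y := AffinoidSpace.Sp R π K L) ⟨σ.toAlgHom⟩) P

end FormalScheme

/-! ### Sections of formal schemes, their generic fibers, and specialization -/

/-- An `R'`-section of `𝔛`, i.e. a morphism `Spf R' ⟶ 𝔛` of formal `R`-schemes, given as a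
compatible system of morphisms `Spec R'/(π^(n+1)) ⟶ X_n` over `R_n`. -/
structure FormalScheme.Section (𝔛 : FormalScheme R π) (R' : Type u) [CommRing R'] [Algebra R R']
    where
  /-- The morphism between the `n`-th thickenings. -/
  hom (n : ℕ) : Spec (.of (Trunc (algebraMap R R' π) n)) ⟶ 𝔛.thickening n
  hom_str (n : ℕ) : hom n ≫ 𝔛.str n =
    Spec.map (CommRingCat.ofHom (Trunc.map (algebraMap R R') rfl n))
  hom_trans (n : ℕ) : hom n ≫ 𝔛.trans n =
    Spec.map (CommRingCat.ofHom (Trunc.factor (algebraMap R R' π) n)) ≫ hom (n + 1)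

/-- The `π`-adic completion of a morphism `σ : Spec R' ⟶ Y` of `R`-schemes. -/
def completeSection {Y : Scheme.{u}} (y : Y ⟶ Spec (.of R)) [LocallyOfFiniteType y]
    [QuasiCompact y] [IsSeparated y] (π : R) {R' : Type u} [CommRing R'] [Algebra R R']
    (σ : Spec (.of R') ⟶ Y) (hσ : σ ≫ y = Spec.map (CommRingCat.ofHom (algebraMap R R'))) :
    (completion y π).Section R' where
  hom n := Limits.pullback.lift
    (Spec.map (CommRingCat.ofHom (Ideal.Quotient.mk _)) ≫ σ)
    (Spec.map (CommRingCat.ofHom (Trunc.map (algebraMap R R') rfl n))) (by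
      rw [Category.assoc, hσ, ← Spec.map_comp, ← Spec.map_comp]; rfl)
  hom_str n := Limits.pullback.lift_snd _ _ _
  hom_trans n := by
    refine Limits.pullback.hom_ext ?_ ?_
    · simp only [completion, Category.assoc, Limits.pullback.lift_fst]
      rw [← Category.assoc, ← Spec.map_comp]; rfl
    · simp only [completion, Category.assoc, Limits.pullback.lift_snd,
        Limits.pullback.lift_snd_assoc]
      rw [← Spec.map_comp, ← Spec.map_comp]
      congr 1
      refine CommRingCat.hom_ext (Ideal.Quotient.ringHom_ext ?_)
      rfl

section

variable {𝔛 : FormalScheme R π} {K : Type u} [Field K] [Algebra R K]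
  [IsDomain R] [IsNoetherianRing R] [IsAdicComplete (Ideal.span {π}) R] [IsFractionRing R K]
  {L : Type u} [Field L] [Algebra K L] [FiniteDimensional K L]
  {R' : Type u} [CommRing R'] [Algebra R R'] [Algebra R' L]

/-- `P = g_η`: the morphism `P : Sp L ⟶ 𝔛_η` is the generic fiber of `g : Spf R' ⟶ 𝔛`. Here `R'`
is the normalization of `R` in `L`. In an affine open `U = Spf A` through which `g` factors,
`P` is given by `A ⊗_R K → L` obtained from `g^♯ : A → R'` by extension of scalars. -/
def IsGenericFiber (g : 𝔛.Section R') (P : 𝔛.Points K L) : Prop :=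
  ∃ (U : 𝔛.AffineOpen) (hU : ∀ n, ⊤ ≤ g.hom n ⁻¹ᵁ U.opens n) (α : K ⊗[R] U.Sections →ₐ[K] L),
    FormalScheme.Points.ofChart U α = P ∧
    ∀ a : U.Sections, ∃ r : R', algebraMap R' L r = α (1 ⊗ₜ a) ∧
      ∀ n, Ideal.Quotient.mk (Ideal.span {algebraMap R R' π ^ (n + 1)}) r =
        (Scheme.ΓSpecIso (.of (Trunc (algebraMap R R' π) n))).hom.hom
          (((g.hom n).appLE (U.opens n) ⊤ (hU n)).hom (a.reduction n))

/-- `sp(P) = x`: the point `P` of `𝔛_η` with values in `L` specializes to `x : Spec κ ⟶ X_0`.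
Here `ρ : R' → κ` is the reduction map from the normalization `R'` of `R` in `L` to its residue
field. In an affine open `U = Spf A` of `𝔛` where `P` is given by `α : A ⊗_R K → L`, this
means that `α(A) ⊆ R'` and that `x` is given by the reduction of `A → R'`. -/
def SpecializesTo {κ : Type u} [Field κ] (ρ : R' →+* κ) (P : 𝔛.Points K L)
    (x : Spec (.of κ) ⟶ 𝔛.thickening 0) : Prop :=
  ∃ (U : 𝔛.AffineOpen) (hU : ⊤ ≤ x ⁻¹ᵁ U.opens 0) (α : K ⊗[R] U.Sections →ₐ[K] L),
    FormalScheme.Points.ofChart U α = P ∧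
    ∀ a : U.Sections, ∃ r : R', algebraMap R' L r = α (1 ⊗ₜ a) ∧
      ρ r = (Scheme.ΓSpecIso (.of κ)).hom.hom ((x.appLE (U.opens 0) ⊤ hU).hom (a.reduction 0))

end

end Formal

/-! ### Arc spaces -/

section Arcs

variable {k : Type u} [Field k]

/-- The ring `A ⊗_k R_n`, where `R_n = k[[t]]/(t^(n+1))`. -/
abbrev JetRing (k : Type u) [Field k] (A : Type u) [CommRing A] [Algebra k A] (n : ℕ) : Type u :=
  A ⊗[k] Trunc (PowerSeries.X : k⟦X⟧) n

/-- The truncation map `R_{n+1} → R_n`. -/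
def truncateTrunc (k : Type u) [Field k] (n : ℕ) :
    Trunc (PowerSeries.X : k⟦X⟧) (n + 1) →ₐ[k] Trunc (PowerSeries.X : k⟦X⟧) n :=
  Ideal.Quotient.factorₐ k ((Ideal.span_singleton_le_span_singleton).2
    ⟨PowerSeries.X, pow_succ (PowerSeries.X : k⟦X⟧) (n + 1)⟩)

/-- The truncation map `A ⊗_k R_{n+1} → A ⊗_k R_n`. -/
def JetRing.truncate (k : Type u) [Field k] (A : Type u) [CommRing A] [Algebra k A] (n : ℕ) :
    JetRing k A (n + 1) →ₐ[k] JetRing k A n :=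
  Algebra.TensorProduct.map (AlgHom.id k A) (truncateTrunc k n)

/-- Evaluation at `t = 0`, as a map of `k`-algebras `R_0 → k`. -/
def evalZeroTrunc (k : Type u) [Field k] : Trunc (PowerSeries.X : k⟦X⟧) 0 →ₐ[k] k :=
  Ideal.Quotient.liftₐ _
    { PowerSeries.constantCoeff (R := k) with commutes' := fun c => PowerSeries.constantCoeff_C c }
    fun a ha => by
      obtain ⟨b, rfl⟩ := Ideal.mem_span_singleton.1 ha
      change PowerSeries.constantCoeff _ = 0
      simp

/-- The isomorphism `A ⊗_k R_0 → A`, i.e. evaluation at `t = 0`. -/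
def JetRing.evalZero (A : Type u) [CommRing A] [Algebra k A] : JetRing k A 0 →ₐ[k] A :=
  Algebra.TensorProduct.lift (AlgHom.id k A) ((Algebra.ofId k A).comp (evalZeroTrunc k))
    fun _ _ => .all _ _

/-- The map `k[[t]] → A ⊗_k R_n`. -/
def JetRing.ofPowerSeries (A : Type u) [CommRing A] [Algebra k A] (n : ℕ) :
    k⟦X⟧ →ₐ[k] JetRing k A n :=
  Algebra.TensorProduct.includeRight.comp (Ideal.Quotient.mkₐ k _)

/-- The endomorphism `t ↦ ξ t` of `R_n`. -/
def rescaleTrunc (ξ : k) (n : ℕ) :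
    Trunc (PowerSeries.X : k⟦X⟧) n →ₐ[k] Trunc (PowerSeries.X : k⟦X⟧) n :=
  Ideal.quotientMapₐ _
    { PowerSeries.rescale ξ with
      commutes' := fun c => by
        change PowerSeries.rescale ξ (PowerSeries.C c) = PowerSeries.C c
        ext m
        rw [PowerSeries.coeff_rescale, PowerSeries.coeff_C]
        split_ifs with h
        · rw [h, pow_zero, one_mul]
        · rw [mul_zero] }
    ((Ideal.span_singleton_le_iff_mem _).2 (by
      change PowerSeries.rescale ξ (PowerSeries.X ^ (n + 1)) ∈
        Ideal.span {(PowerSeries.X : k⟦X⟧) ^ (n + 1)}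
      rw [map_pow, PowerSeries.rescale_X, mul_pow]
      exact Ideal.mul_mem_left _ _ (Ideal.mem_span_singleton_self _)))

/-- The endomorphism `t ↦ ξ t` of `A ⊗_k R_n`. -/
def JetRing.rescale (A : Type u) [CommRing A] [Algebra k A] (ξ : k) (n : ℕ) :
    JetRing k A n →ₐ[k] JetRing k A n :=
  Algebra.TensorProduct.map (AlgHom.id k A) (rescaleTrunc ξ n)

/-- The map `A ⊗_k R_n → B ⊗_k R_n` induced by `A → B`. -/
def JetRing.map {A B : Type u} [CommRing A] [Algebra k A] [CommRing B] [Algebra k B]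
    (g : A →ₐ[k] B) (n : ℕ) : JetRing k A n →ₐ[k] JetRing k B n :=
  Algebra.TensorProduct.map g (AlgHom.id k _)

theorem JetRing.map_id (A : Type u) [CommRing A] [Algebra k A] (n : ℕ) :
    JetRing.map (AlgHom.id k A) n = AlgHom.id k (JetRing k A n) :=
  Algebra.TensorProduct.map_id

theorem JetRing.map_comp {A B C : Type u} [CommRing A] [Algebra k A] [CommRing B] [Algebra k B]
    [CommRing C] [Algebra k C] (g : A →ₐ[k] B) (h : B →ₐ[k] C) (n : ℕ) :
    JetRing.map (h.comp g) n = (JetRing.map h n).comp (JetRing.map g n) := by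
  rw [JetRing.map, JetRing.map, JetRing.map, ← Algebra.TensorProduct.map_comp, AlgHom.comp_id]

theorem JetRing.truncate_comp_map {A B : Type u} [CommRing A] [Algebra k A] [CommRing B]
    [Algebra k B] (g : A →ₐ[k] B) (n : ℕ) :
    (JetRing.truncate k B n).comp (JetRing.map g (n + 1)) =
      (JetRing.map g n).comp (JetRing.truncate k A n) := by
  rw [JetRing.truncate, JetRing.truncate, JetRing.map, JetRing.map,
    ← Algebra.TensorProduct.map_comp, ← Algebra.TensorProduct.map_comp, AlgHom.comp_id,
    AlgHom.id_comp, AlgHom.comp_id, AlgHom.id_comp]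

theorem rescaleTrunc_mk (ξ : k) (n : ℕ) (b : k⟦X⟧) :
    rescaleTrunc ξ n (Ideal.Quotient.mk _ b) = Ideal.Quotient.mk _ (PowerSeries.rescale ξ b) := rfl

theorem truncateTrunc_mk (n : ℕ) (b : k⟦X⟧) :
    truncateTrunc k n (Ideal.Quotient.mk _ b) = Ideal.Quotient.mk _ b := rfl

theorem truncateTrunc_comp_rescaleTrunc (ξ : k) (n : ℕ) :
    (truncateTrunc k n).comp (rescaleTrunc ξ (n + 1)) =
      (rescaleTrunc ξ n).comp (truncateTrunc k n) := by
  refine AlgHom.ext fun b => ?_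
  obtain ⟨b, rfl⟩ := Ideal.Quotient.mk_surjective b
  rw [AlgHom.comp_apply, AlgHom.comp_apply, rescaleTrunc_mk, truncateTrunc_mk, truncateTrunc_mk,
    rescaleTrunc_mk]

theorem JetRing.truncate_comp_rescale (A : Type u) [CommRing A] [Algebra k A] (ξ : k) (n : ℕ) :
    (JetRing.truncate k A n).comp (JetRing.rescale A ξ (n + 1)) =
      (JetRing.rescale A ξ n).comp (JetRing.truncate k A n) := by
  rw [JetRing.truncate, JetRing.rescale, JetRing.rescale, ← Algebra.TensorProduct.map_id_comp,
    ← Algebra.TensorProduct.map_id_comp, truncateTrunc_comp_rescaleTrunc]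

theorem JetRing.truncate_comp_ofPowerSeries (A : Type u) [CommRing A] [Algebra k A] (n : ℕ) :
    (JetRing.truncate k A n).comp (JetRing.ofPowerSeries A (n + 1)) =
      JetRing.ofPowerSeries A n := by
  refine AlgHom.ext fun b => ?_
  refine (Algebra.TensorProduct.map_tmul _ _ _ _).trans ?_
  rw [map_one]
  rfl

theorem JetRing.map_comp_ofPowerSeries {A B : Type u} [CommRing A] [Algebra k A] [CommRing B]
    [Algebra k B] (g : A →ₐ[k] B) (n : ℕ) :
    (JetRing.map g n).comp (JetRing.ofPowerSeries A n) = JetRing.ofPowerSeries B n := by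
  refine AlgHom.ext fun b => ?_
  refine (Algebra.TensorProduct.map_tmul _ _ _ _).trans ?_
  rw [map_one]
  rfl

/-- The morphism of schemes corresponding to a morphism of `k`-algebras. -/
abbrev specMap {A B : Type u} [CommRing A] [Algebra k A] [CommRing B] [Algebra k B]
    (g : A →ₐ[k] B) : Spec (.of B) ⟶ Spec (.of A) :=
  Spec.map (CommRingCat.ofHom g.toRingHom)

/-- The structure morphism `Spec A ⟶ Spec k` of a `k`-algebra. -/
abbrev specStr (k : Type u) [Field k] (A : Type u) [CommRing A] [Algebra k A] :
    Spec (.of A) ⟶ Spec (.of k) :=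
  Spec.map (CommRingCat.ofHom (algebraMap k A))

theorem specMap_specStr {A B : Type u} [CommRing A] [Algebra k A] [CommRing B] [Algebra k B]
    (g : A →ₐ[k] B) : specMap g ≫ specStr k A = specStr k B := by
  rw [← Spec.map_comp, ← CommRingCat.ofHom_comp]
  congr 2
  exact g.comp_algebraMap

theorem specMap_id (A : Type u) [CommRing A] [Algebra k A] :
    specMap (AlgHom.id k A) = 𝟙 (Spec (.of A)) :=
  Spec.map_id _

theorem specMap_comp {A B C : Type u} [CommRing A] [Algebra k A] [CommRing B] [Algebra k B]
    [CommRing C] [Algebra k C] (g : A →ₐ[k] B) (h : B →ₐ[k] C) :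
    specMap h ≫ specMap g = specMap (h.comp g) := by
  rw [← Spec.map_comp]; rfl

section ArcSpace

variable {X : Scheme.{u}} (p : X ⟶ Spec (.of k))

/-- The `A`-points of the arc scheme `ℒ(X)` of a `k`-scheme `p : X ⟶ Spec k`, for a `k`-algebra
`A`: the elements of `lim ℒ_n(X)(A) = lim X(A ⊗_k R_n)`. -/
@[ext]
structure ArcPoints (A : Type u) [CommRing A] [Algebra k A] where
  /-- The `n`-jet. -/
  jet (n : ℕ) : Spec (.of (JetRing k A n)) ⟶ X
  jet_str (n : ℕ) : jet n ≫ p = specStr k (JetRing k A n)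
  truncate_jet (n : ℕ) : specMap (JetRing.truncate k A n) ≫ jet (n + 1) = jet n

namespace ArcPoints

variable {p}

/-- Functoriality in the `k`-algebra. -/
def map {A B : Type u} [CommRing A] [Algebra k A] [CommRing B] [Algebra k B] (g : A →ₐ[k] B)
    (γ : ArcPoints p A) : ArcPoints p B where
  jet n := specMap (JetRing.map g n) ≫ γ.jet n
  jet_str n := by rw [Category.assoc, γ.jet_str, specMap_specStr]
  truncate_jet n := by
    rw [← γ.truncate_jet n, ← Category.assoc, ← Category.assoc, specMap_comp, specMap_comp,
      JetRing.truncate_comp_map]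

/-- The `k`-point of `ℒ(X)` defined by an arc `ψ : Spec k[[t]] ⟶ X`. -/
def ofArc (ψ : Spec (.of k⟦X⟧) ⟶ X) (hψ : ψ ≫ p = specStr k k⟦X⟧) : ArcPoints p k where
  jet n := specMap (JetRing.ofPowerSeries k n) ≫ ψ
  jet_str n := by rw [Category.assoc, hψ, specMap_specStr]
  truncate_jet n := by
    rw [← Category.assoc, specMap_comp, JetRing.truncate_comp_ofPowerSeries]

/-- The projection `π_0 : ℒ(X) ⟶ X` on `k`-points. -/
def origin (γ : ArcPoints p k) : Spec (.of k) ⟶ X :=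
  specMap (JetRing.evalZero k) ≫ γ.jet 0

/-- The arc `ψ(ξ t)`, for a `k`-point `ψ` of `ℒ(X)`. -/
def rescale (ξ : k) (γ : ArcPoints p k) : ArcPoints p k where
  jet n := specMap (JetRing.rescale k ξ n) ≫ γ.jet n
  jet_str n := by rw [Category.assoc, γ.jet_str, specMap_specStr]
  truncate_jet n := by
    rw [← γ.truncate_jet n, ← Category.assoc, ← Category.assoc, specMap_comp, specMap_comp,
      JetRing.truncate_comp_rescale]

end ArcPoints

/-- The arc scheme `ℒ(X)`, through its functor of points on `k`-algebras. -/
def arcSpace : CommAlgCat.{u} k ⥤ Type u where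
  obj A := ArcPoints p A
  map g := TypeCat.ofHom (ArcPoints.map g.hom)
  map_id A := by
    refine ConcreteCategory.hom_ext _ _ fun γ => ArcPoints.ext (funext fun n => ?_)
    change specMap (JetRing.map (AlgHom.id k A) n) ≫ γ.jet n = γ.jet n
    rw [JetRing.map_id, specMap_id, Category.id_comp]
  map_comp {A B C} f g := by
    refine ConcreteCategory.hom_ext _ _ fun γ => ArcPoints.ext (funext fun n => ?_)
    change specMap (JetRing.map (g.hom.comp f.hom) n) ≫ γ.jet n =
      specMap (JetRing.map g.hom n) ≫ specMap (JetRing.map f.hom n) ≫ γ.jet n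
    rw [JetRing.map_comp, ← Category.assoc, specMap_comp]

/-- The `A`-point of `𝔸¹ = Spec k[t]` with coordinate `a`. -/
def affineLinePoint {A : Type u} [CommRing A] [Algebra k A] (a : A) :
    Spec (.of A) ⟶ Spec (.of (Polynomial k)) :=
  specMap (Polynomial.aeval a)

theorem specMap_affineLinePoint {A B : Type u} [CommRing A] [Algebra k A] [CommRing B]
    [Algebra k B] (g : A →ₐ[k] B) (a : A) :
    specMap g ≫ affineLinePoint (k := k) a = affineLinePoint (g a) := by
  rw [affineLinePoint, specMap_comp, affineLinePoint]
  congr 1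
  exact Polynomial.algHom_ext (by simp)

/-- The closed subscheme `𝒳(d) = {ψ | f(ψ) = t^d}` of `ℒ(X)`, as a functor of points. -/
def arcsOfLevel (f : X ⟶ Spec (.of (Polynomial k))) (d : ℕ) : Subfunctor (arcSpace p) where
  obj A := {γ : ArcPoints p A | ∀ n, γ.jet n ≫ f =
    affineLinePoint (JetRing.ofPowerSeries (k := k) A n (PowerSeries.X ^ d))}
  map {A B} g γ hγ n := by
    change (specMap (JetRing.map g.hom n) ≫ ArcPoints.jet γ n) ≫ f = _
    rw [Category.assoc, hγ n, specMap_affineLinePoint, ← AlgHom.comp_apply,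
      JetRing.map_comp_ofPowerSeries]

/-- The set `𝒳(d)(k)`. -/
abbrev LevelPoints (f : X ⟶ Spec (.of (Polynomial k))) (d : ℕ) : Type u :=
  {γ : ArcPoints p k // γ ∈ (arcsOfLevel p f d).obj (.of k k)}

end ArcSpace

/-! ### The `t`-adic completion of a function -/

/-- The scheme `X_R = X ×_{k[t]} k[[t]]`, for `f : X ⟶ Spec k[t]`, where `Spec k[[t]] ⟶ Spec k[t]`
is the point of the affine line with coordinate `t`. -/
abbrev baseChangePowerSeries {X : Scheme.{u}} (f : X ⟶ Spec (.of (Polynomial k))) : Scheme.{u} :=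
  Limits.pullback f (affineLinePoint (PowerSeries.X : k⟦X⟧))

theorem finiteType_of_comp {X : Scheme.{u}} {p : X ⟶ Spec (.of k)} [LocallyOfFiniteType p]
    [QuasiCompact p] [IsSeparated p] {f : X ⟶ Spec (.of (Polynomial k))}
    (hf : f ≫ specStr k (Polynomial k) = p) :
    LocallyOfFiniteType f ∧ QuasiCompact f ∧ IsSeparated f := by
  subst hf
  exact ⟨locallyOfFiniteType_of_comp f (specStr k (Polynomial k)),
    QuasiCompact.of_comp f (specStr k (Polynomial k)),
    IsSeparated.of_comp f (specStr k (Polynomial k))⟩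

section

variable {X : Scheme.{u}} {p : X ⟶ Spec (.of k)} [LocallyOfFiniteType p] [QuasiCompact p]
  [IsSeparated p]
  {f : X ⟶ Spec (.of (Polynomial k))} (hf : f ≫ specStr k (Polynomial k) = p)

/-- The formal scheme `X̂`: the `t`-adic completion of `f : X ⟶ 𝔸¹`, i.e. of `X_R`. -/
def functionCompletion : FormalScheme k⟦X⟧ PowerSeries.X :=
  have h := finiteType_of_comp hf
  have := h.1
  have := h.2.1
  have := h.2.2
  completion (Limits.pullback.snd f (affineLinePoint (PowerSeries.X : k⟦X⟧))) PowerSeries.X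

/-- The morphism `X_0 ⟶ X` from the special fiber of `X̂`. -/
def functionCompletion.toBase : (functionCompletion hf).thickening 0 ⟶ X :=
  (Limits.pullback.fst (Limits.pullback.snd f (affineLinePoint (PowerSeries.X : k⟦X⟧)))
    (Spec.map (CommRingCat.ofHom (Ideal.Quotient.mk _)) :
      Spec (.of (Trunc (PowerSeries.X : k⟦X⟧) 0)) ⟶ Spec (.of k⟦X⟧)) :) ≫
    Limits.pullback.fst _ _

/-- The completion of an `R'`-section of `X_R`. -/
def functionCompletion.completeSection {R' : Type u} [CommRing R'] [Algebra k⟦X⟧ R']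
    (σ : Spec (.of R') ⟶ baseChangePowerSeries f)
    (hσ : σ ≫ Limits.pullback.snd _ _ = Spec.map (CommRingCat.ofHom (algebraMap k⟦X⟧ R'))) :
    (functionCompletion hf).Section R' :=
  have h := finiteType_of_comp hf
  have := h.1
  have := h.2.1
  have := h.2.2
  RigidArc.completeSection _ _ σ hσ

end

/-- The formal completion `X̂` of `X_R = X ×_k R`, where `R = k[[t]]`, for a separated `k`-scheme
of finite type `p : X ⟶ Spec k`. -/
abbrev constantCompletion {X : Scheme.{u}} (p : X ⟶ Spec (.of k)) [LocallyOfFiniteType p]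
    [QuasiCompact p] [IsSeparated p] : FormalScheme k⟦X⟧ PowerSeries.X :=
  completion (Limits.pullback.snd p (specStr k k⟦X⟧)) PowerSeries.X

/-- The morphism `X_0 ⟶ X` from the special fiber of `X̂` (an isomorphism). -/
abbrev constantCompletion.toBase {X : Scheme.{u}} (p : X ⟶ Spec (.of k)) [LocallyOfFiniteType p]
    [QuasiCompact p] [IsSeparated p] : (constantCompletion p).thickening 0 ⟶ X :=
  Limits.pullback.fst (Limits.pullback.snd p (specStr k k⟦X⟧)) _ ≫ Limits.pullback.fst _ _

/-- The extension `K(s)` of `K` generated by an element `s` of an algebraic closure is finite. -/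
instance {K Ω : Type u} [Field K] [Field Ω] [Algebra K Ω] [IsAlgClosure K Ω] (s : Ω) :
    FiniteDimensional K (IntermediateField.adjoin K {s}) :=
  have : Algebra.IsAlgebraic K Ω := IsAlgClosure.isAlgebraic
  IntermediateField.adjoin.finiteDimensional (Algebra.IsIntegral.isIntegral s)

end Arcs

end RigidArc

end

open RigidArc IntermediateField

/-! Both cases rest on one chain of identifications: an `L`-valued point of the generic fiber is a
section of the formal scheme over the ring of integers `R'` of `L`; such a section is an
`R`-morphism from `Spec R'`; and that morphism is an arc.

Points and formal sections. The generic fiber is the sheafification of the presheaf glued from the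
charts. Since `Sp L` has a single point, a covering sieve of any affinoid space contains all
morphisms from `Sp L` (`AffinoidSpace.arrows_of_mem_topology`), so sheafification changes nothing on
`Sp L`, and a point is a map `α : A ⊗ K → L` from one chart, up to gluing. Such an `α` sends `A`
into `R'`: for `x = α(a)` outside `R'` there is a polynomial `q` over `R` with `1 + π q(x) = 0`,
whereas `1 + π q(a)` is a unit of `A = lim 𝒪(U_n)` (`isUnit_one_add`). As the kernel of `A → 𝒪(U_n)`
is generated by `π^(n+1)`, the map `A → R'` amounts to compatible morphisms from the truncations of
`R'`, that is, to a section. This gives `IsValuationSubring.existsUnique_section`; the converse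
`IsValuationSubring.point_eq` compares two charts on their intersection. Specialization and the
Galois action can then be read off the section.

Formal sections and morphisms. Because `R'` is local, a compatible system of morphisms from its
truncations to `Y` lies in one affine open of `Y`; because `R'` is the limit of its truncations, the
system comes from a unique morphism `Spec R' ⟶ Y` (`TruncComplete.exists_hom`,
`TruncComplete.hom_ext`). The same argument identifies the `k`-points of the arc scheme with the
morphisms `Spec k[[t]] ⟶ X`.

The ring of integers. Through `t ↦ t^d`, the ring `k[[t]]` is `R[Y]/(Y^d - t)`. Sending `Y` to the
`d`-th root of `t` embeds it in `K(d)` with image the integral closure of `R`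
(`exists_integralClosure_equiv`). Under this identification `R → R(d)` becomes `t ↦ t^d`, so
sections of `X_R` become arcs with `f(ψ) = t^d`; reduction becomes the constant coefficient, so `sp`
becomes `π_0`; and a Galois automorphism becomes `t ↦ ξ t`. The absolute case is the same argument
with `R' = R`. -/

noncomputable section

namespace RigidArc

/-! ### Morphisms from affine schemes into affine opens -/

section AffineOpens

variable {X Y : Scheme.{u}} {S T : Type u} [CommRing S] [CommRing T]

/-- The ring map `Γ(X, U) → S` given by a morphism `Spec S ⟶ X` that factors through `U`. -/
def coordMap (g : Spec (.of S) ⟶ X) (U : X.Opens) (h : ⊤ ≤ g ⁻¹ᵁ U) : Γ(X, U) →+* S :=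
  (Scheme.ΓSpecIso (.of S)).hom.hom.comp (g.appLE U ⊤ h).hom

theorem ofHom_coordMap (g : Spec (.of S) ⟶ X) (U : X.Opens) (h : ⊤ ≤ g ⁻¹ᵁ U) :
    CommRingCat.ofHom (coordMap g U h) = g.appLE U ⊤ h ≫ (Scheme.ΓSpecIso (.of S)).hom := rfl

theorem coordMap_specMap_comp (φ : S →+* T) (g : Spec (.of S) ⟶ X) (U : X.Opens)
    (h : ⊤ ≤ g ⁻¹ᵁ U) (h' : ⊤ ≤ (Spec.map (CommRingCat.ofHom φ) ≫ g) ⁻¹ᵁ U) :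
    coordMap (Spec.map (CommRingCat.ofHom φ) ≫ g) U h' = φ.comp (coordMap g U h) := by
  have key : (Spec.map (CommRingCat.ofHom φ) ≫ g).appLE U ⊤ h' ≫ (Scheme.ΓSpecIso (.of T)).hom =
      (g.appLE U ⊤ h ≫ (Scheme.ΓSpecIso (.of S)).hom) ≫ CommRingCat.ofHom φ := by
    rw [← Scheme.Hom.appLE_comp_appLE _ _ U ⊤ ⊤ h le_top, Category.assoc, Category.assoc]
    refine congrArg (g.appLE U ⊤ h ≫ ·) ?_
    refine Eq.trans (congrArg (· ≫ _) ?_) (Scheme.ΓSpecIso_naturality _)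
    exact Category.comp_id _
  exact congrArg CommRingCat.Hom.hom key

theorem coordMap_comp (g : Spec (.of S) ⟶ X) (j : X ⟶ Y) (U : X.Opens) (V : Y.Opens)
    (h : ⊤ ≤ g ⁻¹ᵁ U) (hUV : U ≤ j ⁻¹ᵁ V) (h' : ⊤ ≤ (g ≫ j) ⁻¹ᵁ V) :
    coordMap (g ≫ j) V h' = (coordMap g U h).comp (j.appLE V U hUV).hom := by
  have key : (g ≫ j).appLE V ⊤ h' = j.appLE V U hUV ≫ g.appLE U ⊤ h :=
    (Scheme.Hom.appLE_comp_appLE _ _ _ _ _ _ _).symm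
  rw [coordMap, key]
  rfl

theorem coordMap_res (g : Spec (.of S) ⟶ X) {U V : X.Opens} (hVU : V ≤ U)
    (h : ⊤ ≤ g ⁻¹ᵁ V) (h' : ⊤ ≤ g ⁻¹ᵁ U) (a : Γ(X, U)) :
    coordMap g V h ((X.presheaf.map (homOfLE hVU).op).hom a) = coordMap g U h' a := by
  have key : X.presheaf.map (homOfLE hVU).op ≫ g.appLE V ⊤ h = g.appLE U ⊤ h' := by
    rw [Scheme.Hom.map_appLE]
  rw [coordMap, coordMap, ← key]
  rfl

/-- With `coordMap_fromSpec`, this is the duality between morphisms into an affine open and ring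
maps; it lets identities of morphisms be checked on rings. -/
theorem eq_specMap_coordMap (g : Spec (.of S) ⟶ X) {U : X.Opens} (hU : IsAffineOpen U)
    (h : ⊤ ≤ g ⁻¹ᵁ U) :
    Spec.map (CommRingCat.ofHom (coordMap g U h)) ≫ hU.fromSpec = g := by
  rw [ofHom_coordMap, Spec.map_comp, Category.assoc,
    IsAffineOpen.SpecMap_appLE_fromSpec g hU (isAffineOpen_top _) h, IsAffineOpen.fromSpec_top,
    ← Category.assoc]
  convert Category.id_comp g
  rw [Scheme.isoSpec_Spec_inv, ← Spec.map_comp]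
  simp

theorem eq_of_coordMap_eq {g g' : Spec (.of S) ⟶ X} {U : X.Opens} (hU : IsAffineOpen U)
    (h : ⊤ ≤ g ⁻¹ᵁ U) (h' : ⊤ ≤ g' ⁻¹ᵁ U) (e : coordMap g U h = coordMap g' U h') : g = g' := by
  rw [← eq_specMap_coordMap g hU h, e, eq_specMap_coordMap]

theorem top_le_preimage_fromSpec {U : X.Opens} (hU : IsAffineOpen U) (φ : Γ(X, U) →+* S) :
    ⊤ ≤ (Spec.map (CommRingCat.ofHom φ) ≫ hU.fromSpec) ⁻¹ᵁ U := by
  rw [Scheme.Hom.comp_preimage, hU.fromSpec_preimage_self]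
  exact le_top

theorem coordMap_fromSpec {U : X.Opens} (hU : IsAffineOpen U) (φ : Γ(X, U) →+* S) :
    coordMap (Spec.map (CommRingCat.ofHom φ) ≫ hU.fromSpec) U (top_le_preimage_fromSpec hU φ) =
      φ := by
  have h : ⊤ ≤ hU.fromSpec ⁻¹ᵁ U := hU.fromSpec_preimage_self.ge
  have h1 : coordMap (S := Γ(X, U)) hU.fromSpec U h = RingHom.id _ := by
    have : hU.fromSpec.appLE U ⊤ h ≫ (Scheme.ΓSpecIso (.of Γ(X, U))).hom = 𝟙 _ := by
      rw [Scheme.Hom.appLE, hU.fromSpec_app_self]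
      simp only [Category.assoc]
      rw [← Functor.map_comp_assoc]
      have h2 : (eqToHom hU.fromSpec_preimage_self).op ≫ (homOfLE h).op = 𝟙 _ :=
        Subsingleton.elim _ _
      rw [h2, CategoryTheory.Functor.map_id, Category.id_comp]
      exact Iso.inv_hom_id _
    exact congrArg CommRingCat.Hom.hom this
  rw [coordMap_specMap_comp (S := Γ(X, U)) φ hU.fromSpec U h, h1, RingHom.comp_id]

end AffineOpens

/-! ### Truncation-complete rings -/

section Complete

/-- The ring `S` is the limit of its truncations `S/(a^(n+1))`. -/
def TruncComplete {S : Type u} [CommRing S] (a : S) : Prop :=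
  ∀ x : ∀ n, Trunc a n, (∀ n, Trunc.factor a n (x (n + 1)) = x n) →
    ∃! s : S, ∀ n, Ideal.Quotient.mk _ s = x n

variable {S : Type u} [CommRing S] {a : S}

theorem Trunc.factor_mk (n : ℕ) (s : S) :
    Trunc.factor a n (Ideal.Quotient.mk _ s) = Ideal.Quotient.mk _ s := rfl

theorem TruncComplete.ext (hS : TruncComplete a) {s t : S}
    (h : ∀ n, (Ideal.Quotient.mk _ s : Trunc a n) = Ideal.Quotient.mk _ t) : s = t :=
  (hS (fun _ => Ideal.Quotient.mk _ t) fun _ => rfl).unique h fun _ => rfl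

/-- Each value is the unique limit of its truncations, and the ring axioms can be tested modulo
every `a^(n+1)`, where they hold for `f n`. -/
theorem TruncComplete.exists_lift (hS : TruncComplete a) {B : Type u} [CommRing B]
    (f : ∀ n, B →+* Trunc a n) (hf : ∀ n, (Trunc.factor a n).comp (f (n + 1)) = f n) :
    ∃ g : B →+* S, ∀ n, (Ideal.Quotient.mk _).comp g = f n := by
  choose g hg _ using fun b => hS (fun n => f n b) fun n => RingHom.congr_fun (hf n) b
  refine ⟨{ toFun := g, map_one' := ?_, map_mul' := ?_, map_zero' := ?_, map_add' := ?_ },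
    fun n => RingHom.ext fun b => hg b n⟩ <;> intros <;> refine hS.ext fun n => ?_ <;>
    simp only [hg, map_one, map_mul, map_zero, map_add]

/-- Arbitrary lifts of a compatible system form a Cauchy sequence. Truncation `n` has modulus
`a^(n+1)` while the adic filtration has modulus `a^n` at index `n`, hence the shifts by one. -/
theorem truncComplete_of_isAdicComplete [IsAdicComplete (Ideal.span {a}) S] : TruncComplete a := by
  intro x hx
  choose y hy using fun n => Ideal.Quotient.mk_surjective (x n)
  have hmem : ∀ n (s : S), s ∈ (Ideal.span {a} ^ n • ⊤ : Ideal S) ↔ s ∈ Ideal.span {a ^ n} := by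
    intro n s
    rw [smul_eq_mul, Ideal.mul_top, Ideal.span_singleton_pow]
  have hstep : ∀ n, y (n + 1) - y n ∈ Ideal.span {a ^ (n + 1)} := fun n => by
    rw [← Ideal.Quotient.eq, hy n, ← hx n, ← hy (n + 1)]
    rfl
  have hle : ∀ {m n}, m ≤ n → Ideal.span {a ^ n} ≤ Ideal.span {a ^ m} := fun h =>
    Ideal.span_singleton_le_span_singleton.2 (pow_dvd_pow a h)
  have hcau : ∀ {m n}, m ≤ n → y n - y m ∈ Ideal.span {a ^ (m + 1)} := by
    intro m n h
    induction n, h using Nat.le_induction with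
    | base => simp
    | succ n h ih =>
      have := Ideal.add_mem _ (hle (Nat.succ_le_succ h) (hstep n)) ih
      simpa using this
  obtain ⟨s, hs⟩ := IsPrecomplete.prec (I := Ideal.span {a}) (M := S) inferInstance (f := y)
    fun {m n} h => SModEq.sub_mem.2 ((hmem _ _).2 (by
      have := hle (Nat.le_succ m) (hcau h)
      rwa [← Ideal.neg_mem_iff, neg_sub] at this))
  have hs' : ∀ n, Ideal.Quotient.mk _ s = x n := fun n => by
    rw [← hy n, Ideal.Quotient.eq]
    have h1 := (hmem _ _).1 (SModEq.sub_mem.1 (hs (n + 1)))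
    rw [← Ideal.neg_mem_iff, neg_sub] at h1
    have := Ideal.add_mem _ h1 (hcau (Nat.le_succ n))
    simpa using this
  refine ⟨s, hs', fun t ht => ?_⟩
  refine (IsHausdorff.eq_iff_smodEq (I := Ideal.span {a})).2 fun n => ?_
  rw [SModEq.sub_mem, hmem]
  exact hle (Nat.le_succ n) (Ideal.Quotient.eq.1 ((ht n).trans (hs' n).symm))

theorem TruncComplete.of_ringEquiv {T : Type u} [CommRing T] (e : S ≃+* T) {b : T} (hb : e a = b)
    (hS : TruncComplete a) : TruncComplete b := by
  subst hb
  intro x hx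
  obtain ⟨s, hs, hu⟩ := hS (fun n => Trunc.map (e.symm : T →+* S) (by simp) n (x n)) fun n => by
    rw [← hx n]
    obtain ⟨y, hy⟩ := Ideal.Quotient.mk_surjective (x (n + 1))
    rw [← hy]
    rfl
  have hinj : ∀ n, Function.Injective
      (Trunc.map (e.symm : T →+* S) (a := e a) (b := a) (by simp) n) := fun n => by
    refine Function.LeftInverse.injective (g := Trunc.map (e : S →+* T) rfl n) fun y => ?_
    obtain ⟨y, rfl⟩ := Ideal.Quotient.mk_surjective y
    change Ideal.Quotient.mk _ (e (e.symm y)) = _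
    rw [e.apply_symm_apply]
  refine ⟨e s, fun n => hinj n ?_, fun t ht => ?_⟩
  · rw [← hs n]
    change Ideal.Quotient.mk _ (e.symm (e s)) = _
    rw [e.symm_apply_apply]
  · rw [← hu (e.symm t) fun n => ?_, e.apply_symm_apply]
    rw [← ht n]
    rfl

end Complete

/-! ### Algebraization of morphisms from the spectrum of a complete local ring -/

section Algebraization

variable {S : Type u} [CommRing S] [IsLocalRing S] {a : S} {X : Scheme.{u}}

theorem isLocalRing_trunc (ha : ¬ IsUnit a) (n : ℕ) : IsLocalRing (Trunc a n) := by
  have : Nontrivial (Trunc a n) := Ideal.Quotient.nontrivial_iff.2 fun h => ha (by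
    rw [Ideal.span_singleton_eq_top] at h
    exact (isUnit_pow_iff (Nat.succ_ne_zero n)).1 h)
  exact .of_surjective' (Ideal.Quotient.mk _) Ideal.Quotient.mk_surjective

/-- The closed point of the spectrum of a local ring. -/
def closedPt (S : Type u) [CommRing S] [IsLocalRing S] : (Spec (.of S) : Scheme.{u}) :=
  IsLocalRing.closedPoint S

theorem top_le_preimage_of_closedPoint_mem {g : Spec (.of S) ⟶ X} {U : X.Opens}
    (h : g (closedPt S) ∈ U) : ⊤ ≤ g ⁻¹ᵁ U :=
  (Scheme.preimage_eq_top_of_closedPoint_mem (R := .of S) g h).ge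

theorem specMap_closedPoint {T : Type u} [CommRing T] [IsLocalRing T] (φ : S →+* T)
    (hφ : Function.Surjective φ) :
    Spec.map (CommRingCat.ofHom φ) (closedPt T) = closedPt S :=
  have : IsLocalHom φ := IsLocalHom.of_surjective φ hφ
  IsLocalRing.comap_closedPoint φ

/-- The morphism `Spec S/(a^(n+1)) ⟶ Spec S`. -/
abbrev truncInclusion (a : S) (n : ℕ) : Spec (.of (Trunc a n)) ⟶ Spec (.of S) :=
  Spec.map (CommRingCat.ofHom (Ideal.Quotient.mk _))

/-- A system of compatible morphisms factors through an affine open as soon as its first member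
does at the closed point. -/
theorem top_le_preimage_of_compatible (ha : ¬ IsUnit a) (g : ∀ n, Spec (.of (Trunc a n)) ⟶ X)
    (hg : ∀ n, Spec.map (CommRingCat.ofHom (Trunc.factor a n)) ≫ g (n + 1) = g n) {U : X.Opens}
    (hU : ⊤ ≤ g 0 ⁻¹ᵁ U) (n : ℕ) : ⊤ ≤ g n ⁻¹ᵁ U := by
  have hloc := isLocalRing_trunc ha
  induction n with
  | zero => exact hU
  | succ n ih =>
    refine top_le_preimage_of_closedPoint_mem ?_
    -- The transition between truncations carries closed point to closed point, so membership in `U`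
    -- passes from level `n` to level `n + 1`.
    have h1 : g n (closedPt (Trunc a n)) ∈ U := ih trivial
    rw [← hg n, Scheme.Hom.comp_apply, specMap_closedPoint _ (Ideal.Quotient.factor_surjective _)]
      at h1
    exact h1

theorem top_le_preimage_of_truncInclusion (ha : ¬ IsUnit a) {g : Spec (.of S) ⟶ X} {U : X.Opens}
    {n : ℕ} (h : ⊤ ≤ (truncInclusion a n ≫ g) ⁻¹ᵁ U) : ⊤ ≤ g ⁻¹ᵁ U := by
  have := isLocalRing_trunc ha n
  have h1 : (truncInclusion a n ≫ g) (closedPt (Trunc a n)) ∈ U := h trivial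
  rw [Scheme.Hom.comp_apply, specMap_closedPoint _ Ideal.Quotient.mk_surjective] at h1
  exact top_le_preimage_of_closedPoint_mem h1

/-- An open subset of `Spec S` containing the closed point is everything, so any affine
neighbourhood of the image of that point works. Algebraization therefore needs no gluing. -/
theorem exists_affineOpen_top_le (g : Spec (.of S) ⟶ X) :
    ∃ U : X.Opens, IsAffineOpen U ∧ ⊤ ≤ g ⁻¹ᵁ U := by
  obtain ⟨U, hU, hx, _⟩ := exists_isAffineOpen_mem_and_subset
    (TopologicalSpace.Opens.mem_top (g (closedPt S)))
  exact ⟨U, hU, top_le_preimage_of_closedPoint_mem hx⟩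

/-- A morphism from the spectrum of a complete local ring is determined by its truncations. -/
theorem TruncComplete.hom_ext (hS : TruncComplete a) (ha : ¬ IsUnit a) {g g' : Spec (.of S) ⟶ X}
    (h : ∀ n, truncInclusion a n ≫ g = truncInclusion a n ≫ g') : g = g' := by
  obtain ⟨U, hU, hg⟩ := exists_affineOpen_top_le g
  have hn : ∀ n, ⊤ ≤ (truncInclusion a n ≫ g) ⁻¹ᵁ U := fun n => by
    rw [Scheme.Hom.comp_preimage, top_le_iff.1 hg]; exact le_top
  have hg' : ⊤ ≤ g' ⁻¹ᵁ U := top_le_preimage_of_truncInclusion ha (h 0 ▸ hn 0)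
  refine eq_of_coordMap_eq hU hg hg' (RingHom.ext fun b => hS.ext fun n => ?_)
  have h1 := coordMap_specMap_comp (Ideal.Quotient.mk _ : S →+* Trunc a n) g U hg (hn n)
  have h2 := coordMap_specMap_comp (Ideal.Quotient.mk _ : S →+* Trunc a n) g' U hg' (h n ▸ hn n)
  refine (RingHom.congr_fun h1 b).symm.trans (Eq.trans ?_ (RingHom.congr_fun h2 b))
  congr! 1
  congr 1
  exact h n

/-- Compatible morphisms from the truncations of a complete local ring come from a morphism. -/
theorem TruncComplete.exists_hom (hS : TruncComplete a) (ha : ¬ IsUnit a)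
    (g : ∀ n, Spec (.of (Trunc a n)) ⟶ X)
    (hg : ∀ n, Spec.map (CommRingCat.ofHom (Trunc.factor a n)) ≫ g (n + 1) = g n) :
    ∃ σ : Spec (.of S) ⟶ X, ∀ n, truncInclusion a n ≫ σ = g n := by
  have := isLocalRing_trunc ha 0
  obtain ⟨U, hU, hg0⟩ := exists_affineOpen_top_le (g 0)
  have hn := top_le_preimage_of_compatible ha g hg hg0
  -- All levels lie in the same chart, so the system becomes a compatible family of ring maps out of
  -- the single ring `Γ(X, U)`.
  obtain ⟨φ, hφ⟩ := hS.exists_lift (fun n => coordMap (g n) U (hn n)) fun n => by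
    rw [← coordMap_specMap_comp _ _ _ _ (by rw [hg]; exact hn n)]
    congr 1
    exact hg n
  refine ⟨Spec.map (CommRingCat.ofHom φ) ≫ hU.fromSpec, fun n => ?_⟩
  rw [← Category.assoc, ← Spec.map_comp, ← CommRingCat.ofHom_comp, hφ, eq_specMap_coordMap]

end Algebraization

/-! ### Base change along surjections -/

section BaseChange

variable {X X' : Scheme.{u}} {A B : Type u} [CommRing A] [CommRing B]

/-- The ring map `A → Γ(X, U)` of a scheme over `Spec A`. -/
def structureHom (s : X ⟶ Spec (.of A)) (U : X.Opens) : A →+* Γ(X, U) :=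
  (s.appLE ⊤ U (by rw [Scheme.Hom.preimage_top]; exact le_top)).hom.comp
    (Scheme.ΓSpecIso (.of A)).inv.hom

theorem fromSpec_comp (s : X ⟶ Spec (.of A)) {U : X.Opens} (hU : IsAffineOpen U) :
    hU.fromSpec ≫ s = Spec.map (CommRingCat.ofHom (structureHom s U)) := by
  rw [← IsAffineOpen.SpecMap_appLE_fromSpec s (isAffineOpen_top (Spec (.of A))) hU
    (by rw [Scheme.Hom.preimage_top]; exact le_top), IsAffineOpen.fromSpec_top,
    Scheme.isoSpec_Spec_inv, ← Spec.map_comp]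
  rfl

theorem specMap_comp_str {S : Type u} [CommRing S] (g : Spec (.of S) ⟶ X) (s : X ⟶ Spec (.of A))
    {U : X.Opens} (hU : IsAffineOpen U) (h : ⊤ ≤ g ⁻¹ᵁ U) :
    g ≫ s = Spec.map (CommRingCat.ofHom ((coordMap g U h).comp (structureHom s U))) := by
  conv_lhs => rw [← eq_specMap_coordMap g hU h]
  rw [Category.assoc, fromSpec_comp, ← Spec.map_comp]
  rfl

/-- Over an affine open the fiber product is the spectrum of `Γ(X, U)` modulo the ideal `I`
generated by `ker φ`. Instead of computing a tensor product, the universal property supplies a map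
from `Γ(X', V)` to `Γ(X, U) ⧸ I`, which is compared with the evident map back. -/
theorem appLE_surjective_and_ker {j : X' ⟶ X} {s' : X' ⟶ Spec (.of B)} {s : X ⟶ Spec (.of A)}
    {φ : A →+* B} (hφ : Function.Surjective φ)
    (hp : IsPullback j s' s (Spec.map (CommRingCat.ofHom φ))) {U : X.Opens} {V : X'.Opens}
    (hU : IsAffineOpen U) (hV : IsAffineOpen V) (hUV : j ⁻¹ᵁ U = V) :
    Function.Surjective (j.appLE U V hUV.ge).hom ∧
      RingHom.ker (j.appLE U V hUV.ge).hom ≤ (RingHom.ker φ).map (structureHom s U) := by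
  let I : Ideal Γ(X, U) := (RingHom.ker φ).map (structureHom s U)
  let q : B →+* Γ(X, U) ⧸ I := φ.liftOfSurjective hφ
    ⟨(Ideal.Quotient.mk I).comp (structureHom s U), fun a ha => by
      rw [RingHom.mem_ker, RingHom.comp_apply]
      exact Ideal.Quotient.eq_zero_iff_mem.2 (Ideal.mem_map_of_mem _ ha)⟩
  have hq : q.comp φ = (Ideal.Quotient.mk I).comp (structureHom s U) :=
    RingHom.liftOfRightInverse_comp _ _ _ _
  -- On functions `ℓ` gives `Γ(X', V) → Γ(X, U) ⧸ I`. Composed with restriction along `j` it is the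
  -- quotient map, so the kernel of that restriction lies in `I`.
  let ℓ : Spec (.of (Γ(X, U) ⧸ I)) ⟶ X' :=
    hp.lift (Spec.map (CommRingCat.ofHom (Ideal.Quotient.mk I)) ≫ hU.fromSpec)
      (Spec.map (CommRingCat.ofHom q)) (by
        rw [Category.assoc, fromSpec_comp, ← Spec.map_comp, ← Spec.map_comp,
          ← CommRingCat.ofHom_comp, ← CommRingCat.ofHom_comp, hq])
  have hℓ : ℓ ≫ j = Spec.map (CommRingCat.ofHom (Ideal.Quotient.mk I)) ≫ hU.fromSpec :=
    hp.lift_fst _ _ _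
  have hℓV : ⊤ ≤ ℓ ⁻¹ᵁ V := by
    rw [← hUV, ← Scheme.Hom.comp_preimage, hℓ]
    exact top_le_preimage_fromSpec hU _
  have hcomp : (coordMap ℓ V hℓV).comp (j.appLE U V hUV.ge).hom = Ideal.Quotient.mk I := by
    have h' : ⊤ ≤ (ℓ ≫ j) ⁻¹ᵁ U := by rw [hℓ]; exact top_le_preimage_fromSpec hU _
    rw [← coordMap_comp ℓ j V U hℓV hUV.ge h', ← coordMap_fromSpec hU (Ideal.Quotient.mk I)]
    congr 1
  refine ⟨?_, fun a ha => ?_⟩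
  · have hI : ∀ a ∈ I, (j.appLE U V hUV.ge).hom a = 0 := by
      change I ≤ RingHom.ker _
      refine Ideal.map_le_iff_le_comap.2 fun a ha => ?_
      have h1 : (j.appLE U V hUV.ge).hom.comp (structureHom s U) = (structureHom s' V).comp φ := by
        have h2 : hV.fromSpec ≫ j ≫ s = hV.fromSpec ≫ s' ≫ _ := congrArg (hV.fromSpec ≫ ·) hp.w
        rw [← Category.assoc, ← Category.assoc, fromSpec_comp s' hV,
          ← IsAffineOpen.SpecMap_appLE_fromSpec j hU hV hUV.ge, Category.assoc, fromSpec_comp,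
          ← Spec.map_comp, ← Spec.map_comp] at h2
        exact congrArg CommRingCat.Hom.hom (Spec.map_injective h2)
      rw [Ideal.mem_comap, RingHom.mem_ker, ← RingHom.comp_apply, h1, RingHom.comp_apply,
        (RingHom.mem_ker).1 ha, map_zero]
    let w : Γ(X, U) ⧸ I →+* Γ(X', V) := Ideal.Quotient.lift I _ hI
    have : IsClosedImmersion (Spec.map (CommRingCat.ofHom φ)) :=
      IsClosedImmersion.spec_of_surjective _ hφ
    -- As a base change of a closed immersion, `j` is a monomorphism, so the identity `hid` may be
    -- checked after composing with it. It makes `w` a left inverse of the coordinate map of `ℓ`,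
    -- and surjectivity follows.
    have : Mono j := ⟨fun g g' h => hp.hom_ext h (by
      rw [← cancel_mono (Spec.map (CommRingCat.ofHom φ)), Category.assoc, Category.assoc, ← hp.w,
        ← Category.assoc, h, Category.assoc])⟩
    have hid : Spec.map (CommRingCat.ofHom w) ≫ ℓ =
        Spec.map (CommRingCat.ofHom (RingHom.id Γ(X', V))) ≫ hV.fromSpec := by
      rw [← cancel_mono j, Category.assoc, hℓ, ← Category.assoc, ← Spec.map_comp]
      refine Eq.trans ?_ ((IsAffineOpen.SpecMap_appLE_fromSpec j hU hV hUV.ge).trans ?_)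
      · rfl
      · refine congrArg (· ≫ j) ?_
        exact ((congrArg (· ≫ hV.fromSpec) (Spec.map_id _)).trans (Category.id_comp _)).symm
    have hw : w.comp (coordMap ℓ V hℓV) = RingHom.id _ := by
      have h' : ⊤ ≤ (Spec.map (CommRingCat.ofHom w) ≫ ℓ) ⁻¹ᵁ V := by
        rw [hid]; exact top_le_preimage_fromSpec hV _
      rw [← coordMap_specMap_comp w ℓ V hℓV h', ← coordMap_fromSpec hV (RingHom.id _)]
      congr 1
    intro b
    obtain ⟨a, ha⟩ := Ideal.Quotient.mk_surjective (coordMap ℓ V hℓV b)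
    refine ⟨a, ?_⟩
    have := RingHom.congr_fun hw b
    rw [RingHom.comp_apply, ← ha] at this
    exact this
  · have h1 := RingHom.congr_fun hcomp a
    rw [RingHom.comp_apply, (RingHom.mem_ker).1 ha, map_zero] at h1
    exact Ideal.Quotient.eq_zero_iff_mem.1 h1.symm

end BaseChange

/-! ### Sections over affine opens of a formal scheme -/

/-- Above level `n` one lifts step by step, below it one pushes down. The induction shifts the
tower, so that lifting is only needed from level `0`. -/
theorem exists_compatible_of_surjective {G : ℕ → Type u} (f : ∀ n, G (n + 1) → G n)
    (hf : ∀ n, Function.Surjective (f n)) (n : ℕ) (b : G n) :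
    ∃ a : ∀ n, G n, (∀ n, f n (a (n + 1)) = a n) ∧ a n = b := by
  induction n generalizing G with
  | zero =>
    choose g hg using hf
    exact ⟨fun n => Nat.rec b (fun m x => g m x) n, fun n => hg n _, rfl⟩
  | succ n ih =>
    obtain ⟨a, ha, hb⟩ := ih (G := fun m => G (m + 1)) (fun m => f (m + 1)) (fun m => hf _) b
    refine ⟨fun m => Nat.casesOn m (f 0 (a 0)) a, fun m => ?_, hb⟩
    cases m with
    | zero => rfl
    | succ m => exact ha m

namespace FormalScheme.AffineOpen

variable {R : Type u} [CommRing R] {π : R} {𝔛 : FormalScheme R π} (U : 𝔛.AffineOpen)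

theorem transition_reduction (n : ℕ) (a : U.Sections) :
    (U.transition n).hom (a.reduction (n + 1)) = a.reduction n :=
  a.2 n

variable {U} in
theorem Sections.ext_reduction {a b : U.Sections} (h : ∀ n, a.reduction n = b.reduction n) :
    a = b :=
  Subtype.ext (funext h)

theorem exists_reduction_eq (x : ∀ n, Γ(𝔛.thickening n, U.opens n))
    (hx : ∀ n, (U.transition n).hom (x (n + 1)) = x n) :
    ∃ a : U.Sections, ∀ n, a.reduction n = x n :=
  ⟨⟨x, hx⟩, fun _ => rfl⟩

theorem reduction_algebraMap (n : ℕ) (r : R) :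
    (algebraMap R U.Sections r).reduction n = U.structureMap n r := rfl

theorem structureMap_eq (n : ℕ) :
    U.structureMap n = (structureHom (𝔛.str n) (U.opens n)).comp (Ideal.Quotient.mk _) := rfl

theorem structureMap_pow_eq_zero {n m : ℕ} (h : n < m) : U.structureMap n (π ^ m) = 0 := by
  rw [structureMap_eq, RingHom.comp_apply, Ideal.Quotient.eq_zero_iff_mem.2, map_zero]
  exact Ideal.mem_span_singleton.2 (pow_dvd_pow π h)

theorem transition_surjective (n : ℕ) : Function.Surjective (U.transition n).hom :=
  (appLE_surjective_and_ker (Ideal.Quotient.factor_surjective _) (𝔛.isPullback n)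
    (U.isAffineOpen _) (U.isAffineOpen n) (U.preimage_opens n)).1

/-- The kernel of `R_{n+1} → R_n` is generated by `π^(n+1)`, and base change along a surjection
extends this to functions on `U`. -/
theorem dvd_of_transition_eq_zero (n : ℕ) {b : Γ(𝔛.thickening (n + 1), U.opens (n + 1))}
    (hb : (U.transition n).hom b = 0) : U.structureMap (n + 1) (π ^ (n + 1)) ∣ b := by
  have h := (appLE_surjective_and_ker (Ideal.Quotient.factor_surjective _) (𝔛.isPullback n)
    (U.isAffineOpen _) (U.isAffineOpen n) (U.preimage_opens n)).2 ((RingHom.mem_ker).2 hb)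
  have hk : RingHom.ker (Trunc.factor π n) ≤ Ideal.span {Ideal.Quotient.mk _ (π ^ (n + 1))} := by
    intro x hx
    obtain ⟨r, rfl⟩ := Ideal.Quotient.mk_surjective x
    have hr : (Ideal.Quotient.mk _ r : Trunc π n) = 0 := hx
    obtain ⟨c, rfl⟩ := Ideal.mem_span_singleton.1 (Ideal.Quotient.eq_zero_iff_mem.1 hr)
    rw [map_mul]
    exact Ideal.mul_mem_right _ _ (Ideal.mem_span_singleton_self _)
  have h2 := Ideal.map_mono hk h
  rw [Ideal.map_span, Set.image_singleton] at h2
  exact Ideal.mem_span_singleton.1 h2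

theorem reduction_surjective (n : ℕ) :
    Function.Surjective (Sections.reduction n : U.Sections →+* _) := fun b => by
  obtain ⟨a, ha, hb⟩ := exists_compatible_of_surjective
    (G := fun n => Γ(𝔛.thickening n, U.opens n)) (fun n => (U.transition n).hom)
    U.transition_surjective n b
  obtain ⟨c, hc⟩ := U.exists_reduction_eq a ha
  exact ⟨c, (hc n).trans hb⟩

theorem reduction_eq_zero_of_le {a : U.Sections} {m n : ℕ} (h : m ≤ n) (ha : a.reduction n = 0) :
    a.reduction m = 0 := by
  induction n, h using Nat.le_induction with
  | base => exact ha
  | succ n h ih => exact ih (by rw [← U.transition_reduction, ha, map_zero])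

/-- The kernel of the reduction modulo `π^(n+1)` is generated by `π^(n+1)`. -/
theorem dvd_of_reduction_eq_zero {n : ℕ} {a : U.Sections} (ha : a.reduction n = 0) :
    algebraMap R U.Sections (π ^ (n + 1)) ∣ a := by
  have step : ∀ m (a : U.Sections), a.reduction m = 0 →
      ∃ c : U.Sections, (a - algebraMap R U.Sections (π ^ (m + 1)) * c).reduction (m + 1) = 0 := by
    intro m a h
    obtain ⟨c', hc'⟩ := U.dvd_of_transition_eq_zero m
      ((U.transition_reduction m a).trans h)
    obtain ⟨c, rfl⟩ := U.reduction_surjective _ c'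
    exact ⟨c, by rw [map_sub, map_mul, reduction_algebraMap, hc', sub_self]⟩
  choose c hc using step
  -- Successive approximation: the remainder `s i` vanishes at level `n + i`, and subtracting
  -- `π^(n+i+1) C i` makes it vanish one level further. No cancellation of `π` is involved; the
  -- quotients are merely chosen.
  let s : ∀ i, {x : U.Sections // x.reduction (n + i) = 0} := fun i =>
    Nat.rec ⟨a, ha⟩ (fun i x => ⟨_, hc (n + i) x.1 x.2⟩) i
  let C : ℕ → U.Sections := fun i => c (n + i) (s i).1 (s i).2
  have hs : ∀ i, (s (i + 1)).1 = (s i).1 - algebraMap R U.Sections (π ^ (n + i + 1)) * C i :=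
    fun _ => rfl
  let B : ℕ → U.Sections := fun m =>
    ∑ i ∈ Finset.range m, algebraMap R U.Sections (π ^ i) * C i
  have hB : ∀ m, a - algebraMap R U.Sections (π ^ (n + 1)) * B m = (s m).1 := by
    intro m
    induction m with
    | zero => simp [B, s]
    | succ m ih =>
      rw [hs, ← ih]
      simp only [B, Finset.sum_range_succ, mul_add, ← mul_assoc, ← map_mul, ← pow_add]
      rw [sub_sub, show n + 1 + m = n + m + 1 by ring]
  -- The quotient is the series `∑ π^i C i`. At level `m` its terms with `i > m` vanish, so the
  -- partial sum `B (m + 1)` represents it there.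
  obtain ⟨b, hb⟩ := U.exists_reduction_eq (fun m => (B (m + 1)).reduction m) fun m => by
    refine (U.transition_reduction m _).trans ?_
    simp only [B, Finset.sum_range_succ _ (m + 1), map_add, map_mul]
    rw [reduction_algebraMap, U.structureMap_pow_eq_zero (Nat.lt_succ_self m), zero_mul, add_zero]
  refine ⟨b, Sections.ext_reduction fun m => ?_⟩
  have h1 := U.reduction_eq_zero_of_le (by omega : m ≤ n + (m + 1)) (s (m + 1)).2
  rw [← hB, map_sub, sub_eq_zero] at h1
  rw [h1, map_mul, map_mul, hb]

/-- On each thickening `π` is nilpotent, and the inverses found there are compatible by uniqueness.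
This fact forces functions to take integral values at points. -/
theorem isUnit_one_add (b : U.Sections) : IsUnit (1 + algebraMap R U.Sections π * b) := by
  have h : ∀ n, IsUnit ((1 + algebraMap R U.Sections π * b).reduction n) := fun n => by
    rw [map_add, map_one, map_mul, reduction_algebraMap]
    refine IsNilpotent.isUnit_one_add ⟨n + 1, ?_⟩
    rw [mul_pow, ← map_pow, U.structureMap_pow_eq_zero (Nat.lt_succ_self n), zero_mul]
  choose y hy using fun n => (h n).exists_right_inv
  obtain ⟨z, hz⟩ := U.exists_reduction_eq y fun n => (h n).mul_left_cancel <| by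
    conv_lhs => rw [← U.transition_reduction, ← map_mul, hy, map_one]
    exact (hy n).symm
  refine IsUnit.of_mul_eq_one z (Sections.ext_reduction fun n => ?_)
  rw [map_mul, map_one, hz, hy]

/-- The intersection of two affine open formal subschemes. -/
def inf (U V : 𝔛.AffineOpen) : 𝔛.AffineOpen where
  opens n := U.opens n ⊓ V.opens n
  preimage_opens n := by
    rw [Scheme.Hom.preimage_inf, U.preimage_opens, V.preimage_opens]
  isAffineOpen n := by
    have := 𝔛.isSeparated n
    -- Separatedness over the affine base gives absolute separatedness, which makes the intersection
    -- of two affine opens affine.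
    have : (𝔛.thickening n).IsSeparated := by
      rw [Scheme.isSeparated_iff, ← Limits.terminal.comp_from (𝔛.str n)]
      infer_instance
    exact (U.isAffineOpen n).inf (V.isAffineOpen n)

theorem inf_le_left (U V : 𝔛.AffineOpen) : U.inf V ≤ U := fun _ => _root_.inf_le_left

theorem inf_le_right (U V : 𝔛.AffineOpen) : U.inf V ≤ V := fun _ => _root_.inf_le_right

end FormalScheme.AffineOpen

/-! ### Points of the generic fiber with values in a field -/

section FieldPoints

variable {R : Type u} [CommRing R] {π : R} {K : Type u} [Field K] [Algebra R K]

/-- A covering sieve contains every morphism whose source is the spectrum of a finite extension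
of the base field. -/
theorem AffinoidSpace.arrows_of_mem_topology [IsDomain R] [IsNoetherianRing R]
    [IsAdicComplete (Ideal.span {π}) R] [IsFractionRing R K]
    (L : Type u) [Field L] [Algebra K L] [FiniteDimensional K L] {Z : AffinoidSpace R π K}
    {S : Sieve Z} (hS : S ∈ AffinoidSpace.topology Z) (f : AffinoidSpace.Sp R π K L ⟶ Z) :
    S f := by
  change affinoidCovers.Saturate Z S at hS
  induction hS with
  | of Z T hT =>
    obtain ⟨n, U, j, hj, hc, rfl⟩ := hT
    let F : Z.functions →ₐ[K] L := f.pullback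
    -- `L` is algebraic over `K`, hence integral over `A(Z)`, so the zero ideal of `L` contracts to
    -- a maximal ideal. The cover condition then yields an open immersion whose image contains it.
    have hmax : (RingHom.ker F).IsMaximal := by
      have hF : F.toRingHom.IsIntegral := RingHom.IsIntegral.tower_top (algebraMap K Z.functions) _
        (by rw [AlgHom.toRingHom_eq_coe, AlgHom.comp_algebraMap]; exact algebraMap_isIntegral_iff.2 inferInstance)
      exact Ideal.isMaximal_comap_of_isIntegral_of_isMaximal' F.toRingHom hF ⊥
    obtain ⟨i, hi⟩ := hc _ hmax
    obtain ⟨g, hg, -⟩ := hj i (AffinoidSpace.Sp R π K L) f (by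
      rintro x ⟨y, hy, rfl⟩
      -- The image of `Sp L` is the single point `ker F`, so the defining property of the open
      -- immersion factors `f` through it.
      have hy' : y = ⊥ := ((Ideal.eq_bot_or_top (K := L) y).resolve_right hy.ne_top)
      subst hy'
      exact hi)
    exact ⟨_, g, j i, ⟨i⟩, hg⟩
  | top => trivial
  | pullback Z S _ Y g ih => exact ih (f ≫ g)
  | transitive Z S T _ _ ih₁ ih₂ =>
    have := ih₂ (ih₁ f) (𝟙 _)
    rwa [Sieve.pullback_apply, Category.id_comp] at this

namespace FormalScheme

variable {𝔛 : FormalScheme R π} [IsDomain R] [IsNoetherianRing R]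
  [IsAdicComplete (Ideal.span {π}) R] [IsFractionRing R K]
  {L : Type u} [Field L] [Algebra K L] [FiniteDimensional K L]

variable (𝔛 K) in
/-- The map from points in charts to points of the generic fiber, before sheafification. -/
abbrev sheafifyPoints : 𝔛.chartPresheaf K ⟶
    sheafify AffinoidSpace.topology (𝔛.chartPresheaf K) :=
  toSheafify AffinoidSpace.topology (𝔛.chartPresheaf K)

variable (K L) in
/-- The section of the presheaf of charts given by a point in a chart. -/
def ChartPoint.toPresheaf (P : 𝔛.ChartPoint K (AffinoidSpace.Sp R π K L)) :
    (𝔛.chartPresheaf K).obj (op (AffinoidSpace.Sp R π K L)) :=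
  ULift.up.{u + 1} (Quot.mk _ P)

theorem Points.ofChart_eq (U : 𝔛.AffineOpen) (α : K ⊗[R] U.Sections →ₐ[K] L) :
    (Points.ofChart U α : 𝔛.Points K L) = (𝔛.sheafifyPoints K).app _
      (ChartPoint.toPresheaf K L ⟨U, α⟩) := rfl

/-- Two points in charts give the same point of the generic fiber if and only if they are
identified by the gluing. -/
theorem Points.ofChart_eq_iff {U V : 𝔛.AffineOpen} {α : K ⊗[R] U.Sections →ₐ[K] L}
    {β : K ⊗[R] V.Sections →ₐ[K] L} :
    (Points.ofChart U α : 𝔛.Points K L) = Points.ofChart V β ↔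
      Quot.mk (ChartPoint.Rel (𝔛 := 𝔛) (Y := AffinoidSpace.Sp R π K L)) ⟨U, α⟩ =
        Quot.mk ChartPoint.Rel ⟨V, β⟩ := by
  rw [Points.ofChart_eq, Points.ofChart_eq]
  refine ⟨fun h => ?_, fun h => ?_⟩
  -- Sections with the same image agree on a covering sieve; over `Sp L` that sieve contains the
  -- identity, so they are already equal in the presheaf.
  · have h1 := Presheaf.equalizerSieve_mem (D := Type (u + 1)) AffinoidSpace.topology
      (𝔛.sheafifyPoints K) _ _ h
    have h2 : (𝔛.chartPresheaf K).map (𝟙 (AffinoidSpace.Sp R π K L)).op _ =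
      (𝔛.chartPresheaf K).map (𝟙 (AffinoidSpace.Sp R π K L)).op _ :=
        AffinoidSpace.arrows_of_mem_topology L h1 (𝟙 _)
    rw [op_id, CategoryTheory.Functor.map_id] at h2
    exact congrArg ULift.down h2
  · exact congrArg (fun x => (𝔛.sheafifyPoints K).app (op (AffinoidSpace.Sp R π K L))
      (ULift.up.{u + 1} x)) h

/-- Every point of the generic fiber with values in a field lies in a chart. -/
theorem Points.exists_ofChart (P : 𝔛.Points K L) :
    ∃ (U : 𝔛.AffineOpen) (α : K ⊗[R] U.Sections →ₐ[K] L), Points.ofChart U α = P := by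
  -- Likewise the covering sieve on which `P` lifts to the presheaf contains the identity.
  have h1 := Presheaf.imageSieve_mem (A := Type (u + 1)) AffinoidSpace.topology
    (𝔛.sheafifyPoints K) (U := op (AffinoidSpace.Sp R π K L)) P
  obtain ⟨t, ht⟩ := AffinoidSpace.arrows_of_mem_topology L h1 (𝟙 _)
  rw [op_id, CategoryTheory.Functor.map_id] at ht
  obtain ⟨t, rfl⟩ : ∃ t', t = ChartPoint.toPresheaf K L t' := by
    rcases t with ⟨⟨t⟩⟩
    exact ⟨t, rfl⟩
  exact ⟨t.chart, t.hom, ht⟩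

theorem Points.gal_ofChart (U : 𝔛.AffineOpen) (α : K ⊗[R] U.Sections →ₐ[K] L) (τ : L ≃ₐ[K] L) :
    (Points.ofChart U α).gal τ = Points.ofChart U (τ.toAlgHom.comp α) :=
  (NatTrans.naturality_apply (C := (AffinoidSpace R π K)ᵒᵖ) (D := Type (u + 1))
    (𝔛.sheafifyPoints K)
    (Quiver.Hom.op (X := AffinoidSpace.Sp R π K L) (Y := AffinoidSpace.Sp R π K L)
      (AffinoidSpace.Hom.mk τ.toAlgHom))
    (ChartPoint.toPresheaf K L ⟨U, α⟩)).symm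

end FormalScheme

end FieldPoints

/-! ### Points and sections of a formal scheme -/

section PointsSections

variable {R : Type u} [CommRing R] {π : R}

theorem FormalScheme.Section.ext_hom {𝔛 : FormalScheme R π} {R' : Type u} [CommRing R']
    [Algebra R R'] {g g' : 𝔛.Section R'} (h : ∀ n, g.hom n = g'.hom n) : g = g' := by
  cases g
  cases g'
  obtain rfl := funext h
  rfl

variable {K : Type u} [Field K] [Algebra R K]

/-- The properties of the ring of integers `R'` of a complete valued extension `L` of `K`:
it is complete and local, and an element of `L` outside `R'` is so large that `-π⁻¹` is a
polynomial in it with coefficients in `R`. -/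
structure IsValuationSubring (π : R) (K L R' : Type u) [Field K] [Algebra R K] [Field L]
    [Algebra K L] [CommRing R'] [Algebra R R'] [Algebra R' L] : Prop where
  injective : Function.Injective (algebraMap R' L)
  algebraMap_eq (r : R) :
    algebraMap R' L (algebraMap R R' r) = algebraMap K L (algebraMap R K r)
  complete : TruncComplete (algebraMap R R' π)
  isLocalRing : IsLocalRing R'
  not_isUnit : ¬ IsUnit (algebraMap R R' π)
  mem_or_large (x : L) : (∃ r, algebraMap R' L r = x) ∨ ∃ q : Polynomial R,
    1 + algebraMap K L (algebraMap R K π) *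
      q.eval₂ ((algebraMap K L).comp (algebraMap R K)) x = 0

variable {L R' : Type u} [Field L] [Algebra K L] [CommRing R'] [Algebra R R'] [Algebra R' L]

/-- The ring map `A → L` underlying a `K`-algebra map `A ⊗_R K → L`. -/
def integralPart {A : Type u} [CommRing A] [Algebra R A] (α : K ⊗[R] A →ₐ[K] L) : A →+* L :=
  α.toRingHom.comp (Algebra.TensorProduct.includeRight : A →ₐ[R] K ⊗[R] A).toRingHom

theorem integralPart_apply {A : Type u} [CommRing A] [Algebra R A] (α : K ⊗[R] A →ₐ[K] L)
    (a : A) : integralPart α a = α (1 ⊗ₜ a) := rfl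

theorem integralPart_algebraMap {A : Type u} [CommRing A] [Algebra R A] (α : K ⊗[R] A →ₐ[K] L)
    (r : R) : integralPart α (algebraMap R A r) = algebraMap K L (algebraMap R K r) := by
  rw [integralPart_apply, ← α.commutes]
  congr 1
  exact ((Algebra.TensorProduct.includeRight : A →ₐ[R] K ⊗[R] A).commutes r).trans
    (IsScalarTower.algebraMap_apply R K (K ⊗[R] A) r)

theorem algHom_ext_integralPart {A : Type u} [CommRing A] [Algebra R A]
    {α β : K ⊗[R] A →ₐ[K] L} (h : integralPart α = integralPart β) : α = β := by
  refine AlgHom.ext fun x => ?_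
  induction x using TensorProduct.induction_on with
  | zero => rw [map_zero, map_zero]
  | add x y hx hy => rw [map_add, map_add, hx, hy]
  | tmul c a =>
    have h1 : c ⊗ₜ[R] a = c • (1 : K) ⊗ₜ[R] a := by
      rw [TensorProduct.smul_tmul', smul_eq_mul, mul_one]
    rw [h1, map_smul, map_smul]
    exact congrArg (c • ·) (RingHom.congr_fun h a)

theorem exists_integralPart_eq {A : Type u} [CommRing A] [Algebra R A] (h : A →+* L)
    (hh : ∀ r, h (algebraMap R A r) = algebraMap K L (algebraMap R K r)) :
    ∃ α : K ⊗[R] A →ₐ[K] L, integralPart α = h := by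
  let _ : Algebra R L := ((algebraMap K L).comp (algebraMap R K)).toAlgebra
  have : IsScalarTower R K L := .of_algebraMap_eq fun _ => rfl
  let h' : A →ₐ[R] L := { h with commutes' := hh }
  refine ⟨Algebra.TensorProduct.lift (Algebra.ofId K L) h' fun _ _ => .all _ _,
    RingHom.ext fun a => ?_⟩
  refine (Algebra.TensorProduct.lift_tmul (Algebra.ofId K L) h' (fun _ _ => .all _ _) 1 a).trans ?_
  rw [map_one, one_mul]
  rfl

variable {𝔛 : FormalScheme R π}

/-- The functions on an affine open take integral values at every point. -/
theorem IsValuationSubring.exists_eq (hR' : IsValuationSubring π K L R') (U : 𝔛.AffineOpen)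
    (α : K ⊗[R] U.Sections →ₐ[K] L) : ∃ h : U.Sections →+* R',
      (algebraMap R' L).comp h = integralPart α := by
  have key : ∀ a, ∃ r, algebraMap R' L r = integralPart α a := by
    intro a
    refine (hR'.mem_or_large (integralPart α a)).resolve_right ?_
    rintro ⟨q, hq⟩
    -- For a non-integral value `x` of `a`, the unit `1 + π q(a)` would be mapped to `1 + π q(x) =
    -- 0`.
    have h1 := (U.isUnit_one_add (Polynomial.aeval a q)).map (integralPart α)
    rw [map_add, map_one, map_mul, integralPart_algebraMap, Polynomial.aeval_def,
      Polynomial.hom_eval₂] at h1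
    have h2 : (integralPart α).comp (algebraMap R U.Sections) =
      (algebraMap K L).comp (algebraMap R K) := RingHom.ext (integralPart_algebraMap α)
    rw [h2, hq] at h1
    exact not_isUnit_zero h1
  choose h hh using key
  refine ⟨{ toFun := h, map_one' := ?_, map_mul' := ?_, map_zero' := ?_, map_add' := ?_ },
    RingHom.ext hh⟩ <;> intros <;> apply hR'.injective <;>
    simp only [hh, map_one, map_mul, map_zero, map_add]

theorem IsValuationSubring.apply_algebraMap (hR' : IsValuationSubring π K L R')
    {A : Type u} [CommRing A] [Algebra R A] {α : K ⊗[R] A →ₐ[K] L} {h : A →+* R'}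
    (hh : (algebraMap R' L).comp h = integralPart α) (r : R) :
    h (algebraMap R A r) = algebraMap R R' r := by
  apply hR'.injective
  rw [← RingHom.comp_apply, hh, integralPart_algebraMap, hR'.algebraMap_eq]

/-- The section `g` factors through `U` and is given there by the ring map `h`. -/
structure FormalScheme.Section.IsGivenBy (g : 𝔛.Section R') (U : 𝔛.AffineOpen)
    (h : U.Sections →+* R') : Prop where
  top_le (n : ℕ) : ⊤ ≤ g.hom n ⁻¹ᵁ U.opens n
  mk_eq (n : ℕ) (a : U.Sections) :
    Ideal.Quotient.mk (Ideal.span {algebraMap R R' π ^ (n + 1)}) (h a) =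
      coordMap (g.hom n) (U.opens n) (top_le n) (a.reduction n)

namespace FormalScheme.Section.IsGivenBy

variable {g g' : 𝔛.Section R'} {U V : 𝔛.AffineOpen} {h : U.Sections →+* R'}

/-- The reductions are surjective, so `h` fixes the coordinate map at every level. -/
theorem section_eq (hg : g.IsGivenBy U h) (hg' : g'.IsGivenBy U h) : g = g' := by
  refine Section.ext_hom fun n => eq_of_coordMap_eq (U.isAffineOpen n) (hg.top_le n)
    (hg'.top_le n) (RingHom.ext fun b => ?_)
  obtain ⟨a, rfl⟩ := U.reduction_surjective n b
  rw [← hg.mk_eq, hg'.mk_eq]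

/-- Conversely, the section fixes `h` modulo every `π^(n+1)`, and `R'` is the limit of its
truncations. -/
theorem ringHom_eq (hR' : IsValuationSubring π K L R') {h' : U.Sections →+* R'}
    (hg : g.IsGivenBy U h) (hg' : g.IsGivenBy U h') : h = h' :=
  RingHom.ext fun a => hR'.complete.ext fun n => by rw [hg.mk_eq, hg'.mk_eq]

theorem restrict {h : V.Sections →+* R'} (hg : g.IsGivenBy V h) (hVU : V ≤ U) :
    g.IsGivenBy U (h.comp (AffineOpen.restrict hVU).toRingHom) where
  top_le n := (hg.top_le n).trans fun _ hx => hVU n hx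
  mk_eq n a := by
    refine (hg.mk_eq n _).trans ?_
    exact coordMap_res (g.hom n) (hVU n) (hg.top_le n) _ _

end FormalScheme.Section.IsGivenBy

/-- The map `h` is `R`-linear because `R' → L` is injective, and the kernel of each reduction is
generated by `π^(n+1)`; hence `h` descends to `𝒪(U_n) → R'/(π^(n+1))` at every level. -/
theorem IsValuationSubring.exists_section (hR' : IsValuationSubring π K L R')
    {U : 𝔛.AffineOpen} {α : K ⊗[R] U.Sections →ₐ[K] L} {h : U.Sections →+* R'}
    (hh : (algebraMap R' L).comp h = integralPart α) :
    ∃ g : 𝔛.Section R', g.IsGivenBy U h := by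
  have hker : ∀ n, RingHom.ker (FormalScheme.AffineOpen.Sections.reduction (U := U) n) ≤
      RingHom.ker ((Ideal.Quotient.mk (Ideal.span {algebraMap R R' π ^ (n + 1)})).comp h) := by
    intro n a ha
    obtain ⟨b, rfl⟩ := U.dvd_of_reduction_eq_zero ((RingHom.mem_ker).1 ha)
    rw [RingHom.mem_ker, RingHom.comp_apply, map_mul, hR'.apply_algebraMap hh, map_pow]
    exact Ideal.Quotient.eq_zero_iff_mem.2 (Ideal.mul_mem_right _ _
      (Ideal.mem_span_singleton_self _))
  let φ : ∀ n, Γ(𝔛.thickening n, U.opens n) →+* Trunc (algebraMap R R' π) n := fun n =>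
    (FormalScheme.AffineOpen.Sections.reduction (U := U) n).liftOfSurjective
      (U.reduction_surjective n) ⟨(Ideal.Quotient.mk _).comp h, hker n⟩
  have hφ : ∀ n (a : U.Sections), φ n (a.reduction n) = Ideal.Quotient.mk _ (h a) := fun n a =>
    RingHom.liftOfRightInverse_comp_apply _ _ _ _ _
  have htop : ∀ n, ⊤ ≤
      (Spec.map (CommRingCat.ofHom (φ n)) ≫ (U.isAffineOpen n).fromSpec) ⁻¹ᵁ U.opens n :=
    fun n => top_le_preimage_fromSpec (U.isAffineOpen n) (φ n)
  refine ⟨{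
    hom n := Spec.map (CommRingCat.ofHom (φ n)) ≫ (U.isAffineOpen n).fromSpec
    hom_str n := ?_
    hom_trans n := ?_ }, htop, fun n a => ?_⟩
  · rw [specMap_comp_str _ _ (U.isAffineOpen n) (htop n), coordMap_fromSpec]
    congr 2
    refine Ideal.Quotient.ringHom_ext (RingHom.ext fun r => ?_)
    refine (hφ n (algebraMap R U.Sections r)).trans ?_
    rw [hR'.apply_algebraMap hh]
    rfl
  · have h1 : ⊤ ≤ ((Spec.map (CommRingCat.ofHom (φ n)) ≫ (U.isAffineOpen n).fromSpec) ≫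
        𝔛.trans n) ⁻¹ᵁ U.opens (n + 1) := by
      rw [Scheme.Hom.comp_preimage, U.preimage_opens]
      exact htop n
    have h2 : ⊤ ≤ (Spec.map (CommRingCat.ofHom (Trunc.factor (algebraMap R R' π) n)) ≫
        Spec.map (CommRingCat.ofHom (φ (n + 1))) ≫ (U.isAffineOpen (n + 1)).fromSpec) ⁻¹ᵁ
        U.opens (n + 1) := by
      rw [Scheme.Hom.comp_preimage, top_le_iff.1 (htop (n + 1))]
      exact le_top
    refine eq_of_coordMap_eq (U.isAffineOpen (n + 1)) h1 h2 (RingHom.ext fun b => ?_)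
    obtain ⟨a, rfl⟩ := U.reduction_surjective _ b
    rw [coordMap_comp _ _ _ _ (htop n) (U.preimage_opens n).ge, coordMap_fromSpec,
      coordMap_specMap_comp _ _ _ (htop (n + 1)), coordMap_fromSpec, RingHom.comp_apply,
      RingHom.comp_apply, hφ]
    exact (congrArg (φ n) (U.transition_reduction n a)).trans (hφ n a)
  · rw [coordMap_fromSpec, hφ]

/-- The coordinate maps of the section form a compatible system with values in the truncations of
`R'`, whose limit is `R'`. -/
theorem IsValuationSubring.exists_isGivenBy (hR' : IsValuationSubring π K L R')
    {g : 𝔛.Section R'} {U : 𝔛.AffineOpen} (hU : ∀ n, ⊤ ≤ g.hom n ⁻¹ᵁ U.opens n) :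
    ∃ h : U.Sections →+* R', g.IsGivenBy U h ∧
      ∃ α : K ⊗[R] U.Sections →ₐ[K] L, (algebraMap R' L).comp h = integralPart α := by
  obtain ⟨h, hh⟩ := hR'.complete.exists_lift
    (fun n => (coordMap (g.hom n) (U.opens n) (hU n)).comp
      (FormalScheme.AffineOpen.Sections.reduction n)) fun n => by
    refine RingHom.ext fun a => ?_
    have h1 : ⊤ ≤ (g.hom n ≫ 𝔛.trans n) ⁻¹ᵁ U.opens (n + 1) := by
      rw [Scheme.Hom.comp_preimage, U.preimage_opens]
      exact hU n
    have h2 : ⊤ ≤ (Spec.map (CommRingCat.ofHom (Trunc.factor (algebraMap R R' π) n)) ≫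
        g.hom (n + 1)) ⁻¹ᵁ U.opens (n + 1) := g.hom_trans n ▸ h1
    have h3 := coordMap_specMap_comp (Trunc.factor (algebraMap R R' π) n) (g.hom (n + 1))
      (U.opens (n + 1)) (hU (n + 1)) h2
    have h4 := coordMap_comp (g.hom n) (𝔛.trans n) (U.opens n) (U.opens (n + 1)) (hU n)
      (U.preimage_opens n).ge h1
    have h5 : coordMap (g.hom n ≫ 𝔛.trans n) (U.opens (n + 1)) h1 = coordMap _ _ h2 := by
      congr 1
      exact g.hom_trans n
    rw [h3, h4] at h5
    refine (RingHom.congr_fun h5 (a.reduction (n + 1))).symm.trans ?_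
    exact congrArg (coordMap (g.hom n) (U.opens n) (hU n)) (U.transition_reduction n a)
  refine ⟨h, ⟨hU, fun n a => RingHom.congr_fun (hh n) a⟩, ?_⟩
  obtain ⟨α, hα⟩ := exists_integralPart_eq (K := K) ((algebraMap R' L).comp h) fun r => by
    rw [RingHom.comp_apply, ← hR'.algebraMap_eq]
    congr 1
    -- `R`-linearity is tested on truncations, where it says that the section lies over `Spec R_n`.
    refine hR'.complete.ext fun n => ?_
    rw [← RingHom.comp_apply, hh]
    have h1 := specMap_comp_str (g.hom n) (𝔛.str n) (U.isAffineOpen n) (hU n)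
    rw [g.hom_str n] at h1
    have h2 := congrArg CommRingCat.Hom.hom (Spec.map_injective h1)
    exact (RingHom.congr_fun h2 (Ideal.Quotient.mk _ r)).symm
  exact ⟨α, hα.symm⟩

theorem integralPart_restrict {U V : 𝔛.AffineOpen} (hVU : V ≤ U)
    (β : K ⊗[R] V.Sections →ₐ[K] L) :
    integralPart (β.comp (Algebra.TensorProduct.map (AlgHom.id K K)
      (FormalScheme.AffineOpen.restrict hVU))) =
      (integralPart β).comp (FormalScheme.AffineOpen.restrict hVU).toRingHom := by
  refine RingHom.ext fun a => ?_
  refine congrArg β (Algebra.TensorProduct.map_tmul _ _ _ _)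

variable [IsDomain R] [IsNoetherianRing R] [IsAdicComplete (Ideal.span {π}) R]
  [IsFractionRing R K] [FiniteDimensional K L]

/-- The elementwise lifts to `R'` in the definition assemble into a ring map, since they are unique.
-/
theorem IsValuationSubring.isGenericFiber_iff (hR' : IsValuationSubring π K L R')
    (g : 𝔛.Section R') (P : 𝔛.Points K L) :
    IsGenericFiber g P ↔ ∃ (U : 𝔛.AffineOpen) (h : U.Sections →+* R')
      (α : K ⊗[R] U.Sections →ₐ[K] L), FormalScheme.Points.ofChart U α = P ∧
        (algebraMap R' L).comp h = integralPart α ∧ g.IsGivenBy U h := by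
  constructor
  · rintro ⟨U, hU, α, hP, hα⟩
    obtain ⟨h, hh⟩ := hR'.exists_eq U α
    refine ⟨U, h, α, hP, hh, hU, fun n a => ?_⟩
    obtain ⟨r, hr, hr'⟩ := hα a
    obtain rfl : r = h a := hR'.injective (hr.trans (RingHom.congr_fun hh a).symm)
    exact hr' n
  · rintro ⟨U, h, α, hP, hh, hg⟩
    exact ⟨U, hg.top_le, α, hP, fun a => ⟨h a, RingHom.congr_fun hh a, fun n => hg.mk_eq n a⟩⟩

/-- Every point of the generic fiber is the generic fiber of a unique section. -/
theorem IsValuationSubring.existsUnique_section (hR' : IsValuationSubring π K L R')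
    (P : 𝔛.Points K L) : ∃! g : 𝔛.Section R', IsGenericFiber g P := by
  have key : ∀ Q : 𝔛.ChartPoint K (AffinoidSpace.Sp R π K L), ∃ g : 𝔛.Section R',
      ∃ h : Q.chart.Sections →+* R',
        (algebraMap R' L).comp h = integralPart (L := L) Q.hom ∧ g.IsGivenBy Q.chart h := by
    intro Q
    obtain ⟨h, hh⟩ := hR'.exists_eq Q.chart Q.hom
    obtain ⟨g, hg⟩ := hR'.exists_section hh
    exact ⟨g, h, hh, hg⟩
  have huniq : ∀ {U : 𝔛.AffineOpen} {α : K ⊗[R] U.Sections →ₐ[K] L} {h h' : U.Sections →+* R'}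
      {g g' : 𝔛.Section R'}, (algebraMap R' L).comp h = integralPart α →
      (algebraMap R' L).comp h' = integralPart α → g.IsGivenBy U h → g'.IsGivenBy U h' →
      g = g' := by
    intro U α h h' g g' hh hh' hg hg'
    obtain rfl : h = h' := RingHom.ext fun a =>
      hR'.injective (RingHom.congr_fun (hh.trans hh'.symm) a)
    exact hg.section_eq hg'
  choose sec hom hhom hsec using key
  -- The section attached to a chart point is unchanged by the gluing relation, so it descends to
  -- the quotient. This gives independence of the chart without analysing the generated equivalence
  -- relation.
  have hrel : ∀ Q Q', FormalScheme.ChartPoint.Rel Q Q' → sec Q = sec Q' := by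
    rintro ⟨V, β⟩ ⟨U, α⟩ ⟨hVU, hα⟩
    refine huniq (α := α) ?_ (hhom ⟨U, α⟩) ((hsec ⟨V, β⟩).restrict hVU) (hsec ⟨U, α⟩)
    rw [← RingHom.comp_assoc, hhom ⟨V, β⟩]
    exact (integralPart_restrict (L := L) hVU β).symm.trans (congrArg (integralPart (L := L)) hα.symm)
  obtain ⟨U, α, hP⟩ := P.exists_ofChart
  refine ⟨sec ⟨U, α⟩, (hR'.isGenericFiber_iff _ _).2 ⟨U, _, α, hP, hhom ⟨U, α⟩, hsec ⟨U, α⟩⟩,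
    fun g hg => ?_⟩
  obtain ⟨V, h, β, hP', hh, hg'⟩ := (hR'.isGenericFiber_iff _ _).1 hg
  have h1 := congrArg (Quot.lift sec hrel)
    (FormalScheme.Points.ofChart_eq_iff.1 (hP'.trans hP.symm))
  exact (huniq hh (hhom ⟨V, β⟩) hg' (hsec ⟨V, β⟩)).trans h1

/-- A section determines its generic fiber. -/
theorem IsValuationSubring.point_eq (hR' : IsValuationSubring π K L R') {g : 𝔛.Section R'}
    {P Q : 𝔛.Points K L} (hP : IsGenericFiber g P) (hQ : IsGenericFiber g Q) : P = Q := by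
  obtain ⟨U, h, α, rfl, hh, hg⟩ := (hR'.isGenericFiber_iff _ _).1 hP
  obtain ⟨V, h', β, rfl, hh', hg'⟩ := (hR'.isGenericFiber_iff _ _).1 hQ
  -- The section factors through both charts, hence through their intersection, where it defines
  -- `γ`. Both given chart points are glued to this one.
  obtain ⟨hW, hgW, γ, hγ⟩ := hR'.exists_isGivenBy (g := g) (U := U.inf V) fun n x hx =>
    ⟨hg.top_le n hx, hg'.top_le n hx⟩
  have key : ∀ {U : 𝔛.AffineOpen} {h : U.Sections →+* R'} {α : K ⊗[R] U.Sections →ₐ[K] L} {W}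
      (hWU : W ≤ U) {hW : W.Sections →+* R'} {γ : K ⊗[R] W.Sections →ₐ[K] L},
      (algebraMap R' L).comp h = integralPart α → g.IsGivenBy U h →
      (algebraMap R' L).comp hW = integralPart γ → g.IsGivenBy W hW →
      FormalScheme.Points.ofChart W γ = (FormalScheme.Points.ofChart U α : 𝔛.Points K L) := by
    intro U h α W hWU hW γ hh hg hγ hgW
    refine FormalScheme.Points.ofChart_eq_iff.2 (Quot.sound ⟨hWU, algHom_ext_integralPart (L := L) ?_⟩)
    refine Eq.trans ?_ (integralPart_restrict hWU γ).symm
    rw [← hγ, RingHom.comp_assoc, ← hg.ringHom_eq hR' (hgW.restrict hWU)]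
    exact hh.symm
  rw [← key (U.inf_le_left V) hh hg hγ hgW, ← key (U.inf_le_right V) hh' hg' hγ hgW]

theorem IsValuationSubring.existsUnique_point (hR' : IsValuationSubring π K L R')
    {g : 𝔛.Section R'} {U : 𝔛.AffineOpen} (hU : ∀ n, ⊤ ≤ g.hom n ⁻¹ᵁ U.opens n) :
    ∃! P : 𝔛.Points K L, IsGenericFiber g P := by
  obtain ⟨h, hg, α, hα⟩ := hR'.exists_isGivenBy hU
  exact ⟨_, (hR'.isGenericFiber_iff _ _).2 ⟨U, h, α, rfl, hα, hg⟩,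
    fun Q hQ => hR'.point_eq hQ ((hR'.isGenericFiber_iff _ _).2 ⟨U, h, α, rfl, hα, hg⟩)⟩

/-- A point specializes exactly to the closed point of the section of which it is the generic
fiber. -/
theorem IsValuationSubring.specializesTo_iff (hR' : IsValuationSubring π K L R')
    {κ : Type u} [Field κ] (ρ : R' →+* κ) {g : 𝔛.Section R'} {P : 𝔛.Points K L}
    (hP : IsGenericFiber g P) (ρ₀ : Trunc (algebraMap R R' π) 0 →+* κ)
    (hρ : ρ₀.comp (Ideal.Quotient.mk _) = ρ) (y : Spec (.of κ) ⟶ 𝔛.thickening 0) :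
    SpecializesTo ρ P y ↔ y = Spec.map (CommRingCat.ofHom ρ₀) ≫ g.hom 0 := by
  have key : ∀ {U : 𝔛.AffineOpen} {h : U.Sections →+* R'} (hg : g.IsGivenBy U h)
      (hx : ⊤ ≤ (Spec.map (CommRingCat.ofHom ρ₀) ≫ g.hom 0) ⁻¹ᵁ U.opens 0) (a : U.Sections),
      ρ (h a) = coordMap (Spec.map (CommRingCat.ofHom ρ₀) ≫ g.hom 0) (U.opens 0) hx
        (a.reduction 0) := by
    intro U h hg hx a
    rw [coordMap_specMap_comp _ _ _ (hg.top_le 0), RingHom.comp_apply, ← hg.mk_eq, ← hρ]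
    rfl
  have htop : ∀ {U : 𝔛.AffineOpen} {h : U.Sections →+* R'} (hg : g.IsGivenBy U h),
      ⊤ ≤ (Spec.map (CommRingCat.ofHom ρ₀) ≫ g.hom 0) ⁻¹ᵁ U.opens 0 := by
    intro U h hg
    rw [Scheme.Hom.comp_preimage, top_le_iff.1 (hg.top_le 0)]
    exact le_top
  constructor
  · rintro ⟨U, hU, α, hα, hy⟩
    obtain ⟨h, hh⟩ := hR'.exists_eq U α
    obtain ⟨g', hg'⟩ := hR'.exists_section hh
    -- The chart witnessing specialization may differ from the one witnessing `hP`; uniqueness of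
    -- the section makes them comparable.
    obtain rfl : g = g' := (hR'.existsUnique_section P).unique hP
      ((hR'.isGenericFiber_iff _ _).2 ⟨U, h, α, hα, hh, hg'⟩)
    refine eq_of_coordMap_eq (U.isAffineOpen 0) hU (htop hg') (RingHom.ext fun b => ?_)
    obtain ⟨a, rfl⟩ := U.reduction_surjective 0 b
    obtain ⟨r, hr, hr'⟩ := hy a
    obtain rfl : r = h a := hR'.injective (hr.trans (RingHom.congr_fun hh a).symm)
    exact hr'.symm.trans (key hg' _ a)
  · rintro rfl
    obtain ⟨U, h, α, hα, hh, hg⟩ := (hR'.isGenericFiber_iff _ _).1 hP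
    exact ⟨U, htop hg, α, hα, fun a => ⟨h a, RingHom.congr_fun hh a, key hg _ a⟩⟩

/-- The action of the Galois group on points, in terms of sections. -/
theorem IsValuationSubring.isGenericFiber_gal (hR' : IsValuationSubring π K L R')
    {g g' : 𝔛.Section R'} {P : 𝔛.Points K L} (hP : IsGenericFiber g P) (τ : L ≃ₐ[K] L)
    (τ' : R' →+* R') (hτ : ∀ r, algebraMap R' L (τ' r) = τ (algebraMap R' L r))
    (hτ' : τ' (algebraMap R R' π) = algebraMap R R' π)
    (hg' : ∀ n, g'.hom n = Spec.map (CommRingCat.ofHom (Trunc.map τ' hτ' n)) ≫ g.hom n) :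
    IsGenericFiber g' (P.gal τ) := by
  obtain ⟨U, h, α, rfl, hh, hg⟩ := (hR'.isGenericFiber_iff _ _).1 hP
  -- The chart is kept: `τ` acts only on values in `L`, and on integral values this is `τ'`.
  refine (hR'.isGenericFiber_iff _ _).2 ⟨U, τ'.comp h, τ.toAlgHom.comp α,
    (FormalScheme.Points.gal_ofChart U α τ).symm, RingHom.ext fun a => ?_, ⟨fun n => ?_,
    fun n a => ?_⟩⟩
  · refine (hτ _).trans (congrArg τ (RingHom.congr_fun hh a))
  · rw [hg', Scheme.Hom.comp_preimage, top_le_iff.1 (hg.top_le n)]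
    exact le_top
  · have h1 : ⊤ ≤ (Spec.map (CommRingCat.ofHom (Trunc.map τ' hτ' n)) ≫ g.hom n) ⁻¹ᵁ
        U.opens n := by
      rw [Scheme.Hom.comp_preimage, top_le_iff.1 (hg.top_le n)]
      exact le_top
    have h2 : coordMap (Spec.map (CommRingCat.ofHom (Trunc.map τ' hτ' n)) ≫ g.hom n)
        (U.opens n) h1 (a.reduction n) = Ideal.Quotient.mk _ (τ' (h a)) := by
      rw [coordMap_specMap_comp _ _ _ (hg.top_le n), RingHom.comp_apply, ← hg.mk_eq]
      rfl
    refine h2.symm.trans ?_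
    congr! 1
    congr 1
    exact (hg' n).symm

end PointsSections

/-! ### Sections of the completion of a scheme -/

/-- Used for the thickenings of a completion, which are closed subschemes of `Y`: affine opens of
`Y` thereby give affine opens of the formal scheme. -/
theorem isAffineOpen_preimage_fst {X Y Z : Scheme.{u}} (f : X ⟶ Z) (g : Y ⟶ Z)
    (hg : IsClosedImmersion g) {W : X.Opens} (hW : IsAffineOpen W) :
    IsAffineOpen (Limits.pullback.fst f g ⁻¹ᵁ W) :=
  have : IsClosedImmersion (Limits.pullback.fst f g) := inferInstance
  hW.preimage _

section Completion

variable {R : Type u} [CommRing R] {Y : Scheme.{u}} (y : Y ⟶ Spec (.of R))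
  [LocallyOfFiniteType y] [QuasiCompact y] [IsSeparated y] (π : R)

/-- The morphism from a thickening of the completion of `Y` to `Y`. -/
def completionFst (n : ℕ) : (completion y π).thickening n ⟶ Y := Limits.pullback.fst _ _

theorem trans_completionFst (n : ℕ) :
    (completion y π).trans n ≫ completionFst y π (n + 1) = completionFst y π n :=
  Limits.pullback.lift_fst _ _ _

theorem completionFst_comp (n : ℕ) : completionFst y π n ≫ y =
    (completion y π).str n ≫ Spec.map (CommRingCat.ofHom (Ideal.Quotient.mk _)) :=
  Limits.pullback.condition

/-- The affine open of the completion given by an affine open of the scheme. -/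
def completionOpen {W : Y.Opens} (hW : IsAffineOpen W) : (completion y π).AffineOpen where
  opens n := completionFst y π n ⁻¹ᵁ W
  preimage_opens n := by rw [← Scheme.Hom.comp_preimage, trans_completionFst]
  isAffineOpen n :=
    isAffineOpen_preimage_fst _ _
      (IsClosedImmersion.spec_of_surjective _ Ideal.Quotient.mk_surjective) hW

variable {y π} {R' : Type u} [CommRing R'] [Algebra R R']

theorem hom_completeSection (σ : Spec (.of R') ⟶ Y)
    (hσ : σ ≫ y = Spec.map (CommRingCat.ofHom (algebraMap R R'))) (n : ℕ) :
    (completeSection y π σ hσ).hom n ≫ completionFst y π n =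
      truncInclusion (algebraMap R R' π) n ≫ σ :=
  Limits.pullback.lift_fst _ _ _

theorem specMap_factor_comp_section (g : (completion y π).Section R') (n : ℕ) :
    Spec.map (CommRingCat.ofHom (Trunc.factor (algebraMap R R' π) n)) ≫ g.hom (n + 1) ≫
      completionFst y π (n + 1) = g.hom n ≫ completionFst y π n := by
  rw [← Category.assoc, ← g.hom_trans, Category.assoc, trans_completionFst]

theorem section_ext_completionFst {g g' : (completion y π).Section R'}
    (h : ∀ n, g.hom n ≫ completionFst y π n = g'.hom n ≫ completionFst y π n) : g = g' :=
  FormalScheme.Section.ext_hom fun n =>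
    Limits.pullback.hom_ext (h n) ((g.hom_str n).trans (g'.hom_str n).symm)

section

variable [IsLocalRing R'] (hπ : ¬ IsUnit (algebraMap R R' π))
include hπ

theorem exists_affineOpen_top_le_section (g : (completion y π).Section R') :
    ∃ U : (completion y π).AffineOpen, ∀ n, ⊤ ≤ g.hom n ⁻¹ᵁ U.opens n := by
  have := isLocalRing_trunc hπ 0
  obtain ⟨W, hW, h0⟩ := exists_affineOpen_top_le (g.hom 0 ≫ completionFst y π 0)
  exact ⟨completionOpen y π hW, top_le_preimage_of_compatible hπ
    (fun n => g.hom n ≫ completionFst y π n) (specMap_factor_comp_section g) h0⟩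

variable (hR' : TruncComplete (algebraMap R R' π))
include hR'

/-- Algebraization holds because `R'` is local and complete. That the resulting morphism lies over
`Spec R` is again tested on truncations. -/
theorem exists_completeSection_eq (g : (completion y π).Section R') :
    ∃ (σ : Spec (.of R') ⟶ Y) (hσ : σ ≫ y = Spec.map (CommRingCat.ofHom (algebraMap R R'))),
      completeSection y π σ hσ = g := by
  obtain ⟨σ, h⟩ := hR'.exists_hom hπ (fun n => g.hom n ≫ completionFst y π n)
    (specMap_factor_comp_section g)
  refine ⟨σ, hR'.hom_ext hπ fun n => ?_, section_ext_completionFst fun n => ?_⟩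
  · rw [← Category.assoc, h, Category.assoc, completionFst_comp, ← Category.assoc, g.hom_str,
      ← Spec.map_comp, ← Spec.map_comp]
    rfl
  · rw [hom_completeSection, h]

theorem completeSection_injective {σ σ' : Spec (.of R') ⟶ Y}
    {hσ : σ ≫ y = Spec.map (CommRingCat.ofHom (algebraMap R R'))}
    {hσ' : σ' ≫ y = Spec.map (CommRingCat.ofHom (algebraMap R R'))}
    (h : completeSection y π σ hσ = completeSection y π σ' hσ') : σ = σ' :=
  hR'.hom_ext hπ fun n => by
    rw [← hom_completeSection σ hσ, h, hom_completeSection]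

end

variable {K L : Type u} [Field K] [Algebra R K] [Field L] [Algebra K L] [Algebra R' L]
  [IsDomain R] [IsNoetherianRing R] [IsAdicComplete (Ideal.span {π}) R] [IsFractionRing R K]
  [FiniteDimensional K L]

/-- The points of the generic fiber of a completion are the sections over the ring of integers. -/
theorem IsValuationSubring.exists_points_equiv (hR' : IsValuationSubring π K L R') :
    ∃ E : (completion y π).Points K L ≃
        {σ : Spec (.of R') ⟶ Y // σ ≫ y = Spec.map (CommRingCat.ofHom (algebraMap R R'))},
      ∀ P σ, E P = σ ↔ IsGenericFiber (completeSection y π σ.1 σ.2) P := by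
  have := hR'.isLocalRing
  have h1 : ∀ P : (completion y π).Points K L, ∃ σ :
      {σ : Spec (.of R') ⟶ Y // σ ≫ y = Spec.map (CommRingCat.ofHom (algebraMap R R'))},
      IsGenericFiber (completeSection y π σ.1 σ.2) P := fun P => by
    obtain ⟨g, hg, -⟩ := hR'.existsUnique_section P
    obtain ⟨σ, hσ, rfl⟩ := exists_completeSection_eq hR'.not_isUnit hR'.complete g
    exact ⟨⟨σ, hσ⟩, hg⟩
  have h2 : ∀ σ : {σ : Spec (.of R') ⟶ Y //
      σ ≫ y = Spec.map (CommRingCat.ofHom (algebraMap R R'))},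
      ∃ P : (completion y π).Points K L, IsGenericFiber (completeSection y π σ.1 σ.2) P :=
    fun σ => by
      obtain ⟨U, hU⟩ := exists_affineOpen_top_le_section hR'.not_isUnit
        (completeSection y π σ.1 σ.2)
      exact (hR'.existsUnique_point hU).exists
  choose E hE using h1
  choose F hF using h2
  have huniq : ∀ P σ, IsGenericFiber (completeSection y π σ.1 σ.2) P → E P = σ := fun P σ h =>
    Subtype.ext (completeSection_injective hR'.not_isUnit hR'.complete
      ((hR'.existsUnique_section P).unique (hE P) h))
  refine ⟨⟨E, F, fun P => hR'.point_eq (hF _) (hE P), fun σ => huniq _ _ (hF σ)⟩,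
    fun P σ => ⟨?_, huniq P σ⟩⟩
  rintro rfl
  exact hE P

/-- The specialization of a point, in terms of the section over the ring of integers. -/
theorem IsValuationSubring.exists_specialization (hR' : IsValuationSubring π K L R')
    {κ : Type u} [Field κ] (ρ : R' →+* κ) (hρ : ρ (algebraMap R R' π) = 0)
    {P : (completion y π).Points K L} {σ : Spec (.of R') ⟶ Y}
    {hσ : σ ≫ y = Spec.map (CommRingCat.ofHom (algebraMap R R'))}
    (hP : IsGenericFiber (completeSection y π σ hσ) P) :
    ∃ x : Spec (.of κ) ⟶ (completion y π).thickening 0,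
      (∀ x', SpecializesTo ρ P x' ↔ x' = x) ∧
      x ≫ completionFst y π 0 = Spec.map (CommRingCat.ofHom ρ) ≫ σ := by
  let ρ₀ : Trunc (algebraMap R R' π) 0 →+* κ := Ideal.Quotient.lift _ ρ fun a ha => by
    obtain ⟨b, rfl⟩ := Ideal.mem_span_singleton.1 ha
    rw [map_mul, map_pow, hρ, zero_pow (Nat.succ_ne_zero 0), zero_mul]
  refine ⟨_, hR'.specializesTo_iff ρ hP ρ₀ rfl, ?_⟩
  rw [Category.assoc, hom_completeSection, ← Category.assoc, ← Spec.map_comp]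
  rfl

/-- The Galois action on points, in terms of sections over the ring of integers. -/
theorem IsValuationSubring.isGenericFiber_completeSection_gal (hR' : IsValuationSubring π K L R')
    {P : (completion y π).Points K L} {σ : Spec (.of R') ⟶ Y}
    {hσ : σ ≫ y = Spec.map (CommRingCat.ofHom (algebraMap R R'))}
    (hP : IsGenericFiber (completeSection y π σ hσ) P) (τ : L ≃ₐ[K] L) (τ' : R' →ₐ[R] R')
    (hτ : ∀ r, algebraMap R' L (τ' r) = τ (algebraMap R' L r)) :
    ∃ hσ', IsGenericFiber
      (completeSection y π (Spec.map (CommRingCat.ofHom τ'.toRingHom) ≫ σ) hσ') (P.gal τ) := by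
  have hσ' : (Spec.map (CommRingCat.ofHom τ'.toRingHom) ≫ σ) ≫ y =
      Spec.map (CommRingCat.ofHom (algebraMap R R')) := by
    rw [Category.assoc, hσ, ← Spec.map_comp, ← CommRingCat.ofHom_comp]
    congr 2
    exact τ'.comp_algebraMap
  refine ⟨hσ', hR'.isGenericFiber_gal hP τ τ'.toRingHom hτ (τ'.commutes π) fun n => ?_⟩
  refine Limits.pullback.hom_ext ?_ ?_
  · refine (hom_completeSection _ hσ' n).trans
      (Eq.trans ?_ (congrArg (Spec.map _ ≫ ·) (hom_completeSection σ hσ n)).symm)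
    simp only [← Category.assoc, ← Spec.map_comp]
    rfl
  · refine ((completeSection y π _ hσ').hom_str n).trans
      (Eq.trans ?_ (congrArg (Spec.map _ ≫ ·) ((completeSection y π σ hσ).hom_str n)).symm)
    rw [← Spec.map_comp, ← CommRingCat.ofHom_comp]
    congr 2
    refine Ideal.Quotient.ringHom_ext (RingHom.ext fun r => ?_)
    exact congrArg (Ideal.Quotient.mk _) (τ'.commutes r).symm

end Completion

/-! ### Rings of integers in terms of power series -/

/-- If `x` is not in `R'`, then `w = 1/x` is a nonunit of `R'`, so `w^N = π c` and `c` is inverse to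
`π x^N`. Reversing a monic equation of `c` over `R` gives one for `π x^N` with constant term `1`,
and the remaining terms are divisible by `π`. -/
theorem isValuationSubring_of_valuationRing {R : Type u} [CommRing R] {π : R} {K L R' : Type u}
    [Field K] [Algebra R K] [Field L] [Algebra K L] [CommRing R'] [IsDomain R'] [ValuationRing R']
    [Algebra R R'] [Algebra R' L] [IsFractionRing R' L] [Algebra.IsIntegral R R']
    (hmap : ∀ r, algebraMap R' L (algebraMap R R' r) = algebraMap K L (algebraMap R K r))
    (hπ : ¬ IsUnit (algebraMap R R' π)) (hc : TruncComplete (algebraMap R R' π))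
    (hpow : ∀ w : R', ¬ IsUnit w → ∃ N, algebraMap R R' π ∣ w ^ N) :
    IsValuationSubring π K L R' where
  injective := IsFractionRing.injective R' L
  algebraMap_eq := hmap
  complete := hc
  isLocalRing := inferInstance
  not_isUnit := hπ
  mem_or_large x := by
    rcases ValuationRing.isInteger_or_isInteger R' x with ⟨r, hr⟩ | ⟨w, hw⟩
    · exact Or.inl ⟨r, hr⟩
    by_cases hu : IsUnit w
    · obtain ⟨v, hv⟩ := hu.exists_right_inv
      refine Or.inl ⟨v, ?_⟩
      have h1 : algebraMap R' L w * algebraMap R' L v = 1 := by rw [← map_mul, hv, map_one]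
      rw [hw] at h1
      rw [eq_inv_of_mul_eq_one_right h1, inv_inv]
    by_cases hx : x = 0
    · exact Or.inl ⟨0, by rw [hx, map_zero]⟩
    refine Or.inr ?_
    let ι : R →+* L := (algebraMap K L).comp (algebraMap R K)
    have hι : ι = (algebraMap R' L).comp (algebraMap R R') := RingHom.ext fun r => (hmap r).symm
    obtain ⟨N, c, hc⟩ := hpow w hu
    obtain ⟨p, hp, hpc⟩ := Algebra.IsIntegral.isIntegral (R := R) c
    have h1 : (ι π * x ^ N) * algebraMap R' L c = 1 := by
      have h2 := congrArg (algebraMap R' L) hc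
      rw [map_mul, map_pow, hw, hmap] at h2
      rw [mul_right_comm]
      change algebraMap K L (algebraMap R K π) * _ * _ = 1
      rw [← h2, ← mul_pow, inv_mul_cancel₀ hx, one_pow]
    let _ : Invertible (ι π * x ^ N) := invertibleOfNonzero (left_ne_zero_of_mul_eq_one h1)
    have h2 : p.eval₂ ι (⅟(ι π * x ^ N)) = 0 := by
      have h3 : ⅟(ι π * x ^ N) = algebraMap R' L c := invOf_eq_right_inv h1
      rw [h3, hι, ← Polynomial.hom_eval₂, hpc, map_zero]
    have h3 : p.reverse.eval₂ ι (ι π * x ^ N) = 0 :=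
      (Polynomial.eval₂_reverse_eq_zero_iff ι (⅟(ι π * x ^ N)) p).2 h2 |> fun h => by
        simpa using h
    -- With `z = π x^N`, the reversed equation reads `1 + z e(z) = 0` for `e = p.reverse.divX`;
    -- hence `q(x) = x^N e(π x^N)`.
    refine ⟨Polynomial.X ^ N * p.reverse.divX.comp (Polynomial.C π * Polynomial.X ^ N), ?_⟩
    change 1 + ι π * Polynomial.eval₂ ι x _ = 0
    rw [← Polynomial.divX_mul_X_add p.reverse, Polynomial.coeff_zero_reverse, hp.leadingCoeff] at h3
    simp only [Polynomial.eval₂_add, Polynomial.eval₂_mul, Polynomial.eval₂_X, Polynomial.eval₂_one,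
      map_one] at h3
    rw [Polynomial.eval₂_mul, Polynomial.eval₂_comp, Polynomial.eval₂_mul, Polynomial.eval₂_pow,
      Polynomial.eval₂_X, Polynomial.eval₂_C, ← h3]
    ring

/-- The powers of `a^d` are cofinal among the powers of `a`. This transfers completeness for `t` to
completeness for `t^d`. -/
theorem TruncComplete.pow {S : Type u} [CommRing S] {a : S} (h : TruncComplete a) {d : ℕ}
    (hd : d ≠ 0) : TruncComplete (a ^ d) := by
  have hle : ∀ {m n}, m ≤ n → Ideal.span {a ^ n} ≤ Ideal.span {a ^ m} := fun h =>
    Ideal.span_singleton_le_span_singleton.2 (pow_dvd_pow a h)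
  have hd1 : ∀ n, n + 1 ≤ d * (n + 1) := fun n =>
    Nat.le_mul_of_pos_left _ (Nat.pos_of_ne_zero hd)
  intro x hx
  choose y hy using fun n => Ideal.Quotient.mk_surjective (x n)
  have hstep : ∀ n, y (n + 1) - y n ∈ Ideal.span {a ^ (d * (n + 1))} := fun n => by
    rw [pow_mul, ← Ideal.Quotient.eq, hy n, ← hx n, ← hy (n + 1)]
    rfl
  have hcau : ∀ {m n}, m ≤ n → y n - y m ∈ Ideal.span {a ^ (d * (m + 1))} := by
    intro m n h
    induction n, h using Nat.le_induction with
    | base => simp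
    | succ n h ih =>
      have := Ideal.add_mem _ (hle (Nat.mul_le_mul_left d (Nat.succ_le_succ h)) (hstep n)) ih
      simpa using this
  obtain ⟨s, hs, -⟩ := h (fun n => Ideal.Quotient.mk _ (y n)) fun n => by
    rw [Trunc.factor_mk]
    exact Ideal.Quotient.eq.2 (hle (hd1 n) (hstep n))
  refine ⟨s, fun n => ?_, fun t ht => h.ext fun n => ?_⟩
  -- Index `d * (n + 1)` gives agreement modulo `a^(d(n+1)+1)`, one power more than level `n` for
  -- `a^d` requires.
  · have h1 := Ideal.Quotient.eq.1 (hs (d * (n + 1)))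
    have h2 := Ideal.add_mem _ (hle (Nat.le_succ _) h1) (hcau ((Nat.le_succ n).trans (hd1 n)))
    rw [sub_add_sub_cancel, pow_mul] at h2
    rw [← hy n]
    exact Ideal.Quotient.eq.2 h2
  · rw [hs n, Ideal.Quotient.eq]
    have h1 := (ht n).trans (hy n).symm
    rw [Ideal.Quotient.eq, ← pow_mul] at h1
    exact hle (hd1 n) h1

/-! ### The ring `k[[t]]` as `R[Y]/(Y^d - t)`, by way of `t ↦ t^d` and `Y ↦ t` -/

section Expand

variable {k : Type u} [Field k] {d : ℕ} (hd : d ≠ 0)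

/-- Only the summand with `i ≡ m` modulo `d` contributes to `t^m`. Hence `1, t, …, t^(d-1)` is a
basis of `k[[t]]` over `k[[t^d]]`. -/
theorem coeff_sum_expand_mul_X_pow (b : ℕ → k⟦X⟧) (m : ℕ) :
    PowerSeries.coeff m (∑ i ∈ Finset.range d, PowerSeries.expand d hd (b i) * PowerSeries.X ^ i) =
      PowerSeries.coeff (m / d) (b (m % d)) := by
  rw [map_sum, Finset.sum_eq_single_of_mem (m % d)
    (Finset.mem_range.2 (Nat.mod_lt _ (Nat.pos_of_ne_zero hd)))]
  · have h : m = d * (m / d) + m % d := (Nat.div_add_mod m d).symm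
    generalize m / d = q, m % d = r at h
    rw [h, PowerSeries.coeff_mul_X_pow, PowerSeries.coeff_expand_mul]
  · intro i hi hne
    rw [PowerSeries.coeff_mul_X_pow']
    split_ifs with h
    · refine PowerSeries.coeff_expand_of_not_dvd d hd _ fun hdvd => hne ?_
      have h1 := (Nat.modEq_iff_dvd' h).2 hdvd
      exact (Nat.mod_eq_of_lt (Finset.mem_range.1 hi)).symm.trans h1
    · rfl

/-- Every power series in `t` is a combination of `1, t, …, t^(d-1)` with coefficients power
series in `t^d`. -/
theorem exists_eq_sum_expand_mul_X_pow (a : k⟦X⟧) : ∃ b : ℕ → k⟦X⟧,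
    a = ∑ i ∈ Finset.range d, PowerSeries.expand d hd (b i) * PowerSeries.X ^ i := by
  refine ⟨fun i => PowerSeries.mk fun n => PowerSeries.coeff (d * n + i) a, PowerSeries.ext fun m => ?_⟩
  rw [coeff_sum_expand_mul_X_pow, PowerSeries.coeff_mk, Nat.div_add_mod]

/-- The map `k[[t]][Y] → k[[t]]` given by `t ↦ t^d` and `Y ↦ t`. -/
def expandEval : Polynomial k⟦X⟧ →+* k⟦X⟧ :=
  Polynomial.eval₂RingHom (PowerSeries.expand d hd : k⟦X⟧ →ₐ[k] k⟦X⟧).toRingHom PowerSeries.X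

theorem expandEval_surjective : Function.Surjective (expandEval (k := k) hd) := by
  intro a
  obtain ⟨b, rfl⟩ := exists_eq_sum_expand_mul_X_pow hd a
  refine ⟨∑ i ∈ Finset.range d, Polynomial.C (b i) * Polynomial.X ^ i, ?_⟩
  simp [expandEval]

theorem expandEval_C (r : k⟦X⟧) :
    expandEval hd (Polynomial.C r) = PowerSeries.expand d hd r := by
  simp [expandEval]

theorem expandEval_X : expandEval (k := k) hd Polynomial.X = PowerSeries.X := by
  simp [expandEval]

/-- Ring maps on `k[[t]]` are determined by their values on `k[[t^d]]` and `t`. -/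
theorem ringHom_ext_expand {B : Type u} [CommRing B] {f g : k⟦X⟧ →+* B}
    (h : ∀ r, f (PowerSeries.expand d hd r) = g (PowerSeries.expand d hd r))
    (hX : f PowerSeries.X = g PowerSeries.X) : f = g := by
  have h1 : f.comp (expandEval hd) = g.comp (expandEval hd) := by
    refine Polynomial.ringHom_ext (fun r => ?_) ?_
    · rw [RingHom.comp_apply, RingHom.comp_apply, expandEval_C, h]
    · rw [RingHom.comp_apply, RingHom.comp_apply, expandEval_X, hX]
  exact (RingHom.cancel_right (expandEval_surjective hd)).1 h1

/-- Division by the monic `Y^d - t` leaves a remainder of degree below `d`; if it maps to zero, its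
coefficients vanish by the basis property. -/
theorem ker_expandEval_le : RingHom.ker (expandEval (k := k) hd) ≤
    Ideal.span {Polynomial.X ^ d - Polynomial.C PowerSeries.X} := by
  intro p hp
  set q : Polynomial k⟦X⟧ := Polynomial.X ^ d - Polynomial.C PowerSeries.X with hq
  have hmon : q.Monic := Polynomial.monic_X_pow_sub_C _ hd
  have hq0 : expandEval hd q = 0 := by
    rw [hq, map_sub, map_pow, expandEval_X, expandEval_C, PowerSeries.expand_X, sub_self]
  have hr0 : expandEval hd (p %ₘ q) = 0 := by
    rw [Polynomial.modByMonic_eq_sub_mul_div p q, map_sub, map_mul, hq0, zero_mul, sub_zero]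
    exact hp
  have hr : p %ₘ q = 0 := by
    have hdeg : (p %ₘ q).natDegree < d := by
      -- The strict degree bound requires the divisor not to be `1`, which holds because its degree
      -- `d` is nonzero.
      refine (Polynomial.natDegree_modByMonic_lt p hmon fun h => hd ?_).trans_eq
        (Polynomial.natDegree_X_pow_sub_C)
      have h2 := congrArg Polynomial.natDegree h
      rwa [hq, Polynomial.natDegree_X_pow_sub_C, Polynomial.natDegree_one] at h2
    rw [Polynomial.as_sum_range' _ _ hdeg] at hr0 ⊢
    simp only [map_sum, ← Polynomial.C_mul_X_pow_eq_monomial, map_mul, map_pow, expandEval_C,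
      expandEval_X] at hr0
    refine Finset.sum_eq_zero fun i hi => ?_
    rw [Polynomial.monomial_eq_zero_iff]
    refine PowerSeries.ext fun n => ?_
    have hi' := Finset.mem_range.1 hi
    have h1 := congrArg (PowerSeries.coeff (d * n + i)) hr0
    rw [coeff_sum_expand_mul_X_pow, Nat.mul_add_mod, Nat.mod_eq_of_lt hi', Nat.mul_add_div
      (Nat.pos_of_ne_zero hd), Nat.div_eq_of_lt hi', add_zero] at h1
    rw [h1, map_zero, map_zero]
  rw [← Polynomial.modByMonic_add_div p q, hr, zero_add]
  exact Ideal.mul_mem_right _ _ (Ideal.mem_span_singleton_self _)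

end Expand

/-! ### The integral closure of `k[[t]]` in the field generated by a `d`-th root of `t` -/

section Puiseux

variable {k : Type u} [Field k] {d : ℕ} (hd : d ≠ 0) {L : Type u} [Field L] [Algebra k⸨X⸩ L]
  [Algebra k⟦X⟧ L] [IsScalarTower k⟦X⟧ k⸨X⸩ L] {s : L}
  (hs : s ^ d = algebraMap k⟦X⟧ L PowerSeries.X)
include hs

/-- Evaluation at `s` kills `Y^d - t`, so it factors through the presentation `R[Y]/(Y^d - t)` of
`k[[t]]`. -/
theorem exists_puiseuxMap : ∃ ι : k⟦X⟧ →+* L, Function.Injective ι ∧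
    (∀ r, ι (PowerSeries.expand d hd r) = algebraMap k⟦X⟧ L r) ∧ ι PowerSeries.X = s := by
  have hker : RingHom.ker (expandEval (k := k) hd) ≤
      RingHom.ker (Polynomial.aeval s : Polynomial k⟦X⟧ →ₐ[k⟦X⟧] L).toRingHom := by
    refine (ker_expandEval_le hd).trans ((Ideal.span_singleton_le_iff_mem _).2 ?_)
    rw [RingHom.mem_ker]
    change Polynomial.aeval s _ = 0
    rw [map_sub, map_pow, Polynomial.aeval_X, Polynomial.aeval_C, hs, sub_self]
  let ι : k⟦X⟧ →+* L := (expandEval hd).liftOfSurjective (expandEval_surjective hd) ⟨_, hker⟩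
  have hι : ∀ p, ι (expandEval hd p) = Polynomial.aeval s p := fun p =>
    RingHom.liftOfRightInverse_comp_apply _ _ _ _ _
  have hX : ι PowerSeries.X = s := by rw [← expandEval_X hd, hι, Polynomial.aeval_X]
  refine ⟨ι, (injective_iff_map_eq_zero ι).2 fun a ha => ?_, fun r => ?_, hX⟩
  · by_contra hne
    -- A nonzero power series is a unit times a power of `X`, and `X` goes to `s ≠ 0`. So
    -- injectivity needs no irreducibility of `Y^d - t` over `K`.
    obtain ⟨n, u, rfl⟩ := IsDiscreteValuationRing.eq_unit_mul_pow_irreducible hne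
      PowerSeries.X_irreducible
    rw [map_mul, map_pow, hX] at ha
    have hs0 : s ≠ 0 := by
      rintro rfl
      rw [zero_pow hd, IsScalarTower.algebraMap_apply k⟦X⟧ k⸨X⸩ L, eq_comm,
        map_eq_zero_iff _ (algebraMap k⸨X⸩ L).injective,
        map_eq_zero_iff _ (IsFractionRing.injective k⟦X⟧ k⸨X⸩)] at hs
      exact PowerSeries.X_ne_zero hs
    exact mul_ne_zero (u.isUnit.map ι).ne_zero (pow_ne_zero n hs0) ha
  · rw [← expandEval_C, hι, Polynomial.aeval_C]

/-- The ring of integers of `k((t))(t^(1/d))` is `k[[t^(1/d)]]`. -/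
theorem exists_integralClosure_equiv (hgen : ∀ x : L, ∃ p : Polynomial k⸨X⸩, x = Polynomial.aeval s p) :
    ∃ θ : integralClosure k⟦X⟧ L ≃+* k⟦X⟧,
      (∀ r, θ (algebraMap _ _ r) = PowerSeries.expand d hd r) ∧
        (θ.symm PowerSeries.X : L) = s := by
  obtain ⟨ι, hinj, hC, hX⟩ := exists_puiseuxMap hd hs
  have hfrac : ∀ x : L, ∃ a b : k⟦X⟧, ι b ≠ 0 ∧ x * ι b = ι a := by
    intro x
    obtain ⟨p, rfl⟩ := hgen x
    induction p using Polynomial.induction_on' with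
    | add p q hp hq =>
      obtain ⟨a, b, hb, h⟩ := hp
      obtain ⟨a', b', hb', h'⟩ := hq
      refine ⟨a * b' + a' * b, b * b', by rw [map_mul]; exact mul_ne_zero hb hb', ?_⟩
      rw [map_add, map_mul, map_add, map_mul, map_mul, ← h, ← h']
      ring
    | monomial n c =>
      obtain ⟨r, r', hr', rfl⟩ := IsFractionRing.div_surjective (A := k⟦X⟧) c
      have hr0 : algebraMap k⟦X⟧ L r' ≠ 0 := by
        rw [IsScalarTower.algebraMap_apply k⟦X⟧ k⸨X⸩ L]
        exact (map_ne_zero _).2 (IsFractionRing.to_map_ne_zero_of_mem_nonZeroDivisors hr')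
      refine ⟨PowerSeries.expand d hd r * PowerSeries.X ^ n, PowerSeries.expand d hd r',
        by rwa [hC], ?_⟩
      rw [Polynomial.aeval_monomial, map_mul, map_pow, hX, hC, hC, map_div₀,
        ← IsScalarTower.algebraMap_apply, ← IsScalarTower.algebraMap_apply]
      field_simp
  have hmem : ∀ x : L, x ∈ integralClosure k⟦X⟧ L ↔ x ∈ ι.range := by
    intro x
    constructor
    · rintro ⟨p, hp, hpx⟩
      -- In this branch `k⟦X⟧` acts on `L` through `ι`, which makes `L` its fraction field by
      -- `hfrac`. The integral equation over `R` is carried along `expand`, and `k⟦X⟧` is integrally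
      -- closed.
      let _ : Algebra k⟦X⟧ L := ι.toAlgebra
      have : FaithfulSMul k⟦X⟧ L := (faithfulSMul_iff_algebraMap_injective _ _).2 hinj
      have : IsFractionRing k⟦X⟧ L := IsFractionRing.of_field _ _ fun z => by
        obtain ⟨a, b, hb, h⟩ := hfrac z
        exact ⟨a, b, (eq_div_iff hb).2 h⟩
      refine IsIntegrallyClosed.isIntegral_iff.1
        ⟨p.map (PowerSeries.expand d hd : k⟦X⟧ →ₐ[k] k⟦X⟧).toRingHom, hp.map _, ?_⟩
      rw [Polynomial.eval₂_map, ← hpx]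
      congr 1
      exact RingHom.ext hC
    · rintro ⟨a, rfl⟩
      obtain ⟨p, rfl⟩ := expandEval_surjective hd a
      have h1 : ι (expandEval hd p) = Polynomial.aeval s p := by
        have : ι.comp (expandEval hd) = (Polynomial.aeval s : Polynomial k⟦X⟧ →ₐ[k⟦X⟧] L) := by
          refine Polynomial.ringHom_ext (fun r => ?_) ?_
          · rw [RingHom.comp_apply, expandEval_C, hC]
            exact (Polynomial.aeval_C _ _).symm
          · rw [RingHom.comp_apply, expandEval_X, hX]
            exact (Polynomial.aeval_X _).symm
        exact RingHom.congr_fun this p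
      -- Conversely, the image of `ι` consists of polynomials in `s` over `R`, and `s` is integral
      -- because `s^d = t`.
      have h2 : IsIntegral k⟦X⟧ s := by
        refine IsIntegral.of_pow (Nat.pos_of_ne_zero hd) ?_
        rw [hs]
        exact isIntegral_algebraMap
      rw [h1]
      exact adjoin_le_integralClosure h2 (Polynomial.aeval_mem_adjoin_singleton _ _)
  let j : k⟦X⟧ →+* integralClosure k⟦X⟧ L :=
    ι.codRestrict (integralClosure k⟦X⟧ L) fun a => (hmem _).2 ⟨a, rfl⟩
  let η : k⟦X⟧ ≃+* integralClosure k⟦X⟧ L := RingEquiv.ofBijective j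
    ⟨fun a b h => hinj (congrArg Subtype.val h), fun x => by
      obtain ⟨a, ha⟩ := (hmem x).1 x.2
      exact ⟨a, Subtype.ext ha⟩⟩
  refine ⟨η.symm, fun r => ?_, hX⟩
  rw [RingEquiv.symm_apply_eq]
  exact Subtype.ext (hC r).symm

end Puiseux

/-! ### The Galois group of the extension generated by a root of the uniformizer -/

section Galois

variable {k : Type u} [Field k]

theorem truncComplete_X : TruncComplete (PowerSeries.X : k⟦X⟧) :=
  truncComplete_of_isAdicComplete

theorem isValuationSubring_powerSeries :
    IsValuationSubring (PowerSeries.X : k⟦X⟧) k⸨X⸩ k⸨X⸩ k⟦X⟧ :=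
  isValuationSubring_of_valuationRing (fun _ => rfl) PowerSeries.X_irreducible.not_isUnit
    truncComplete_X fun w hw => ⟨1, by
      rw [pow_one]
      change PowerSeries.X ∣ w
      rw [PowerSeries.X_dvd_iff]
      by_contra h
      exact hw (PowerSeries.isUnit_iff_constantCoeff.2 (isUnit_iff_ne_zero.2 h))⟩

/-- Only exponents divisible by `d` occur. Hence `t ↦ ξ t` is linear over `R`, embedded as
`k[[t^d]]`. -/
theorem rescale_expand {d : ℕ} (hd : d ≠ 0) {ξ : k} (hξ : ξ ^ d = 1) (r : k⟦X⟧) :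
    PowerSeries.rescale ξ (PowerSeries.expand d hd r) = PowerSeries.expand d hd r := by
  refine PowerSeries.ext fun n => ?_
  rw [PowerSeries.coeff_rescale]
  by_cases h : d ∣ n
  · obtain ⟨m, rfl⟩ := h
    rw [pow_mul, hξ, one_pow, one_mul]
  · rw [PowerSeries.coeff_expand_of_not_dvd d hd _ h, mul_zero]

/-- The substitution `t ↦ ξ t` for a unit `ξ`. -/
def rescaleEquiv (ξ : kˣ) : k⟦X⟧ ≃+* k⟦X⟧ :=
  RingEquiv.ofRingHom (PowerSeries.rescale (ξ : k)) (PowerSeries.rescale ((ξ⁻¹ : kˣ) : k))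
    (by rw [← PowerSeries.rescale_mul, Units.inv_mul, PowerSeries.rescale_one])
    (by rw [← PowerSeries.rescale_mul, Units.mul_inv, PowerSeries.rescale_one])

variable {d : ℕ} (hd : d ≠ 0) {L : Type u} [Field L] [Algebra k⸨X⸩ L]
  [Algebra k⟦X⟧ L] [IsScalarTower k⟦X⟧ k⸨X⸩ L] {s : L} {θ : integralClosure k⟦X⟧ L ≃+* k⟦X⟧}
  (hθ : ∀ r, θ (algebraMap _ _ r) = PowerSeries.expand d hd r)
include hθ

omit [Algebra k⸨X⸩ L] [IsScalarTower k⟦X⟧ k⸨X⸩ L] in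
theorem symm_expand (r : k⟦X⟧) : θ.symm (PowerSeries.expand d hd r) = algebraMap _ _ r := by
  rw [← hθ, RingEquiv.symm_apply_apply]

/-- Everything is transported through `θ`, which turns the uniformizer of `R` into `t^d`: a nonunit
becomes a multiple of `t`, so its `d`-th power is divisible by the uniformizer. -/
theorem isValuationSubring_integralClosure [FiniteDimensional k⸨X⸩ L] :
    IsValuationSubring (PowerSeries.X : k⟦X⟧) k⸨X⸩ L (integralClosure k⟦X⟧ L) := by
  have : IsFractionRing (integralClosure k⟦X⟧ L) L :=
    integralClosure.isFractionRing_of_finite_extension k⸨X⸩ L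
  have : IsDiscreteValuationRing (integralClosure k⟦X⟧ L) :=
    IsDiscreteValuationRing.RingEquivClass.isDiscreteValuationRing θ.symm
  have hX : θ (algebraMap k⟦X⟧ _ PowerSeries.X) = PowerSeries.X ^ d := by
    rw [hθ, PowerSeries.expand_X]
  refine isValuationSubring_of_valuationRing (fun r => IsScalarTower.algebraMap_apply _ _ _ r)
    (fun h => ?_) ?_ fun w hw => ⟨d, ?_⟩
  · have h1 := h.map θ
    rw [hX, isUnit_pow_iff hd] at h1
    exact PowerSeries.X_irreducible.not_isUnit h1
  · refine (truncComplete_X.pow hd).of_ringEquiv θ.symm ?_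
    rw [← hX, RingEquiv.symm_apply_apply]
  · rw [← map_dvd_iff θ, hX, map_pow]
    refine pow_dvd_pow_of_dvd (PowerSeries.X_dvd_iff.2 ?_) d
    by_contra h
    refine hw ((MulEquiv.isUnit_map θ).1 ?_)
    exact PowerSeries.isUnit_iff_constantCoeff.2 (isUnit_iff_ne_zero.2 h)

variable (hθX : (θ.symm PowerSeries.X : L) = s)
include hθX

/-- An automorphism of the field that multiplies the root of the uniformizer by `ξ` acts on the
ring of integers as `t ↦ ξ t`. -/
theorem mapIntegralClosure_eq_rescale {ξ : k} (hξ : ξ ^ d = 1) {τ : L ≃ₐ[k⸨X⸩] L}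
    (hτ : τ s = algebraMap k⟦X⟧ L (PowerSeries.C ξ) * s) :
    ((θ : integralClosure k⟦X⟧ L →+* k⟦X⟧).comp
      ((τ.toAlgHom.restrictScalars k⟦X⟧).mapIntegralClosure : _ →+* _)).comp
        (θ.symm : k⟦X⟧ →+* integralClosure k⟦X⟧ L) = PowerSeries.rescale ξ := by
  -- On `k[[t^d]]`, the image of `R`, both sides are the identity; on `t`, the image of `s`, both
  -- multiply by `ξ`.
  refine ringHom_ext_expand hd (fun r => ?_) ?_
  · rw [rescale_expand hd hξ, ← hθ r]
    simp
  · rw [PowerSeries.rescale_X]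
    change θ ((τ.toAlgHom.restrictScalars k⟦X⟧).mapIntegralClosure (θ.symm PowerSeries.X)) = _
    rw [← RingEquiv.eq_symm_apply, map_mul, ← PowerSeries.expand_C d hd, symm_expand hd hθ]
    refine Subtype.ext ?_
    refine (congrArg τ hθX).trans (hτ.trans ?_)
    rw [← hθX]
    rfl

/-- The substitution `t ↦ ξ t` is an `R`-automorphism of the ring of integers and extends to its
fraction field, so the minimal polynomial of `s` is not needed. -/
theorem exists_algEquiv_apply_eq [FiniteDimensional k⸨X⸩ L] {ξ : kˣ} (hξ : (ξ : k) ^ d = 1) :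
    ∃ τ : L ≃ₐ[k⸨X⸩] L, τ s = algebraMap k⟦X⟧ L (PowerSeries.C (ξ : k)) * s := by
  have : IsFractionRing (integralClosure k⟦X⟧ L) L :=
    integralClosure.isFractionRing_of_finite_extension k⸨X⸩ L
  let τ' : integralClosure k⟦X⟧ L ≃ₐ[k⟦X⟧] integralClosure k⟦X⟧ L :=
    AlgEquiv.ofRingEquiv (f := (θ.trans (rescaleEquiv ξ)).trans θ.symm) fun r => by
      change θ.symm (PowerSeries.rescale (ξ : k) (θ _)) = _
      rw [hθ, rescale_expand hd hξ, symm_expand hd hθ]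
  have hτ' : τ' (θ.symm PowerSeries.X) =
      algebraMap k⟦X⟧ _ (PowerSeries.C (ξ : k)) * θ.symm PowerSeries.X := by
    change θ.symm (PowerSeries.rescale (ξ : k) (θ (θ.symm _))) = _
    rw [RingEquiv.apply_symm_apply, PowerSeries.rescale_X, map_mul, ← symm_expand hd hθ,
      PowerSeries.expand_C]
  refine ⟨IsFractionRing.fieldEquivOfAlgEquiv k⸨X⸩ L L τ', ?_⟩
  have h1 := IsFractionRing.fieldEquivOfAlgEquiv_algebraMap k⸨X⸩ L L τ' (θ.symm PowerSeries.X)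
  rw [hτ', map_mul] at h1
  rw [← hθX]
  exact h1

/-- The Galois group of `K(t^(1/d))` over `K = k((t))` is the group of `d`-th roots of unity. -/
theorem exists_rootsOfUnity_equiv [IsAlgClosed k] [CharZero k] [FiniteDimensional k⸨X⸩ L]
    (hs : s ^ d = algebraMap k⟦X⟧ L PowerSeries.X)
    (hgen : ∀ x : L, ∃ p : Polynomial k⸨X⸩, x = Polynomial.aeval s p) :
    ∃ e : rootsOfUnity d k ≃* (L ≃ₐ[k⸨X⸩] L),
      ∀ ξ : rootsOfUnity d k, e ξ s = algebraMap k⟦X⟧ L (PowerSeries.C ((ξ : kˣ) : k)) * s := by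
  let c : k →+* L := (algebraMap k⟦X⟧ L).comp PowerSeries.C
  have hcK : ∀ (τ : L ≃ₐ[k⸨X⸩] L) (x : k), τ (c x) = c x := fun τ x => by
    change τ (algebraMap k⟦X⟧ L _) = algebraMap k⟦X⟧ L _
    rw [IsScalarTower.algebraMap_apply k⟦X⟧ k⸨X⸩ L, τ.commutes]
  have hs0 : s ≠ 0 := by
    rw [← hθX]
    intro h
    have h1 : θ.symm PowerSeries.X = 0 := Subtype.ext h
    exact PowerSeries.X_ne_zero ((map_eq_zero_iff _ θ.symm.injective).1 h1)
  have hext : ∀ τ τ' : L ≃ₐ[k⸨X⸩] L, τ s = τ' s → τ = τ' := fun τ τ' h => AlgEquiv.ext fun x => by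
    obtain ⟨p, rfl⟩ := hgen x
    rw [← Polynomial.aeval_algHom_apply, ← Polynomial.aeval_algHom_apply, h]
  have hroot : ∀ ξ : rootsOfUnity d k, ((ξ : kˣ) : k) ^ d = 1 := fun ξ => by
    rw [← Units.val_pow_eq_pow_val, (mem_rootsOfUnity d _).1 ξ.2, Units.val_one]
  choose f hf using fun ξ : rootsOfUnity d k => exists_algEquiv_apply_eq hd hθ hθX (hroot ξ)
  let F : rootsOfUnity d k →* (L ≃ₐ[k⸨X⸩] L) := MonoidHom.mk' f fun ξ η => hext _ _ <| by
    rw [AlgEquiv.mul_apply, hf, hf, map_mul, hf]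
    change c _ * s = f ξ (c _) * (c _ * s)
    rw [hcK, ← mul_assoc, ← map_mul, mul_comm ((η : kˣ) : k)]
    rfl
  refine ⟨MulEquiv.ofBijective F ⟨fun ξ η h => ?_, fun τ => ?_⟩, hf⟩
  · have h1 : c _ * s = c _ * s :=
      (hf ξ).symm.trans ((congrArg (fun τ : L ≃ₐ[k⸨X⸩] L => τ s) h).trans (hf η))
    exact Subtype.ext (Units.ext (c.injective (mul_right_cancel₀ hs0 h1)))
  · have : NeZero d := ⟨hd⟩
    have : NeZero (d : k) := ⟨Nat.cast_ne_zero.2 hd⟩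
    -- A primitive root of unity of `k` stays primitive in `L`, so the `d`-th root of unity `τ s /
    -- s` is a power of it and comes from `k`.
    obtain ⟨ζ, hζ⟩ := HasEnoughRootsOfUnity.exists_primitiveRoot k d
    have h1 : (τ s / s) ^ d = 1 := by
      rw [div_pow, ← map_pow, hs, IsScalarTower.algebraMap_apply k⟦X⟧ k⸨X⸩ L, τ.commutes,
        ← IsScalarTower.algebraMap_apply, ← hs, div_self (pow_ne_zero d hs0)]
    obtain ⟨i, -, hi⟩ := (hζ.map_of_injective c.injective).eq_pow_of_pow_eq_one h1
    let ξ : rootsOfUnity d k := rootsOfUnity.mkOfPowEq (ζ ^ i) (by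
      rw [← pow_mul, mul_comm, pow_mul, hζ.pow_eq_one, one_pow])
    refine ⟨ξ, hext _ _ ((hf ξ).trans ?_)⟩
    change c (ζ ^ i) * s = _
    rw [map_pow, hi, div_mul_cancel₀ _ hs0]

end Galois

/-! ### Arcs and their truncations -/

section ArcComparison

variable {k : Type u} [Field k] {X : Scheme.{u}} {p : X ⟶ Spec (.of k)}

/-- The isomorphism `k ⊗_k R_n → R_n`. -/
def jetEquiv (k : Type u) [Field k] (n : ℕ) :
    JetRing k k n ≃ₐ[k] Trunc (PowerSeries.X : k⟦X⟧) n :=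
  Algebra.TensorProduct.lid k _

theorem jetEquiv_tmul (n : ℕ) (c : k) (b : Trunc (PowerSeries.X : k⟦X⟧) n) :
    jetEquiv k n (c ⊗ₜ b) = c • b :=
  Algebra.TensorProduct.lid_tmul _ _

/-- Jets are indexed by `k ⊗ R_n`, completeness by `R_n`; this and `specMap_jetEquiv_truncate`
translate between them. -/
theorem specMap_jetEquiv_ofPowerSeries (n : ℕ) :
    specMap (jetEquiv k n).toAlgHom ≫ specMap (JetRing.ofPowerSeries k n) =
      truncInclusion (PowerSeries.X : k⟦X⟧) n := by
  rw [specMap_comp]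
  refine congrArg (fun φ => Spec.map (CommRingCat.ofHom φ)) (RingHom.ext fun b => ?_)
  exact (jetEquiv_tmul n 1 _).trans (one_smul _ _)

theorem specMap_jetEquiv_truncate (n : ℕ) :
    specMap (jetEquiv k n).toAlgHom ≫ specMap (JetRing.truncate k k n) =
      Spec.map (CommRingCat.ofHom (Trunc.factor (PowerSeries.X : k⟦X⟧) n)) ≫
        specMap (jetEquiv k (n + 1)).toAlgHom := by
  rw [specMap_comp, ← Spec.map_comp]
  refine congrArg (fun φ => Spec.map (CommRingCat.ofHom φ)) (RingHom.ext fun b => ?_)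
  obtain ⟨b, rfl⟩ := (jetEquiv k (n + 1)).symm.surjective b
  obtain ⟨b, rfl⟩ := Ideal.Quotient.mk_surjective b
  have h1 : (jetEquiv k (n + 1)).symm (Ideal.Quotient.mk _ b) = 1 ⊗ₜ Ideal.Quotient.mk _ b := by
    rw [AlgEquiv.symm_apply_eq, jetEquiv_tmul, one_smul]
  rw [h1]
  refine (congrArg (jetEquiv k n) (Algebra.TensorProduct.map_tmul _ _ _ _)).trans ?_
  refine (jetEquiv_tmul n _ _).trans ?_
  rw [map_one, one_smul]
  refine Eq.trans ?_ (congrArg (Trunc.factor (PowerSeries.X : k⟦X⟧) n)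
    (jetEquiv_tmul (n + 1) 1 (Ideal.Quotient.mk _ b))).symm
  rw [one_smul]
  rfl

instance (n : ℕ) : IsIso (specMap (jetEquiv k n).toAlgHom) := by
  refine ⟨specMap (jetEquiv k n).symm.toAlgHom, ?_, ?_⟩
  · refine (specMap_comp _ _).trans (Eq.trans ?_ (specMap_id (k := k) _))
    exact congrArg specMap (AlgHom.ext (jetEquiv k n).apply_symm_apply)
  · refine (specMap_comp _ _).trans (Eq.trans ?_ (specMap_id (k := k) _))
    exact congrArg specMap (AlgHom.ext (jetEquiv k n).symm_apply_apply)

theorem hom_ext_ofPowerSeries {Z : Scheme.{u}} {ψ ψ' : Spec (.of k⟦X⟧) ⟶ Z}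
    (h : ∀ n, specMap (JetRing.ofPowerSeries k n) ≫ ψ = specMap (JetRing.ofPowerSeries k n) ≫ ψ') :
    ψ = ψ' :=
  truncComplete_X.hom_ext PowerSeries.X_irreducible.not_isUnit fun n => by
    rw [← specMap_jetEquiv_ofPowerSeries, Category.assoc, h, Category.assoc]

/-- The `k`-points of the arc scheme are the morphisms `Spec k[[t]] ⟶ X`. -/
theorem ofArc_bijective :
    Function.Bijective (fun ψ : {ψ : Spec (.of k⟦X⟧) ⟶ X // ψ ≫ p = specStr k k⟦X⟧} =>
      ArcPoints.ofArc ψ.1 ψ.2) := by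
  refine ⟨fun ψ ψ' h => Subtype.ext (hom_ext_ofPowerSeries fun n =>
    congrArg (fun γ => ArcPoints.jet γ n) h), fun γ => ?_⟩
  -- Read on `R_n`, the jets are a compatible system from the truncations of a complete local ring,
  -- so they algebraize.
  obtain ⟨ψ, hψ⟩ := truncComplete_X.exists_hom PowerSeries.X_irreducible.not_isUnit
    (fun n => specMap (jetEquiv k n).toAlgHom ≫ γ.jet n) fun n => by
      rw [← Category.assoc, ← specMap_jetEquiv_truncate, Category.assoc, γ.truncate_jet]
  have hjet : ∀ n, specMap (JetRing.ofPowerSeries k n) ≫ ψ = γ.jet n := fun n => by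
    rw [← cancel_epi (specMap (jetEquiv k n).toAlgHom), ← Category.assoc,
      specMap_jetEquiv_ofPowerSeries, hψ]
  refine ⟨⟨ψ, hom_ext_ofPowerSeries fun n => ?_⟩, ArcPoints.ext (funext hjet)⟩
  rw [← Category.assoc, hjet, γ.jet_str, specMap_specStr]

theorem ofArc_eq_iff {ψ ψ' : Spec (.of k⟦X⟧) ⟶ X} {hψ : ψ ≫ p = specStr k k⟦X⟧}
    {hψ' : ψ' ≫ p = specStr k k⟦X⟧} :
    ArcPoints.ofArc ψ hψ = ArcPoints.ofArc ψ' hψ' ↔ ψ = ψ' :=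
  ⟨fun h => congrArg Subtype.val (ofArc_bijective.1 (a₁ := ⟨ψ, hψ⟩) (a₂ := ⟨ψ', hψ'⟩) h),
    fun h => by subst h; rfl⟩

theorem origin_ofArc (ψ : Spec (.of k⟦X⟧) ⟶ X) (hψ : ψ ≫ p = specStr k k⟦X⟧) :
    (ArcPoints.ofArc ψ hψ).origin =
      Spec.map (CommRingCat.ofHom (PowerSeries.constantCoeff (R := k))) ≫ ψ := by
  change specMap _ ≫ specMap _ ≫ ψ = _
  rw [← Category.assoc, specMap_comp]
  refine congrArg (fun φ => Spec.map (CommRingCat.ofHom φ) ≫ ψ) (RingHom.ext fun b => ?_)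
  refine (Algebra.TensorProduct.lift_tmul (AlgHom.id k k)
    ((Algebra.ofId k k).comp (evalZeroTrunc k)) (fun _ _ => .all _ _) 1 _).trans ?_
  rw [map_one, one_mul]
  rfl

theorem rescale_ofArc (ξ : k) (ψ : Spec (.of k⟦X⟧) ⟶ X) (hψ : ψ ≫ p = specStr k k⟦X⟧)
    (hψ' : (Spec.map (CommRingCat.ofHom (PowerSeries.rescale ξ)) ≫ ψ) ≫ p = specStr k k⟦X⟧) :
    (ArcPoints.ofArc ψ hψ).rescale ξ = ArcPoints.ofArc _ hψ' := by
  refine ArcPoints.ext (funext fun n => ?_)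
  change specMap _ ≫ specMap _ ≫ ψ = specMap _ ≫ Spec.map _ ≫ ψ
  rw [← Category.assoc, specMap_comp, ← Category.assoc, ← Spec.map_comp]
  refine congrArg (fun φ => Spec.map (CommRingCat.ofHom φ) ≫ ψ) (RingHom.ext fun b => ?_)
  exact Algebra.TensorProduct.map_tmul _ _ _ _

theorem comp_str_of_comp_eq_affineLinePoint {f : X ⟶ Spec (.of (Polynomial k))}
    (hf : f ≫ specStr k (Polynomial k) = p) {A : Type u} [CommRing A] [Algebra k A] {a : A}
    {ψ : Spec (.of A) ⟶ X} (hψ : ψ ≫ f = affineLinePoint a) : ψ ≫ p = specStr k A := by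
  rw [← hf, ← Category.assoc, hψ, affineLinePoint, specMap_specStr]

theorem ofArc_mem_arcsOfLevel_iff {f : X ⟶ Spec (.of (Polynomial k))} {d : ℕ}
    {ψ : Spec (.of k⟦X⟧) ⟶ X} {hψ : ψ ≫ p = specStr k k⟦X⟧} :
    ArcPoints.ofArc ψ hψ ∈ (arcsOfLevel p f d).obj (.of k k) ↔
      ψ ≫ f = affineLinePoint (PowerSeries.X ^ d : k⟦X⟧) := by
  have h1 : ∀ n, specMap (JetRing.ofPowerSeries k n) ≫
      affineLinePoint (PowerSeries.X ^ d : k⟦X⟧) =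
      affineLinePoint (JetRing.ofPowerSeries (k := k) k n (PowerSeries.X ^ d)) := fun n =>
    specMap_affineLinePoint _ _
  constructor
  · intro h
    refine hom_ext_ofPowerSeries fun n => ?_
    rw [h1, ← Category.assoc]
    exact h n
  · intro h n
    rw [← h1, ← h, ← Category.assoc]
    rfl

/-- The level set `𝒳(d)(k)` consists of the arcs `ψ` with `f(ψ) = t^d`. -/
theorem exists_levelPoints_equiv {f : X ⟶ Spec (.of (Polynomial k))}
    (hf : f ≫ specStr k (Polynomial k) = p) (d : ℕ) :
    ∃ G : {ψ : Spec (.of k⟦X⟧) ⟶ X // ψ ≫ f = affineLinePoint (PowerSeries.X ^ d : k⟦X⟧)} ≃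
        LevelPoints p f d,
      ∀ ψ, (G ψ).1 = ArcPoints.ofArc ψ.1 (comp_str_of_comp_eq_affineLinePoint hf ψ.2) := by
  let G : {ψ : Spec (.of k⟦X⟧) ⟶ X // ψ ≫ f = affineLinePoint (PowerSeries.X ^ d : k⟦X⟧)} →
      LevelPoints p f d := fun ψ => ⟨ArcPoints.ofArc ψ.1
    (comp_str_of_comp_eq_affineLinePoint hf ψ.2), ofArc_mem_arcsOfLevel_iff.2 ψ.2⟩
  have hG : Function.Injective G := fun ψ ψ' h => Subtype.ext <|
    (ofArc_eq_iff (hψ := comp_str_of_comp_eq_affineLinePoint hf ψ.2)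
      (hψ' := comp_str_of_comp_eq_affineLinePoint hf ψ'.2)).1 (congrArg Subtype.val h)
  refine ⟨Equiv.ofBijective G ⟨hG, fun γ => ?_⟩, fun _ => rfl⟩
  obtain ⟨ψ, hψ⟩ := ofArc_bijective.2 γ.1
  have hγ : ArcPoints.ofArc ψ.1 ψ.2 ∈ (arcsOfLevel p f d).obj (.of k k) := by
    have := γ.2
    rwa [← hψ] at this
  exact ⟨⟨ψ.1, ofArc_mem_arcsOfLevel_iff.1 hγ⟩, Subtype.ext hψ⟩

/-- Sections of `X_R` over the ring of integers `k[[t^(1/d)]]` are the arcs `ψ` with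
`f(ψ) = t^d`. -/
theorem exists_section_arc_equiv (f : X ⟶ Spec (.of (Polynomial k))) {d : ℕ} (hd : d ≠ 0)
    {R' : Type u} [CommRing R'] [Algebra k⟦X⟧ R'] {θ : R' ≃+* k⟦X⟧}
    (hθ : ∀ r, θ (algebraMap _ _ r) = PowerSeries.expand d hd r) :
    ∃ F : {σ : Spec (.of R') ⟶ baseChangePowerSeries f // σ ≫ Limits.pullback.snd _ _ =
        Spec.map (CommRingCat.ofHom (algebraMap k⟦X⟧ R'))} ≃
        {ψ : Spec (.of k⟦X⟧) ⟶ X // ψ ≫ f = affineLinePoint (PowerSeries.X ^ d : k⟦X⟧)},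
      ∀ σ ψ, F σ = ψ ↔ σ.1 ≫ Limits.pullback.fst _ _ =
        Spec.map (CommRingCat.ofHom θ.symm.toRingHom) ≫ ψ.1 := by
  have h₁ : Spec.map (CommRingCat.ofHom θ.symm.toRingHom) ≫
      Spec.map (CommRingCat.ofHom θ.toRingHom) = 𝟙 (Spec (.of R')) := by
    rw [← Spec.map_comp, ← CommRingCat.ofHom_comp]
    exact (congrArg (fun φ => Spec.map (CommRingCat.ofHom φ))
      (RingHom.ext θ.symm_apply_apply : _ = RingHom.id R')).trans (Spec.map_id _)
  have h₂ : Spec.map (CommRingCat.ofHom θ.toRingHom) ≫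
      Spec.map (CommRingCat.ofHom θ.symm.toRingHom) = 𝟙 (Spec (.of k⟦X⟧)) := by
    rw [← Spec.map_comp, ← CommRingCat.ofHom_comp]
    exact (congrArg (fun φ => Spec.map (CommRingCat.ofHom φ))
      (RingHom.ext θ.apply_symm_apply : _ = RingHom.id k⟦X⟧)).trans (Spec.map_id _)
  -- Through `θ` the structure map `R → R'` is `expand`, which sends `t` to `t^d`; being a section
  -- over `R` thus turns into `f(ψ) = t^d`.
  have h₃ : Spec.map (CommRingCat.ofHom θ.toRingHom) ≫
      Spec.map (CommRingCat.ofHom (algebraMap k⟦X⟧ R')) ≫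
        affineLinePoint (k := k) (PowerSeries.X : k⟦X⟧) =
          affineLinePoint (PowerSeries.X ^ d : k⟦X⟧) := by
    rw [← Category.assoc, ← Spec.map_comp, ← CommRingCat.ofHom_comp]
    have h4 : θ.toRingHom.comp (algebraMap k⟦X⟧ R') =
      (PowerSeries.expand d hd : k⟦X⟧ →ₐ[k] k⟦X⟧).toRingHom := RingHom.ext hθ
    rw [h4]
    refine (specMap_affineLinePoint (k := k) (PowerSeries.expand d hd) _).trans ?_
    rw [PowerSeries.expand_X]
  refine ⟨⟨fun σ => ⟨Spec.map (CommRingCat.ofHom θ.toRingHom) ≫ σ.1 ≫ Limits.pullback.fst _ _, ?_⟩,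
    fun ψ => ⟨Limits.pullback.lift (Spec.map (CommRingCat.ofHom θ.symm.toRingHom) ≫ ψ.1)
      (Spec.map (CommRingCat.ofHom (algebraMap k⟦X⟧ R'))) ?_, Limits.pullback.lift_snd _ _ _⟩,
    fun σ => Subtype.ext (Limits.pullback.hom_ext ?_ ?_), fun ψ => Subtype.ext ?_⟩,
    fun σ ψ => ?_⟩
  · rw [Category.assoc, Category.assoc, Limits.pullback.condition, ← Category.assoc σ.1, σ.2, h₃]
  · rw [Category.assoc, ψ.2, ← h₃, ← Category.assoc, h₁, Category.id_comp]
  · rw [Limits.pullback.lift_fst, ← Category.assoc, h₁, Category.id_comp]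
  · rw [Limits.pullback.lift_snd, σ.2]
  · dsimp only
    rw [Limits.pullback.lift_fst, ← Category.assoc, h₂, Category.id_comp]
  · rw [Subtype.ext_iff]
    constructor
    · rintro h
      rw [← h]
      change _ = Spec.map _ ≫ Spec.map _ ≫ _
      rw [← Category.assoc, h₁, Category.id_comp]
    · intro h
      change Spec.map _ ≫ σ.1 ≫ _ = _
      rw [h, ← Category.assoc, h₂, Category.id_comp]

end ArcComparison

/-! ### The comparison of points and arcs, relative and absolute -/

section MainResults

variable {k : Type u} [Field k] {X : Scheme.{u}}

theorem rescale_affineLinePoint {ξ : k} {d : ℕ} (hξ : ξ ^ d = 1) :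
    Spec.map (CommRingCat.ofHom (PowerSeries.rescale ξ)) ≫
      affineLinePoint (k := k) (PowerSeries.X ^ d : k⟦X⟧) =
        affineLinePoint (PowerSeries.X ^ d : k⟦X⟧) := by
  refine (Spec.map_comp _ _).symm.trans ?_
  refine congrArg (fun φ => Spec.map (CommRingCat.ofHom φ)) (Polynomial.ringHom_ext (fun c => ?_) ?_)
  · change PowerSeries.rescale ξ (Polynomial.aeval _ _) = Polynomial.aeval _ _
    rw [Polynomial.aeval_C]
    change PowerSeries.rescale ξ (PowerSeries.C c) = PowerSeries.C c
    refine PowerSeries.ext fun m => ?_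
    rw [PowerSeries.coeff_rescale, PowerSeries.coeff_C]
    split_ifs with h
    · rw [h, pow_zero, one_mul]
    · rw [mul_zero]
  · change PowerSeries.rescale ξ (Polynomial.aeval _ _) = Polynomial.aeval _ _
    rw [Polynomial.aeval_X, map_pow, PowerSeries.rescale_X, mul_pow, ← map_pow, hξ, map_one,
      one_mul]

/-- The points of the completion of a function over a totally ramified extension are the arcs
on which the function takes the value `t^d`. -/
theorem exists_points_arc_equiv {f : X ⟶ Spec (.of (Polynomial k))} [LocallyOfFiniteType f]
    [QuasiCompact f] [IsSeparated f] {d : ℕ} (hd : d ≠ 0) {L : Type u} [Field L]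
    [Algebra k⸨X⸩ L] [FiniteDimensional k⸨X⸩ L] [Algebra k⟦X⟧ L] [IsScalarTower k⟦X⟧ k⸨X⸩ L]
    {s : L} {θ : integralClosure k⟦X⟧ L ≃+* k⟦X⟧}
    (hθ : ∀ r, θ (algebraMap _ _ r) = PowerSeries.expand d hd r)
    (hθX : (θ.symm PowerSeries.X : L) = s) :
    ∃ φ : (completion (Limits.pullback.snd f (affineLinePoint (PowerSeries.X : k⟦X⟧)))
        PowerSeries.X).Points k⸨X⸩ L ≃
        {ψ : Spec (.of k⟦X⟧) ⟶ X // ψ ≫ f = affineLinePoint (PowerSeries.X ^ d : k⟦X⟧)},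
      (∀ P ψ, φ P = ψ ↔
        ∃ (σ : Spec (.of (integralClosure k⟦X⟧ L)) ⟶ baseChangePowerSeries f)
          (hσ : σ ≫ Limits.pullback.snd _ _ = Spec.map (CommRingCat.ofHom (algebraMap _ _))),
          σ ≫ Limits.pullback.fst _ _ = Spec.map (CommRingCat.ofHom θ.symm.toRingHom) ≫ ψ.1 ∧
          IsGenericFiber (completeSection _ PowerSeries.X σ hσ) P) ∧
      (∀ P, ∃ x, (∀ y, SpecializesTo (PowerSeries.constantCoeff.comp θ.toRingHom) P y ↔ y = x) ∧
        (x ≫ completionFst _ _ 0) ≫ Limits.pullback.fst _ _ =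
          Spec.map (CommRingCat.ofHom (PowerSeries.constantCoeff (R := k))) ≫ (φ P).1) ∧
      (∀ (ξ : k) (_ : ξ ^ d = 1) (τ : L ≃ₐ[k⸨X⸩] L)
        (_ : τ s = algebraMap k⟦X⟧ L (PowerSeries.C ξ) * s) (P),
        (φ (P.gal τ)).1 = Spec.map (CommRingCat.ofHom (PowerSeries.rescale ξ)) ≫ (φ P).1) := by
  have hV := isValuationSubring_integralClosure hd hθ
  obtain ⟨E, hE⟩ := hV.exists_points_equiv
    (y := Limits.pullback.snd f (affineLinePoint (PowerSeries.X : k⟦X⟧)))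
  obtain ⟨F, hF⟩ := exists_section_arc_equiv f hd hθ
  have hEP : ∀ P, IsGenericFiber (completeSection _ PowerSeries.X (E P).1 (E P).2) P :=
    fun P => (hE P _).1 rfl
  have hFE : ∀ P, (E P).1 ≫ Limits.pullback.fst _ _ =
    Spec.map (CommRingCat.ofHom θ.symm.toRingHom) ≫ (F (E P)).1 := fun P => (hF _ _).1 rfl
  refine ⟨E.trans F, fun P ψ => ⟨?_, ?_⟩, fun P => ?_, fun ξ hξ τ hτ P => ?_⟩
  · rintro rfl
    exact ⟨(E P).1, (E P).2, hFE P, hEP P⟩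
  · rintro ⟨σ, hσ, hσψ, hP⟩
    exact (congrArg F ((hE P ⟨σ, hσ⟩).2 hP)).trans ((hF ⟨σ, hσ⟩ ψ).2 hσψ)
  · obtain ⟨x, hx, hx'⟩ := hV.exists_specialization
      ((PowerSeries.constantCoeff (R := k)).comp θ.toRingHom) (by
        change PowerSeries.constantCoeff (θ _) = 0
        rw [hθ, PowerSeries.constantCoeff_expand, PowerSeries.constantCoeff_X]) (hEP P)
    refine ⟨x, hx, ?_⟩
    rw [hx', Category.assoc, hFE, ← Category.assoc, ← Spec.map_comp, ← CommRingCat.ofHom_comp]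
    refine congrArg (fun φ => Spec.map (CommRingCat.ofHom φ) ≫ (F (E P)).1)
      (RingHom.ext fun b => ?_)
    exact congrArg PowerSeries.constantCoeff (θ.apply_symm_apply b)
  · let τ' := (τ.toAlgHom.restrictScalars k⟦X⟧).mapIntegralClosure
    obtain ⟨hσ', hgal⟩ := hV.isGenericFiber_completeSection_gal (hEP P) τ τ' fun _ => rfl
    have h4 : (E (P.gal τ)).1 = Spec.map (CommRingCat.ofHom τ'.toRingHom) ≫ (E P).1 :=
      congrArg Subtype.val ((hE (P.gal τ) ⟨_, hσ'⟩).2 hgal)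
    have h5 : (Spec.map (CommRingCat.ofHom (PowerSeries.rescale ξ)) ≫ (F (E P)).1) ≫ f =
        affineLinePoint (PowerSeries.X ^ d : k⟦X⟧) := by
      rw [Category.assoc, (F (E P)).2, rescale_affineLinePoint hξ]
    -- This rewrites the Galois action on sections as the substitution `t ↦ ξ t` on arcs.
    have h6 : τ'.toRingHom.comp θ.symm.toRingHom =
        θ.symm.toRingHom.comp (PowerSeries.rescale ξ) := RingHom.ext fun b => by
      rw [← mapIntegralClosure_eq_rescale hd hθ hθX hξ hτ]
      exact (θ.symm_apply_apply _).symm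
    refine congrArg Subtype.val ((hF (E (P.gal τ)) ⟨_, h5⟩).2 ?_)
    rw [h4, Category.assoc, hFE, ← Category.assoc, ← Spec.map_comp, ← CommRingCat.ofHom_comp, h6,
      CommRingCat.ofHom_comp, Spec.map_comp, Category.assoc]

/-- The comparison of points and arcs in the relative case. -/
theorem exists_points_levelPoints_equiv {p : X ⟶ Spec (.of k)}
    [LocallyOfFiniteType p] [QuasiCompact p] [IsSeparated p] {f : X ⟶ Spec (.of (Polynomial k))}
    (hf : f ≫ specStr k (Polynomial k) = p) {d : ℕ} (hd : d ≠ 0) {L : Type u} [Field L]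
    [Algebra k⸨X⸩ L] [FiniteDimensional k⸨X⸩ L] [Algebra k⟦X⟧ L] [IsScalarTower k⟦X⟧ k⸨X⸩ L]
    {s : L} {θ : integralClosure k⟦X⟧ L ≃+* k⟦X⟧}
    (hθ : ∀ r, θ (algebraMap _ _ r) = PowerSeries.expand d hd r)
    (hθX : (θ.symm PowerSeries.X : L) = s) :
    ∃ φ : (functionCompletion hf).Points k⸨X⸩ L ≃ LevelPoints p f d,
      (∀ (P : (functionCompletion hf).Points k⸨X⸩ L) (ψ : Spec (.of k⟦X⟧) ⟶ X)
        (hψ : ψ ≫ p = specStr k k⟦X⟧) (_ : ψ ≫ f = affineLinePoint (PowerSeries.X ^ d : k⟦X⟧)),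
        (φ P).1 = ArcPoints.ofArc ψ hψ ↔
          ∃ (σ : Spec (.of (integralClosure k⟦X⟧ L)) ⟶ baseChangePowerSeries f)
            (hσ : σ ≫ Limits.pullback.snd _ _ = Spec.map (CommRingCat.ofHom (algebraMap _ _))),
            σ ≫ Limits.pullback.fst _ _ = Spec.map (CommRingCat.ofHom θ.symm.toRingHom) ≫ ψ ∧
            IsGenericFiber (functionCompletion.completeSection hf σ hσ) P) ∧
      (∀ P : (functionCompletion hf).Points k⸨X⸩ L,
        ∃ x : Spec (.of k) ⟶ (functionCompletion hf).thickening 0,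
          (∀ y, SpecializesTo (PowerSeries.constantCoeff.comp θ.toRingHom) P y ↔ y = x) ∧
          x ≫ functionCompletion.toBase hf = (φ P).1.origin) ∧
      (∀ (ξ : k) (_ : ξ ^ d = 1) (τ : L ≃ₐ[k⸨X⸩] L)
        (_ : τ s = algebraMap k⟦X⟧ L (PowerSeries.C ξ) * s)
        (P : (functionCompletion hf).Points k⸨X⸩ L),
        (φ (P.gal τ)).1 = (φ P).1.rescale ξ) := by
  -- With the finiteness of `f` deduced from that of `p`, `functionCompletion` is by definition the
  -- completion treated in `exists_points_arc_equiv`.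
  obtain ⟨h₁, h₂, h₃⟩ := finiteType_of_comp hf
  obtain ⟨Φ, hΦ, hsp, hgal⟩ := exists_points_arc_equiv (f := f) hd hθ hθX
  obtain ⟨G, hG⟩ := exists_levelPoints_equiv hf d
  have hstr := fun P => comp_str_of_comp_eq_affineLinePoint hf (Φ P).2
  have hφ : ∀ P, ((Φ.trans G) P).1 = ArcPoints.ofArc (Φ P).1 (hstr P) := fun P => hG _
  refine ⟨Φ.trans G, fun P ψ hψ hψf => ?_, fun P => ?_, fun ξ hξ τ hτ P => ?_⟩
  · refine Iff.trans ?_ (hΦ P ⟨ψ, hψf⟩)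
    refine (Eq.congr_left (hφ P)).trans (ofArc_eq_iff.trans ?_)
    exact ⟨fun h => Subtype.ext h, congrArg Subtype.val⟩
  · obtain ⟨x, hx, hx'⟩ := hsp P
    refine ⟨x, hx, ?_⟩
    refine (Category.assoc _ _ _).symm.trans (hx'.trans ?_)
    exact ((congrArg ArcPoints.origin (hφ P)).trans (origin_ofArc _ (hstr P))).symm
  · refine (hφ (P.gal τ)).trans (Eq.trans ?_ (congrArg (ArcPoints.rescale ξ) (hφ P)).symm)
    have h : (Spec.map (CommRingCat.ofHom (PowerSeries.rescale ξ)) ≫ (Φ P).1) ≫ p =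
        specStr k k⟦X⟧ := by
      rw [← hgal ξ hξ τ hτ P]; exact hstr _
    exact (ofArc_eq_iff.2 (hgal ξ hξ τ hτ P)).trans (rescale_ofArc ξ _ (hstr P) h).symm

/-- The comparison of points and arcs in the absolute case. -/
theorem exists_arcPoints_equiv (p : X ⟶ Spec (.of k)) [LocallyOfFiniteType p] [QuasiCompact p]
    [IsSeparated p] :
    ∃ φ : ArcPoints p k ≃ (constantCompletion p).Points k⸨X⸩ k⸨X⸩,
      (∀ (ψ : Spec (.of k⟦X⟧) ⟶ X) (hψ : ψ ≫ p = specStr k k⟦X⟧)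
        (P : (constantCompletion p).Points k⸨X⸩ k⸨X⸩),
        φ (ArcPoints.ofArc ψ hψ) = P ↔
          ∃ (σ : Spec (.of k⟦X⟧) ⟶ Limits.pullback p (specStr k k⟦X⟧))
            (hσ : σ ≫ Limits.pullback.snd _ _ = Spec.map (CommRingCat.ofHom (algebraMap _ _))),
            σ ≫ Limits.pullback.fst _ _ = ψ ∧
            IsGenericFiber (completeSection _ PowerSeries.X σ hσ) P) ∧
      (∀ γ : ArcPoints p k,
        ∃ x : Spec (.of k) ⟶ (constantCompletion p).thickening 0,
          (∀ y, SpecializesTo (PowerSeries.constantCoeff (R := k)) (φ γ) y ↔ y = x) ∧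
          x ≫ constantCompletion.toBase p = γ.origin) := by
  have hV := isValuationSubring_powerSeries (k := k)
  obtain ⟨E, hE⟩ := hV.exists_points_equiv (y := Limits.pullback.snd p (specStr k k⟦X⟧))
  have hid : Spec.map (CommRingCat.ofHom (algebraMap k⟦X⟧ k⟦X⟧)) = 𝟙 _ := Spec.map_id _
  -- Here `R' = R`: the second component of a section of `X_R` is the identity, so the first
  -- component, an arc, determines it.
  let F : {σ : Spec (.of k⟦X⟧) ⟶ Limits.pullback p (specStr k k⟦X⟧) //
      σ ≫ Limits.pullback.snd _ _ = Spec.map (CommRingCat.ofHom (algebraMap k⟦X⟧ k⟦X⟧))} ≃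
      {ψ : Spec (.of k⟦X⟧) ⟶ X // ψ ≫ p = specStr k k⟦X⟧} :=
    { toFun σ := ⟨σ.1 ≫ Limits.pullback.fst _ _, by
        rw [Category.assoc, Limits.pullback.condition, ← Category.assoc, σ.2, hid,
          Category.id_comp]⟩
      invFun ψ := ⟨Limits.pullback.lift ψ.1 (Spec.map (CommRingCat.ofHom (algebraMap _ _))) (by
        rw [ψ.2, hid, Category.id_comp]), Limits.pullback.lift_snd _ _ _⟩
      left_inv σ := Subtype.ext (Limits.pullback.hom_ext (Limits.pullback.lift_fst _ _ _)
        ((Limits.pullback.lift_snd _ _ _).trans σ.2.symm))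
      right_inv ψ := Subtype.ext (Limits.pullback.lift_fst _ _ _) }
  let G := Equiv.ofBijective _ (ofArc_bijective (p := p))
  have hφ : ∀ P ψ, ((E.trans F).trans G).symm (ArcPoints.ofArc ψ.1 ψ.2) = P ↔ F (E P) = ψ :=
    fun P ψ => by
      rw [Equiv.symm_apply_eq, eq_comm]
      exact G.injective.eq_iff (a := F (E P)) (b := ψ)
  refine ⟨((E.trans F).trans G).symm, fun ψ hψ P => ?_, fun γ => ?_⟩
  · refine (hφ P ⟨ψ, hψ⟩).trans ⟨fun h => ?_, ?_⟩
    · exact ⟨(E P).1, (E P).2, congrArg Subtype.val h, (hE P _).1 rfl⟩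
    · rintro ⟨σ, hσ, rfl, hP⟩
      rw [(hE P ⟨σ, hσ⟩).2 hP]
      rfl
  · obtain ⟨ψ, rfl⟩ := ofArc_bijective.2 γ
    have h1 := (hφ _ ψ).1 rfl
    set P := ((E.trans F).trans G).symm (ArcPoints.ofArc ψ.1 ψ.2)
    obtain ⟨x, hx, hx'⟩ := hV.exists_specialization (PowerSeries.constantCoeff (R := k))
      PowerSeries.constantCoeff_X ((hE P _).1 rfl)
    refine ⟨x, hx, ?_⟩
    have h5 : x ≫ constantCompletion.toBase p =
        (x ≫ completionFst _ _ 0) ≫ Limits.pullback.fst _ _ := (Category.assoc _ _ _).symm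
    rw [h5, hx', Category.assoc]
    refine Eq.trans ?_ (origin_ofArc ψ.1 ψ.2).symm
    exact congrArg (Spec.map _ ≫ ·) (congrArg Subtype.val h1)

end MainResults

end RigidArc

end

/-- `θ` and `e` are asserted together with `φ` because they enter its properties: `θ` in the
characterization and the specialization, `e` in the Galois equivariance. -/
theorem mainTheorem1 (k : Type u) [Field k] [IsAlgClosed k] [CharZero k] :
    -- the relative case
    (∀ (Ω : Type u) [Field Ω] [Algebra k⸨X⸩ Ω] [IsAlgClosure k⸨X⸩ Ω]
      [Algebra k⟦X⟧ Ω] [IsScalarTower k⟦X⟧ k⸨X⸩ Ω]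
      (s : ℕ → Ω) (_ : s 1 = algebraMap k⟦X⟧ Ω PowerSeries.X)
      (_ : ∀ d e, 0 < d → 0 < e → s (d * e) ^ e = s d)
      (X : Scheme.{u}) (p : X ⟶ Spec (.of k)) [Smooth p] [LocallyOfFiniteType p] [QuasiCompact p]
      [IsSeparated p] [IrreducibleSpace X]
      (f : X ⟶ Spec (.of (Polynomial k))) (hf : f ≫ specStr k (Polynomial k) = p) [IsDominant f]
      (d : ℕ) (hd : d ≠ 0),
      ∃ (θ : integralClosure k⟦X⟧ k⸨X⸩⟮s d⟯ ≃+* k⟦X⟧)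
        (e : rootsOfUnity d k ≃* (k⸨X⸩⟮s d⟯ ≃ₐ[k⸨X⸩] k⸨X⸩⟮s d⟯))
        (φ : (functionCompletion hf).Points k⸨X⸩ k⸨X⸩⟮s d⟯ ≃ LevelPoints p f d),
        (∀ r : k⟦X⟧, θ (algebraMap _ _ r) = PowerSeries.expand d hd r) ∧
        (θ.symm PowerSeries.X : k⸨X⸩⟮s d⟯) = IntermediateField.AdjoinSimple.gen k⸨X⸩ (s d) ∧
        (∀ ξ : rootsOfUnity d k, e ξ (IntermediateField.AdjoinSimple.gen k⸨X⸩ (s d)) =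
          algebraMap k⟦X⟧ k⸨X⸩⟮s d⟯ (PowerSeries.C ((ξ : kˣ) : k)) *
            IntermediateField.AdjoinSimple.gen k⸨X⸩ (s d)) ∧
        (∀ (P : (functionCompletion hf).Points k⸨X⸩ k⸨X⸩⟮s d⟯) (ψ : Spec (.of k⟦X⟧) ⟶ X)
          (hψ : ψ ≫ p = specStr k k⟦X⟧) (_ : ψ ≫ f = affineLinePoint (PowerSeries.X ^ d : k⟦X⟧)),
          (φ P).1 = ArcPoints.ofArc ψ hψ ↔
            ∃ (σ : Spec (.of (integralClosure k⟦X⟧ k⸨X⸩⟮s d⟯)) ⟶ baseChangePowerSeries f)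
              (hσ : σ ≫ Limits.pullback.snd _ _ = Spec.map (CommRingCat.ofHom (algebraMap _ _))),
              σ ≫ Limits.pullback.fst _ _ =
                Spec.map (CommRingCat.ofHom θ.symm.toRingHom) ≫ ψ ∧
              IsGenericFiber (functionCompletion.completeSection hf σ hσ) P) ∧
        (∀ P : (functionCompletion hf).Points k⸨X⸩ k⸨X⸩⟮s d⟯,
          ∃ x : Spec (.of k) ⟶ (functionCompletion hf).thickening 0,
            (∀ y, SpecializesTo (PowerSeries.constantCoeff.comp θ.toRingHom) P y ↔ y = x) ∧
            x ≫ functionCompletion.toBase hf = (φ P).1.origin) ∧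
        (∀ (ξ : rootsOfUnity d k) (P : (functionCompletion hf).Points k⸨X⸩ k⸨X⸩⟮s d⟯),
          (φ (P.gal (e ξ))).1 = (φ P).1.rescale ((ξ : kˣ) : k))) ∧
    -- the absolute case
    (∀ (X : Scheme.{u}) (p : X ⟶ Spec (.of k)) [LocallyOfFiniteType p] [QuasiCompact p]
      [IsSeparated p],
      Function.Bijective (fun ψ : {ψ : Spec (.of k⟦X⟧) ⟶ X // ψ ≫ p = specStr k k⟦X⟧} =>
        ArcPoints.ofArc ψ.1 ψ.2) ∧
      ∃ φ : ArcPoints p k ≃ (constantCompletion p).Points k⸨X⸩ k⸨X⸩,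
        (∀ (ψ : Spec (.of k⟦X⟧) ⟶ X) (hψ : ψ ≫ p = specStr k k⟦X⟧)
          (P : (constantCompletion p).Points k⸨X⸩ k⸨X⸩),
          φ (ArcPoints.ofArc ψ hψ) = P ↔
            ∃ (σ : Spec (.of k⟦X⟧) ⟶ Limits.pullback p (specStr k k⟦X⟧))
              (hσ : σ ≫ Limits.pullback.snd _ _ = Spec.map (CommRingCat.ofHom (algebraMap _ _))),
              σ ≫ Limits.pullback.fst _ _ = ψ ∧
              IsGenericFiber (completeSection _ PowerSeries.X σ hσ) P) ∧
        (∀ γ : ArcPoints p k,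
          ∃ x : Spec (.of k) ⟶ (constantCompletion p).thickening 0,
            (∀ y, SpecializesTo (PowerSeries.constantCoeff (R := k)) (φ γ) y ↔ y = x) ∧
            x ≫ constantCompletion.toBase p = γ.origin)) := by
  refine ⟨fun Ω _ _ _ _ _ s hs₁ hs X p _ _ _ _ _ f hf _ d hd => ?_,
    fun X p _ _ _ => ⟨ofArc_bijective, exists_arcPoints_equiv p⟩⟩
  have hgen : IntermediateField.AdjoinSimple.gen k⸨X⸩ (s d) ^ d =
      algebraMap k⟦X⟧ k⸨X⸩⟮s d⟯ PowerSeries.X := Subtype.ext <| by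
    -- Compatibility of the chosen roots at the pair `1, d` says that `s d` is a `d`-th root of `s 1
    -- = t`.
    have h := hs 1 d one_pos (Nat.pos_of_ne_zero hd)
    rw [one_mul, hs₁] at h
    exact h
  have hpow : ∀ x : k⸨X⸩⟮s d⟯, ∃ q : Polynomial k⸨X⸩,
      x = Polynomial.aeval (IntermediateField.AdjoinSimple.gen k⸨X⸩ (s d)) q := fun x =>
    have : Algebra.IsAlgebraic k⸨X⸩ Ω := IsAlgClosure.isAlgebraic
    (IntermediateField.adjoin.powerBasis (Algebra.IsIntegral.isIntegral (s d))).exists_eq_aeval' x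
  obtain ⟨θ, hθ, hθX⟩ := exists_integralClosure_equiv hd hgen hpow
  obtain ⟨e, he⟩ := exists_rootsOfUnity_equiv hd hθ hθX hgen hpow
  obtain ⟨φ, hφ, hsp, hgal⟩ := exists_points_levelPoints_equiv hf hd hθ hθX
  refine ⟨θ, e, φ, hθ, hθX, he, hφ, hsp, fun ξ P => hgal _ ?_ _ (he ξ) P⟩
  exact (Units.val_pow_eq_pow_val _ _).symm.trans (congrArg Units.val ξ.2)
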